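/- **Setting.** Let $T\ge 0$, $d_X^n,d_U^n\ge 0$ and finite mode sets $\mathcal M^n=\{1,\dots,\kappa^n\}$ ($n=0,1$) be given. The system is, for $t=0,\dots,T$, $$X^0_{t+1}=A^{00}(M^0_t)X^0_t+B^{00}(M^0_t)U^0_t+W^0_t,$$ $$X^1_{t+1}=A^{10}(M^{0:1}_t)X^0_t+A^{11}(M^{0:1}_t)X^1_t+B^{10}(M^{0:1}_t)U^0_t+B^{11}(M^{0:1}_t)U^1_t+W^1_t,$$ where $X^n_t,W^n_t\in\mathbb R^{d_X^n}$, $U^n_t\in\mathbb R^{d_U^n}$, $M^n_t\in\mathcal M^n$ and $M^{0:1}_t=(M^0_t,M^1_t)$. The link states $\Gamma_t\in\{0,1\}$ have a law $p$ not depending on $t$, the modes $M^n_t$ have a law $\pi_{M^n}$ not depending on $t$, and $X^n_0\sim\pi_{X^n_0}$, $W^n_t\sim\pi_{W^n_t}$ have finite second moments, $W^n_t$ with mean zero. All the variables $X^n_0,W^n_t,M^n_t,\Gamma_t$ ($n=0,1$, $0\le t\le T$) are independent. The channel outputs are $(Z_t,\tilde Z_t)=(X^1_t,M^1_t)$ if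 $\Gamma_t=1$ and $(\emptyset,\emptyset)$ if $\Gamma_t=0$. The common information is $H^0_t=(X^0_{0:t},M^0_{0:t},Z_{0:t},\tilde Z_{0:t},U^0_{0:t-1})$. The cost is $c_t=X_t^\top Q_t(M^{0:1}_t)X_t+U_t^\top R_t(M^{0:1}_t)U_t$ with $X_t=(X^0_t,X^1_t)$, $U_t=(U^0_t,U^1_t)$, $Q_t(\cdot)$ symmetric positive semidefinite and $R_t(\cdot)$ symmetric positive definite. A prescription strategy $\phi=(\phi^0_t,\phi^1_t)_{0\le t\le T}$ selects, from $h^0_t$, an action $u^0_t=\phi^0_t(h^0_t)\in\mathbb R^{d_U^0}$ and a prescription $\rho_t=\phi^1_t(h^0_t):\mathbb R^{d_X^1}\times\mathcal M^1\to\mathbb R^{d_U^1}$; then $U^0_t=u^0_t$ and $U^1_t=\rho_t(X^1_t,M^1_t)$. It is feasible if $\phi^0_t(h)$ and $[\phi^1_t(h)](x,m)$ are Borel measurable in $h$ and $(h,x,m)$ respectively, and all states and actions $X^n_t$, $U^n_t$ ($0\le t\le T$) have finite second moments. It is optimal if it is feasible and minimizes $\mathbb E\big[\sum_{t=0}^T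 c_t\big]$ among all feasible prescription strategies. Let $\Delta(\mathbb R^d)$ be the set of probability measures on $\mathbb R^d$ with finite second moment, and $\tilde{\mathcal M}^1=\mathcal M^1\cup\{\emptyset\}$. The common belief $\theta_t$ is the conditional distribution of $X^1_t$ given $H^0_t=h^0_t$. Put $\omega^{\emptyset}=\pi_{M^1}$ and $\omega^{l}=\delta_l$ for $l\in\mathcal M^1$. For $u^{prs}=(u^0,\rho)$ let $\psi_t(\theta,u^{prs},x^0,m^0,\tilde z,x^1)=\delta_{x^1}$ for $x^1\in\mathbb R^{d_X^1}$, and let $\psi_t(\theta,u^{prs},x^0,m^0,\tilde z,\emptyset)$ be the law of $$A^{10}(m^0,M)x^0+A^{11}(m^0,M)X+B^{10}(m^0,M)u^0+B^{11}(m^0,M)\rho(X,M)+W$$ for independent $X\sim\theta$, $M\sim\omega^{\tilde z}$, $W\sim\pi_{W^1_t}$. Let $h_2(x^1,m^1)=m^1$ and $$\bar{\mathcal Q}=\{\bar q:\mathcal M^1\to\mathbb R^{d_U^1}\text{ measurable}\},$$ $$\tilde{\mathcal Q}(\theta)=\Big\{\tilde q:\mathbb R^{d_X^1}\times\mathcal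 M^1\to\mathbb R^{d_U^1}\text{ measurable}:\ \tilde q(\cdot,m)\text{ is }\theta\text{-integrable and }\int\tilde q(x,m)\,\theta(dx)=0\ \text{ for all } m\in\mathcal M^1\Big\}.$$ **Theorem.** Suppose there are functions $V_t:\mathbb R^{d_X^0}\times\mathcal M^0\times\Delta(\mathbb R^{d_X^1})\times\tilde{\mathcal M}^1\to\mathbb R$, $t=0,\dots,T+1$, such that $V_{T+1}=0$ and, for all $t=0,\dots,T$ and all $(x^0,m^0,\theta,\tilde z)$, $$V_t(x^0,m^0,\theta,\tilde z)=\min_{u^0\in\mathbb R^{d_U^0},\ \bar q\in\bar{\mathcal Q},\ \tilde q\in\tilde{\mathcal Q}(\theta)}\mathbb E\Big[c_t\big(x^0,X^1_t,m^0,M^1_t,u^0,\rho(X^1_t,M^1_t)\big)+V_{t+1}\big(X^0_{t+1},M^0_{t+1},\psi_t(\theta,u^{prs},x^0,m^0,\tilde z,Z_{t+1}),\tilde Z_{t+1}\big)\Big],$$ where $\rho=\bar q\circ h_2+\tilde q$ and $u^{prs}=(u^0,\rho)$, the minimum being attained. In the expectation, $X^1_t\sim\theta$, $M^1_t\sim\omega^{\tilde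 z}$, $W^{0}_t$, $W^1_t$, $M^{0}_{t+1}$, $M^1_{t+1}$, $\Gamma_{t+1}$ are independent, the last five with their given laws; $X^{0}_{t+1}$, $X^1_{t+1}$ are obtained from the dynamics with $X^0_t=x^0$, $M^0_t=m^0$, $U^0_t=u^0$, $U^1_t=\rho(X^1_t,M^1_t)$; and $(Z_{t+1},\tilde Z_{t+1})$ from the channel. The expectation is taken in $[0,\infty]$ (as a lower integral should $V_{t+1}$ not be measurable, with $V_{t+1}=\infty$ where the updated belief is outside $\Delta$, which happens only if the expected cost is already infinite). Suppose further that $\phi^*$ is a feasible prescription strategy such that, for every $t=0,\dots,T$ and almost every realization $h^0_t$ of the common information under $\phi^*$, with corresponding common belief $\theta_t$, the prescription $\phi^*_t(h^0_t)$ has the form $(u^{0*}_t,\bar q^*_t\circ h_2+\tilde q^*_t)$ with $\bar q^*_t\in\bar{\mathcal Q}$, $\tilde q^*_t\in\tilde{\mathcal Q}(\theta_t)$ and achieves the minimum in the definition of $V_t(x^0_t,m^0_t,\theta_t,\tilde z_t)$. Then $\phi^*$ is an optimal prescription strategy. -/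

import Mathlib

open MeasureTheory ProbabilityTheory
open scoped Matrix ENNReal

noncomputable section

namespace SwitchedNCS

/-- Vectors of `ℝⁿ`. Only second moments are ever measured by the norm, and all norms of `ℝⁿ` give
the same notion of finite second moment. -/
abbrev Vec (n : ℕ) : Type := Fin n → ℝ

/-- Disjoint-union σ-algebra on `α ∪ {∅}`: a set is measurable iff its trace on `α` is. -/
instance instMeasurableSpaceOption {α : Type*} [m : MeasurableSpace α] :
    MeasurableSpace (Option α) :=
  m.map some

/-- The set `Δ(ℝⁿ)` of probability measures on `ℝⁿ` with finite second moment. -/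
def IsBelief {n : ℕ} (θ : Measure (Vec n)) : Prop :=
  IsProbabilityMeasure θ ∧ MemLp (fun x : Vec n => x) 2 θ

/-- `Δ(ℝⁿ)` as a type. -/
abbrev Belief (n : ℕ) : Type := {θ : Measure (Vec n) // IsBelief θ}

/-- The data of the switched linear system: horizon, dimensions, numbers of modes, system matrices,
cost matrices, and the distributions of the primitive random variables. -/
structure System where
  T : ℕ
  dX0 : ℕ
  dX1 : ℕ
  dU0 : ℕ
  dU1 : ℕ
  κ0 : ℕ
  κ1 : ℕ
  A00 : Fin κ0 → Matrix (Fin dX0) (Fin dX0) ℝ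
  A10 : Fin κ0 → Fin κ1 → Matrix (Fin dX1) (Fin dX0) ℝ
  A11 : Fin κ0 → Fin κ1 → Matrix (Fin dX1) (Fin dX1) ℝ
  B00 : Fin κ0 → Matrix (Fin dX0) (Fin dU0) ℝ
  B10 : Fin κ0 → Fin κ1 → Matrix (Fin dX1) (Fin dU0) ℝ
  B11 : Fin κ0 → Fin κ1 → Matrix (Fin dX1) (Fin dU1) ℝ
  Q : ℕ → Fin κ0 → Fin κ1 → Matrix (Fin dX0 ⊕ Fin dX1) (Fin dX0 ⊕ Fin dX1) ℝ
  R : ℕ → Fin κ0 → Fin κ1 → Matrix (Fin dU0 ⊕ Fin dU1) (Fin dU0 ⊕ Fin dU1) ℝ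
  posSemidef_Q : ∀ t ≤ T, ∀ m0 m1, (Q t m0 m1).PosSemidef
  posDef_R : ∀ t ≤ T, ∀ m0 m1, (R t m0 m1).PosDef
  /-- laws of the initial states -/
  πX0 : Measure (Vec dX0)
  πX1 : Measure (Vec dX1)
  isBelief_πX0 : IsBelief πX0
  isBelief_πX1 : IsBelief πX1
  /-- laws of the noises at each time -/
  πW0 : ℕ → Measure (Vec dX0)
  πW1 : ℕ → Measure (Vec dX1)
  isBelief_πW0 : ∀ t ≤ T, IsBelief (πW0 t)
  isBelief_πW1 : ∀ t ≤ T, IsBelief (πW1 t)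
  mean_πW0 : ∀ t ≤ T, ∫ w, w ∂(πW0 t) = 0
  mean_πW1 : ∀ t ≤ T, ∫ w, w ∂(πW1 t) = 0
  /-- laws of the modes -/
  πM0 : Measure (Fin κ0)
  πM1 : Measure (Fin κ1)
  isProb_πM0 : IsProbabilityMeasure πM0
  isProb_πM1 : IsProbabilityMeasure πM1
  /-- law of the link state; `true` means that the packet arrives -/
  p : Measure Bool
  isProb_p : IsProbabilityMeasure p

namespace System

variable (S : System)

/-- Global plant: `X⁰_{t+1}` as a function of the time-`t` quantities. -/
def next0 (x0 : Vec S.dX0) (m0 : Fin S.κ0) (u0 : Vec S.dU0) (w0 : Vec S.dX0) : Vec S.dX0 :=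
  S.A00 m0 *ᵥ x0 + S.B00 m0 *ᵥ u0 + w0

/-- Local plant: `X¹_{t+1}` as a function of the time-`t` quantities. -/
def next1 (x0 : Vec S.dX0) (x1 : Vec S.dX1) (m0 : Fin S.κ0) (m1 : Fin S.κ1)
    (u0 : Vec S.dU0) (u1 : Vec S.dU1) (w1 : Vec S.dX1) : Vec S.dX1 :=
  S.A10 m0 m1 *ᵥ x0 + S.A11 m0 m1 *ᵥ x1 + S.B10 m0 m1 *ᵥ u0 + S.B11 m0 m1 *ᵥ u1 + w1

/-- The instantaneous cost `c_t`. -/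
def cost (t : ℕ) (x0 : Vec S.dX0) (x1 : Vec S.dX1) (m0 : Fin S.κ0) (m1 : Fin S.κ1)
    (u0 : Vec S.dU0) (u1 : Vec S.dU1) : ℝ :=
  Sum.elim x0 x1 ⬝ᵥ (S.Q t m0 m1 *ᵥ Sum.elim x0 x1) +
    Sum.elim u0 u1 ⬝ᵥ (S.R t m0 m1 *ᵥ Sum.elim u0 u1)

/-- The channel: the input arrives if the link is up, and `∅` (that is, `none`) is received
otherwise. -/
def channel {α : Type*} (γ : Bool) (a : α) : Option α := if γ then some a else none

/-! ### Primitive random variables -/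

/-- Names of the primitive random variables. -/
inductive Src (T : ℕ) : Type
  | x0 : Src T
  | x1 : Src T
  | w0 : Fin (T + 1) → Src T
  | w1 : Fin (T + 1) → Src T
  | m0 : Fin (T + 1) → Src T
  | m1 : Fin (T + 1) → Src T
  | link : Fin (T + 1) → Src T

/-- The space in which each primitive random variable takes its values. -/
def SrcVal : Src S.T → Type
  | .x0 => Vec S.dX0
  | .x1 => Vec S.dX1
  | .w0 _ => Vec S.dX0
  | .w1 _ => Vec S.dX1
  | .m0 _ => Fin S.κ0
  | .m1 _ => Fin S.κ1
  | .link _ => Bool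

instance instMeasurableSpaceSrcVal : ∀ i : Src S.T, MeasurableSpace (S.SrcVal i)
  | .x0 => inferInstanceAs (MeasurableSpace (Vec S.dX0))
  | .x1 => inferInstanceAs (MeasurableSpace (Vec S.dX1))
  | .w0 _ => inferInstanceAs (MeasurableSpace (Vec S.dX0))
  | .w1 _ => inferInstanceAs (MeasurableSpace (Vec S.dX1))
  | .m0 _ => inferInstanceAs (MeasurableSpace (Fin S.κ0))
  | .m1 _ => inferInstanceAs (MeasurableSpace (Fin S.κ1))
  | .link _ => inferInstanceAs (MeasurableSpace Bool)

/-- The law of each primitive random variable. -/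
def srcLaw : ∀ i : Src S.T, Measure (S.SrcVal i)
  | .x0 => S.πX0
  | .x1 => S.πX1
  | .w0 t => S.πW0 t
  | .w1 t => S.πW1 t
  | .m0 _ => S.πM0
  | .m1 _ => S.πM1
  | .link _ => S.p

/-- The initial states, noises, modes and link states. Values at times after the horizon are
never used. -/
structure Sources (Ω : Type*) where
  X0 : Ω → Vec S.dX0
  X1 : Ω → Vec S.dX1
  W0 : ℕ → Ω → Vec S.dX0
  W1 : ℕ → Ω → Vec S.dX1
  M0 : ℕ → Ω → Fin S.κ0
  M1 : ℕ → Ω → Fin S.κ1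
  link : ℕ → Ω → Bool

variable {S}

/-- The primitive random variables up to the horizon, as one family. -/
def Sources.rv {Ω : Type*} (ξ : S.Sources Ω) : ∀ i : Src S.T, Ω → S.SrcVal i
  | .x0 => ξ.X0
  | .x1 => ξ.X1
  | .w0 t => ξ.W0 t
  | .w1 t => ξ.W1 t
  | .m0 t => ξ.M0 t
  | .m1 t => ξ.M1 t
  | .link t => ξ.link t

/-- The primitive random variables are measurable, have the prescribed distributions, and are
(jointly) independent. -/
structure Sources.Admissible {Ω : Type*} [MeasurableSpace Ω] (ξ : S.Sources Ω)
    (P : Measure Ω) : Prop where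
  measurable : ∀ i, Measurable (ξ.rv i)
  law : ∀ i, P.map (ξ.rv i) = S.srcLaw i
  indep : iIndepFun ξ.rv P

variable (S)

/-! ### Information and prescription strategies -/

/-- What becomes commonly known at each time: `(x⁰_t, m⁰_t, z_t, z̃_t)`. -/
abbrev Obs : Type := Vec S.dX0 × Fin S.κ0 × Option (Vec S.dX1) × Option (Fin S.κ1)

/-- The space of common information
`h⁰_t = (x⁰_{0:t}, m⁰_{0:t}, z_{0:t}, z̃_{0:t}, u⁰_{0:t-1})`, arranged chronologically. -/
def Hist : ℕ → Type
  | 0 => S.Obs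
  | t + 1 => Hist t × Vec S.dU0 × S.Obs

instance instMeasurableSpaceHist : ∀ t : ℕ, MeasurableSpace (S.Hist t)
  | 0 => inferInstanceAs (MeasurableSpace S.Obs)
  | t + 1 =>
    letI := instMeasurableSpaceHist t
    inferInstanceAs (MeasurableSpace (S.Hist t × Vec S.dU0 × S.Obs))

variable {S}

/-- The most recent observation `(x⁰_t, m⁰_t, z_t, z̃_t)` in `h⁰_t`. -/
def Hist.last : ∀ {t : ℕ}, S.Hist t → S.Obs
  | 0, h => h
  | _ + 1, h => h.2.2

/-- `x⁰_t` -/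
def Hist.x0 {t : ℕ} (h : S.Hist t) : Vec S.dX0 := h.last.1

/-- `m⁰_t` -/
def Hist.m0 {t : ℕ} (h : S.Hist t) : Fin S.κ0 := h.last.2.1

/-- `z̃_t` -/
def Hist.zTilde {t : ℕ} (h : S.Hist t) : Option (Fin S.κ1) := h.last.2.2.2

variable (S)

/-- Prescriptions for the local controller: maps from (local state, local mode) to actions.
The space `𝒫` consists of the measurable ones. -/
abbrev Presc : Type := Vec S.dX1 × Fin S.κ1 → Vec S.dU1

/-- A prescription strategy: `act t` is `φ⁰_t` and `presc t` is `φ¹_t`. -/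
structure Strategy where
  act : (t : ℕ) → S.Hist t → Vec S.dU0
  presc : (t : ℕ) → S.Hist t → S.Presc

variable {S}

section ClosedLoop

variable {Ω : Type*} (ξ : S.Sources Ω) (φ : S.Strategy)

/-- The pair `(H⁰_t, X¹_t)` when the strategy `φ` is used. -/
def loop : (t : ℕ) → Ω → S.Hist t × Vec S.dX1
  | 0, ω =>
    ((ξ.X0 ω, ξ.M0 0 ω, channel (ξ.link 0 ω) (ξ.X1 ω), channel (ξ.link 0 ω) (ξ.M1 0 ω)), ξ.X1 ω)
  | t + 1, ω =>
    let h := (loop t ω).1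
    let x1 := (loop t ω).2
    let u0 := φ.act t h
    let u1 := φ.presc t h (x1, ξ.M1 t ω)
    let x0' := S.next0 h.x0 (ξ.M0 t ω) u0 (ξ.W0 t ω)
    let x1' := S.next1 h.x0 x1 (ξ.M0 t ω) (ξ.M1 t ω) u0 u1 (ξ.W1 t ω)
    ((h, u0, x0', ξ.M0 (t + 1) ω, channel (ξ.link (t + 1) ω) x1',
      channel (ξ.link (t + 1) ω) (ξ.M1 (t + 1) ω)), x1')

/-- The common information `H⁰_t`. -/
def commonInfo (t : ℕ) (ω : Ω) : S.Hist t := (loop ξ φ t ω).1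

/-- The state `X⁰_t`. -/
def state0 (t : ℕ) (ω : Ω) : Vec S.dX0 := (commonInfo ξ φ t ω).x0

/-- The state `X¹_t`. -/
def state1 (t : ℕ) (ω : Ω) : Vec S.dX1 := (loop ξ φ t ω).2

/-- The action `U⁰_t`. -/
def action0 (t : ℕ) (ω : Ω) : Vec S.dU0 := φ.act t (commonInfo ξ φ t ω)

/-- The action `U¹_t`, given by applying the prescription to `(X¹_t, M¹_t)`. -/
def action1 (t : ℕ) (ω : Ω) : Vec S.dU1 :=
  φ.presc t (commonInfo ξ φ t ω) (state1 ξ φ t ω, ξ.M1 t ω)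

/-- The set `Φ^prs` of feasible prescription strategies: Borel measurable, with all states and
actions of finite second moment. -/
structure Feasible [MeasurableSpace Ω] (P : Measure Ω) : Prop where
  measurable_act : ∀ t ≤ S.T, Measurable (φ.act t)
  measurable_presc : ∀ t ≤ S.T,
    Measurable fun a : S.Hist t × (Vec S.dX1 × Fin S.κ1) => φ.presc t a.1 a.2
  memLp_state0 : ∀ t ≤ S.T, MemLp (state0 ξ φ t) 2 P
  memLp_state1 : ∀ t ≤ S.T, MemLp (state1 ξ φ t) 2 P
  memLp_action0 : ∀ t ≤ S.T, MemLp (action0 ξ φ t) 2 P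
  memLp_action1 : ∀ t ≤ S.T, MemLp (action1 ξ φ t) 2 P

/-- The expected total cost. The cost is nonnegative, so its expectation is taken in `[0, ∞]`. -/
def totalCost [MeasurableSpace Ω] (P : Measure Ω) : ℝ≥0∞ :=
  ∫⁻ ω, ∑ t ∈ Finset.range (S.T + 1), ENNReal.ofReal
    (S.cost t (state0 ξ φ t ω) (state1 ξ φ t ω) (ξ.M0 t ω) (ξ.M1 t ω)
      (action0 ξ φ t ω) (action1 ξ φ t ω)) ∂P

/-- `φ` is an optimal prescription strategy for the equivalent centralized problem. -/
def IsOptimal [MeasurableSpace Ω] (P : Measure Ω) : Prop :=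
  Feasible ξ φ P ∧ ∀ φ' : S.Strategy, Feasible ξ φ' P → totalCost ξ φ P ≤ totalCost ξ φ' P

/-- The common belief `θ_t`: the conditional distribution of `X¹_t` given `H⁰_t`, evaluated at the
realized common information. -/
def commonBelief [MeasurableSpace Ω] (P : Measure Ω) [IsFiniteMeasure P] (t : ℕ) (ω : Ω) :
    Measure (Vec S.dX1) :=
  condDistrib (state1 ξ φ t) (commonInfo ξ φ t) P (commonInfo ξ φ t ω)

end ClosedLoop

variable (S)

/-! ### The dynamic program -/

/-- `ω^{z̃}`, the common belief on the local mode. -/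
def modeBelief : Option (Fin S.κ1) → Measure (Fin S.κ1)
  | none => S.πM1
  | some l => Measure.dirac l

/-- The belief update `ψ_t(θ, (u⁰, ρ), x⁰, m⁰, z̃, z')`. -/
def beliefUpdate (t : ℕ) (θ : Measure (Vec S.dX1)) (u0 : Vec S.dU0) (ρ : S.Presc)
    (x0 : Vec S.dX0) (m0 : Fin S.κ0) (zt : Option (Fin S.κ1)) :
    Option (Vec S.dX1) → Measure (Vec S.dX1)
  | some x1' => Measure.dirac x1'
  | none =>
    (θ.prod ((S.modeBelief zt).prod (S.πW1 t))).map
      fun a => S.next1 x0 a.1 m0 a.2.1 u0 (ρ (a.1, a.2.1)) a.2.2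

/-- Candidate value functions `V_t : ℝ^{d_X^0} × 𝓜⁰ × Δ(ℝ^{d_X^1}) × (𝓜¹ ∪ {∅}) → ℝ`. -/
abbrev ValueFn : Type :=
  Vec S.dX0 → Fin S.κ0 → Belief S.dX1 → Option (Fin S.κ1) → ℝ

open Classical in
/-- A value function read with values in `[0, ∞]`, and as `∞` at distributions outside `Δ`. (The
value functions below are nonnegative, and an updated belief lies outside `Δ` only if the expected
instantaneous cost is already infinite, because `R_t` is positive definite.) -/
def ValueFn.ext {S : System} (V : S.ValueFn) (x0 : Vec S.dX0) (m0 : Fin S.κ0)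
    (θ : Measure (Vec S.dX1)) (zt : Option (Fin S.κ1)) : ℝ≥0∞ :=
  if hθ : IsBelief θ then ENNReal.ofReal (V x0 m0 ⟨θ, hθ⟩ zt) else ∞

/-- The expression that is minimized at time `t` of the dynamic program, for the prescription
`(u⁰, ρ)` and with `V` in the role of `V_{t+1}`. The components of the integration variable `a`
are the independent random variables
`X¹_t ∼ θ`, `M¹_t ∼ ω^{z̃}`, `W⁰_t`, `W¹_t`, `M⁰_{t+1}`, `M¹_{t+1}`, `Γ_{t+1}`. -/
def stageValue (t : ℕ) (V : S.ValueFn) (x0 : Vec S.dX0) (m0 : Fin S.κ0)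
    (θ : Measure (Vec S.dX1)) (zt : Option (Fin S.κ1)) (u0 : Vec S.dU0) (ρ : S.Presc) : ℝ≥0∞ :=
  ∫⁻ a : Vec S.dX1 × Fin S.κ1 × Vec S.dX0 × Vec S.dX1 × Fin S.κ0 × Fin S.κ1 × Bool,
    (let x1 := a.1
     let m1 := a.2.1
     let w0 := a.2.2.1
     let w1 := a.2.2.2.1
     let m0' := a.2.2.2.2.1
     let m1' := a.2.2.2.2.2.1
     let γ' := a.2.2.2.2.2.2
     let u1 := ρ (x1, m1)
     let x0' := S.next0 x0 m0 u0 w0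
     let x1' := S.next1 x0 x1 m0 m1 u0 u1 w1
     ENNReal.ofReal (S.cost t x0 x1 m0 m1 u0 u1) +
       V.ext x0' m0' (S.beliefUpdate t θ u0 ρ x0 m0 zt (channel γ' x1')) (channel γ' m1'))
    ∂(θ.prod ((S.modeBelief zt).prod ((S.πW0 t).prod ((S.πW1 t).prod
      (S.πM0.prod (S.πM1.prod S.p))))))

/-- The set `𝒬̄` of (measurable) functions of the local mode. -/
def QBar : Set (Fin S.κ1 → Vec S.dU1) := {q | Measurable q}

/-- The set `𝒬̃(θ)` of measurable prescriptions with zero mean under `θ` for every local mode. -/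
def QTilde (θ : Measure (Vec S.dX1)) : Set S.Presc :=
  {q | Measurable q ∧
    ∀ m1, Integrable (fun x1 => q (x1, m1)) θ ∧ ∫ x1, q (x1, m1) ∂θ = 0}

/-- The prescription `q̄ ∘ h₂ + q̃`, where `h₂(x¹, m¹) = m¹`. -/
def combine (qb : Fin S.κ1 → Vec S.dU1) (qt : S.Presc) : S.Presc := qb ∘ Prod.snd + qt

/-- `V_0, …, V_{T+1}` solve the dynamic program whose minimization runs over
`u⁰`, `q̄ ∈ 𝒬̄` and `q̃ ∈ 𝒬̃(θ)`. -/
structure SolvesDP (V : ℕ → S.ValueFn) : Prop where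
  terminal : ∀ x0 m0 θ zt, V (S.T + 1) x0 m0 θ zt = 0
  step : ∀ t ≤ S.T, ∀ x0 m0 (θ : Belief S.dX1) zt,
    IsLeast
      {y : EReal | ∃ u0, ∃ qb ∈ S.QBar, ∃ qt ∈ S.QTilde θ.1,
        y = (S.stageValue t (V (t + 1)) x0 m0 θ.1 zt u0 (S.combine qb qt) : EReal)}
      ((V t x0 m0 θ zt : ℝ) : EReal)

variable {S}

/-- At (almost) every realization of the common information, with the corresponding common belief
`θ_t`, the prescription selected by `φ` is of the form `(u⁰, q̄ ∘ h₂ + q̃)` with `q̄ ∈ 𝒬̄`,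
`q̃ ∈ 𝒬̃(θ_t)`, and achieves the minimum in the definition of `V_t`. -/
def AchievesMin {Ω : Type*} [MeasurableSpace Ω] (ξ : S.Sources Ω) (φ : S.Strategy)
    (P : Measure Ω) [IsFiniteMeasure P] (V : ℕ → S.ValueFn) : Prop :=
  ∀ t ≤ S.T, ∀ᵐ ω ∂P, ∀ hθ : IsBelief (commonBelief ξ φ P t ω),
    let h := commonInfo ξ φ t ω
    let θ : Belief S.dX1 := ⟨commonBelief ξ φ P t ω, hθ⟩
    ∃ qb ∈ S.QBar, ∃ qt ∈ S.QTilde θ.1,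
      φ.presc t h = S.combine qb qt ∧
      (S.stageValue t (V (t + 1)) h.x0 h.m0 θ.1 h.zTilde (φ.act t h) (S.combine qb qt) : EReal) =
        ((V t h.x0 h.m0 θ h.zTilde : ℝ) : EReal)

end System

end SwitchedNCS

end

open SwitchedNCS

/-! The result is a verification theorem: along any feasible strategy the value functions at the
realized beliefs never exceed expected cost plus expected value at the next time, with equality
where the minimum is attained. Telescoping gives the bound E[V_0] ≤ cost for every feasible strategy
and the reverse inequality for the given one. The time-0 value is the same for all strategies, since
nothing has been controlled yet.

Three points need an argument. (1) The `V t` are arbitrary functions, so their measurability along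
random beliefs, needed for any tower property, is not given. Backward induction shows that
`SolvesDP` forces each `V t` to be quadratic (`SolvesDP.isQuadratic`): a form in the global state
and the mean of the belief, plus the integral of a form of the deviation from the mean, plus a
constant. The reason is that means, deviations given the mode, and noises are mutually uncorrelated,
so the stage value splits accordingly (`exists_stageValue_eq`), and completing squares minimizes
each piece separately by a linear map (`exists_min_stageValue`).

(2) The dynamic program minimizes only over prescriptions q̄ ∘ h₂ + q̃, while a competitor may use
any measurable one. The quadratic lower bound is therefore proved for all measurable prescriptions.
If the stage value is infinite there is nothing to prove; if finite, positive definiteness of R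
makes the prescription square integrable at every mode of positive probability, and the other modes
do not count.

(3) The conditional law of the local state must follow the update ψ under every measurable strategy.
Given the common information, the local state, mode and noise are independent, with the mode
distributed as ω^{z̃} (`lintegral_mode`, `lintegral_step`); uniqueness of conditional distributions
then gives the recursion (`beliefKernel_succ_ae_eq`) and with it the tower property
`lintegral_pathStage`. -/

noncomputable section

set_option linter.unusedSectionVars false

namespace SwitchedNCS

/-! ### Nonnegative quadratic forms and completion of the square -/

section Forms

variable {E F X U : Type*} [NormedAddCommGroup E] [NormedSpace ℝ E]
  [NormedAddCommGroup F] [NormedSpace ℝ F]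
  [NormedAddCommGroup X] [NormedSpace ℝ X] [NormedAddCommGroup U] [NormedSpace ℝ U]

/-- A function that is a nonnegative (continuous) quadratic form. -/
def IsPSDForm (q : E → ℝ) : Prop :=
  ∃ B : E →L[ℝ] E →L[ℝ] ℝ, (∀ x y, B x y = B y x) ∧ (∀ x, 0 ≤ B x x) ∧ ∀ x, q x = B x x

namespace IsPSDForm

variable {q q' : E → ℝ}

lemma nonneg (hq : IsPSDForm q) (x : E) : 0 ≤ q x := by
  obtain ⟨B, -, h, e⟩ := hq
  rw [e]; exact h x

lemma map_zero (hq : IsPSDForm q) : q 0 = 0 := by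
  obtain ⟨B, -, h, e⟩ := hq
  simp [e]

lemma continuous (hq : IsPSDForm q) : Continuous q := by
  obtain ⟨B, -, h, e⟩ := hq
  rw [funext e]
  fun_prop

lemma zero : IsPSDForm (fun _ : E => (0 : ℝ)) := ⟨0, by simp, by simp, by simp⟩

lemma add (hq : IsPSDForm q) (hq' : IsPSDForm q') : IsPSDForm (fun x => q x + q' x) := by
  obtain ⟨B, h1, h2, h3⟩ := hq
  obtain ⟨B', h1', h2', h3'⟩ := hq'
  refine ⟨B + B', fun x y => ?_, fun x => ?_, fun x => ?_⟩
  · simp [h1 x y, h1' x y]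
  · simpa using add_nonneg (h2 x) (h2' x)
  · simp [h3, h3']

lemma const_mul (hq : IsPSDForm q) {c : ℝ} (hc : 0 ≤ c) : IsPSDForm (fun x => c * q x) := by
  obtain ⟨B, h1, h2, h3⟩ := hq
  refine ⟨c • B, fun x y => ?_, fun x => ?_, fun x => ?_⟩
  · simp [h1 x y]
  · simpa using mul_nonneg hc (h2 x)
  · simp [h3]

lemma sum {ι : Type*} (s : Finset ι) {f : ι → E → ℝ} (hf : ∀ i, IsPSDForm (f i)) :
    IsPSDForm (fun x => ∑ i ∈ s, f i x) := by
  classical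
  induction s using Finset.induction_on with
  | empty => simpa using zero
  | insert a s ha ih => simpa [Finset.sum_insert ha] using (hf a).add ih

lemma comp [FiniteDimensional ℝ F] (hq : IsPSDForm q) {f : F → E} (hf : IsLinearMap ℝ f) :
    IsPSDForm (fun x => q (f x)) := by
  obtain ⟨B, h1, h2, h3⟩ := hq
  let g : F →L[ℝ] E := LinearMap.toContinuousLinearMap hf.mk'
  have hg : ∀ x, g x = f x := fun x => rfl
  refine ⟨B.bilinearComp g g, fun x y => ?_, fun x => ?_, fun x => ?_⟩
  · simpa using h1 _ _
  · simpa using h2 _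
  · simp [h3, hg]

lemma of_linear [FiniteDimensional ℝ E] (B : E →ₗ[ℝ] E →ₗ[ℝ] ℝ) (h1 : ∀ x y, B x y = B y x)
    (h2 : ∀ x, 0 ≤ B x x) : IsPSDForm (fun x => B x x) := by
  let B' : E →L[ℝ] E →L[ℝ] ℝ := LinearMap.toContinuousLinearMap
    ((LinearMap.toContinuousLinearMap (𝕜 := ℝ) (E := E) (F' := ℝ)).toLinearMap ∘ₗ B)
  have hB : ∀ x y, B' x y = B x y := fun x y => rfl
  exact ⟨B', fun x y => by simpa [hB] using h1 x y, fun x => by simpa [hB] using h2 x,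
    fun x => by simp [hB]⟩

/-- Completing the square in the second variable. -/
lemma exists_complete_square [FiniteDimensional ℝ X] [FiniteDimensional ℝ U] {q : X × U → ℝ}
    (hq : IsPSDForm q) :
    ∃ L : X →ₗ[ℝ] U, ∀ x u, q (x, u) = q (x, L x) + q (0, u - L x) := by
  obtain ⟨B, h1, h2, h3⟩ := hq
  -- No definiteness in the second variable is available, because modes of probability zero will
  -- make the form degenerate. Isotropic vectors of a semidefinite form lie in its kernel: otherwise
  -- the multiple of `u` chosen below brings the value of the form down to -1.
  have hker : ∀ u, B u u = 0 → ∀ y, B y u = 0 := by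
    intro u hu y
    by_contra hne
    have h := h2 (y + (-(B y y + 1) / (2 * B y u)) • u)
    simp only [_root_.map_add, _root_.map_smul, add_apply,
      smul_apply, hu, h1 u y, smul_eq_mul] at h
    have : -(B y y + 1) / (2 * B y u) * B y u = -(B y y + 1) / 2 := by field_simp
    rw [this] at h
    linarith
  let b : U →ₗ[ℝ] Module.Dual ℝ U :=
    LinearMap.mk₂ ℝ (fun u v => B (0, u) (0, v))
      (fun u v w => by
        rw [show ((0 : X), u + v) = (0, u) + (0, v) by simp]; simp only [_root_.map_add]; rfl)
      (fun c u v => by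
        rw [show ((0 : X), c • u) = c • ((0 : X), u) by simp]; simp only [_root_.map_smul]; rfl)
      (fun u v w => by
        rw [show ((0 : X), v + w) = (0, v) + (0, w) by simp]; simp only [_root_.map_add])
      (fun c u v => by
        rw [show ((0 : X), c • v) = c • ((0 : X), v) by simp]; simp only [_root_.map_smul])
  let C : X →ₗ[ℝ] Module.Dual ℝ U :=
    LinearMap.mk₂ ℝ (fun x v => B (x, 0) (0, v))
      (fun u v w => by
        rw [show (u + v, (0 : U)) = (u, 0) + (v, 0) by simp]; simp only [_root_.map_add]; rfl)
      (fun c u v => by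
        rw [show (c • u, (0 : U)) = c • (u, (0 : U)) by simp]; simp only [_root_.map_smul]; rfl)
      (fun u v w => by
        rw [show ((0 : X), v + w) = (0, v) + (0, w) by simp]; simp only [_root_.map_add])
      (fun c u v => by
        rw [show ((0 : X), c • v) = c • ((0 : X), v) by simp]; simp only [_root_.map_smul])
  have hb : ∀ u v, b u v = B (0, u) (0, v) := fun u v => rfl
  have hC : ∀ u v, C u v = B (u, 0) (0, v) := fun u v => rfl
  -- This replaces invertibility of `b`. Symmetry gives one inclusion, rank and nullity the
  -- equality; by `hker` the cross terms `C x` vanish on the kernel of `b` and so lie in its range.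
  have hrange : LinearMap.range b = (LinearMap.ker b).dualAnnihilator := by
    apply Submodule.eq_of_le_of_finrank_eq
    · rintro _ ⟨u, rfl⟩
      rw [Submodule.mem_dualAnnihilator]
      intro w hw
      rw [hb, h1, ← hb, LinearMap.mem_ker.1 hw, LinearMap.zero_apply]
    · have e1 := LinearMap.finrank_range_add_finrank_ker b
      have e2 := Subspace.finrank_add_finrank_dualAnnihilator_eq (LinearMap.ker b)
      omega
  have hCr : ∀ x, C x ∈ LinearMap.range b := by
    intro x
    rw [hrange, Submodule.mem_dualAnnihilator]
    intro u hu
    rw [hC]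
    apply hker
    rw [← hb, LinearMap.mem_ker.1 hu, LinearMap.zero_apply]
  choose g hg using hCr
  let bX := Module.Basis.ofVectorSpace ℝ X
  -- The chosen preimages `g` need not depend linearly on `x`; prescribing them on a basis only
  -- makes `L` linear.
  let L : X →ₗ[ℝ] U := bX.constr ℝ fun i => -g (bX i)
  have hbL : b ∘ₗ L = -C := bX.ext fun i => by
    rw [LinearMap.comp_apply, Module.Basis.constr_basis, _root_.map_neg, hg, LinearMap.neg_apply]
  have hL : ∀ x v, B (0, L x) (0, v) = - B (x, 0) (0, v) := by
    intro x v
    rw [← hb, ← hC]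
    exact congrArg (fun z : Module.Dual ℝ U => z v) (LinearMap.congr_fun hbL x)
  refine ⟨L, fun x u => ?_⟩
  have hx : (x, u) = (x, L x) + (0, u - L x) := by simp
  have hcross : B (x, L x) (0, u - L x) = 0 := by
    rw [show (x, L x) = (x, 0) + (0, L x) by simp, _root_.map_add, add_apply,
      hL]
    ring
  rw [h3 (x, u), hx]
  simp only [_root_.map_add, add_apply]
  rw [h1 (0, u - L x) (x, L x), hcross, h3, h3]
  ring

section Integral

variable {α : Type*} [MeasurableSpace α] {μ : Measure α}

lemma integrable [MeasurableSpace E] [BorelSpace E] [SecondCountableTopology E]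
    (hq : IsPSDForm q) {Y : α → E} (hY : MemLp Y 2 μ) : Integrable (fun a => q (Y a)) μ := by
  have hc := hq.continuous
  obtain ⟨B, h1, h2, h3⟩ := hq
  refine Integrable.mono' (hY.integrable_norm_pow (p := 2) (by norm_num) |>.const_mul ‖B‖)
    (hc.comp_aestronglyMeasurable hY.1) (ae_of_all _ fun a => ?_)
  rw [h3]
  refine (B.le_opNorm₂ _ _).trans (le_of_eq ?_)
  ring

/-- The expectation of a quadratic form of a random vector splits into the contributions of the
mean and of the deviation. -/
lemma integral_add [CompleteSpace E] [MeasurableSpace E] [BorelSpace E] [SecondCountableTopology E]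
    [IsProbabilityMeasure μ] (hq : IsPSDForm q) {Y : α → E} (hY : MemLp Y 2 μ)
    (hY0 : ∫ a, Y a ∂μ = 0) (c : E) :
    ∫ a, q (c + Y a) ∂μ = q c + ∫ a, q (Y a) ∂μ := by
  have hi := hq.integrable hY
  obtain ⟨B, h1, h2, h3⟩ := hq
  have hYi : Integrable Y μ := hY.integrable (by norm_num)
  -- The cross term is a continuous linear functional of `Y`, so its integral is its value at the
  -- mean, which is zero.
  have e : ∀ a, q (c + Y a) = q c + ((2 • B c) (Y a) + q (Y a)) := by
    intro a
    simp only [h3, _root_.map_add, add_apply, h1 (Y a) c,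
      smul_apply, nsmul_eq_mul]
    push_cast
    ring
  have hlin : Integrable (fun a => (2 • B c) (Y a)) μ := ContinuousLinearMap.integrable_comp _ hYi
  have h0 : ∫ a, (2 • B c) (Y a) ∂μ = 0 := by
    rw [ContinuousLinearMap.integral_comp_comm _ hYi, hY0, _root_.map_zero]
  simp_rw [e]
  rw [MeasureTheory.integral_add (g := fun a => (2 • B c) (Y a) + q (Y a)) (integrable_const _)
    (hlin.add hi), MeasureTheory.integral_add hlin hi, h0]
  simp

end Integral

end IsPSDForm

lemma isPSDForm_matrix {ι : Type*} [Fintype ι] {A : Matrix ι ι ℝ} (hA : A.PosSemidef) :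
    IsPSDForm (fun v : ι → ℝ => v ⬝ᵥ (A *ᵥ v)) := by
  classical
  have := IsPSDForm.of_linear (Matrix.toLinearMap₂' ℝ A) (fun x y => ?_) (fun x => ?_)
  · simpa only [Matrix.toLinearMap₂'_apply'] using this
  · rw [Matrix.toLinearMap₂'_apply', Matrix.toLinearMap₂'_apply', Matrix.dotProduct_mulVec,
      ← Matrix.mulVec_transpose, dotProduct_comm]
    have : Aᵀ = A := by simpa using hA.isHermitian.eq
    rw [this]
  · rw [Matrix.toLinearMap₂'_apply']
    simpa using hA.dotProduct_mulVec_nonneg x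

/-- A positive definite matrix is bounded below by a multiple of the identity. -/
lemma exists_le_posDef {ι : Type*} [Fintype ι] {A : Matrix ι ι ℝ} (hA : A.PosDef) :
    ∃ ε : ℝ, 0 < ε ∧ ∀ v : ι → ℝ, ε * ‖v‖ ^ 2 ≤ v ⬝ᵥ (A *ᵥ v) := by
  have hc := (isPSDForm_matrix hA.posSemidef).continuous
  rcases (Metric.sphere (0 : ι → ℝ) 1).eq_empty_or_nonempty with h | h
  -- The unit sphere is empty only in dimension zero, where any constant works; otherwise the
  -- minimum on the sphere is used.
  · refine ⟨1, one_pos, fun v => ?_⟩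
    have : v = 0 := by
      by_contra hv
      have hm : ‖v‖⁻¹ • v ∈ Metric.sphere (0 : ι → ℝ) 1 := by
        simp [norm_smul, hv]
      rw [h] at hm
      exact hm
    simp [this]
  · obtain ⟨w, hw, hmin⟩ := (isCompact_sphere (0 : ι → ℝ) 1).exists_isMinOn h hc.continuousOn
    have hw0 : w ≠ 0 := by
      rintro rfl
      simp at hw
    refine ⟨w ⬝ᵥ (A *ᵥ w), by simpa using hA.dotProduct_mulVec_pos hw0, fun v => ?_⟩
    by_cases hv : v = 0
    · simp [hv]
    have hm : ‖v‖⁻¹ • v ∈ Metric.sphere (0 : ι → ℝ) 1 := by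
      simp [norm_smul, hv]
    have h1 := isMinOn_iff.1 hmin _ hm
    have hn : 0 < ‖v‖ := norm_pos_iff.2 hv
    simp only [Matrix.mulVec_smul, dotProduct_smul, smul_dotProduct, smul_eq_mul] at h1
    calc _ ≤ (‖v‖⁻¹ * (‖v‖⁻¹ * (v ⬝ᵥ (A *ᵥ v)))) * ‖v‖ ^ 2 := by gcongr
      _ = _ := by field_simp

end Forms

/-! ### Integration over products with a finite middle factor -/

section FiniteFactor

variable {X M W E : Type*} [MeasurableSpace X] [MeasurableSpace M] [MeasurableSpace W]
  [Fintype M] [MeasurableSingletonClass M] [NormedAddCommGroup E]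
  (θ : Measure X) (ω : Measure M) (π : Measure W) [SFinite θ] [SFinite ω] [SFinite π]

lemma measurable_mk_mid (m : M) : Measurable fun a : X × W => (a.1, m, a.2) := by fun_prop

lemma lintegral_prod_fintype_prod {f : X × M × W → ℝ≥0∞} (hf : Measurable f) :
    ∫⁻ a, f a ∂(θ.prod (ω.prod π)) = ∑ m, ω {m} * ∫⁻ a, f (a.1, m, a.2) ∂(θ.prod π) := by
  rw [lintegral_prod _ hf.aemeasurable]
  have e : ∀ x, ∫⁻ y, f (x, y) ∂(ω.prod π) = ∑ m, ω {m} * ∫⁻ w, f (x, m, w) ∂π := by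
    intro x
    rw [lintegral_prod _ (by fun_prop), lintegral_fintype]
    exact Finset.sum_congr rfl fun m _ => mul_comm _ _
  have hm : ∀ m, Measurable fun a : X × W => f (a.1, m, a.2) := fun m =>
    hf.comp (measurable_mk_mid m)
  simp_rw [e]
  rw [lintegral_finsetSum _ fun m _ => ((hm m).lintegral_prod_right').const_mul _]
  refine Finset.sum_congr rfl fun m _ => ?_
  rw [lintegral_const_mul _ (hm m).lintegral_prod_right', lintegral_prod _ (hm m).aemeasurable]

lemma prod_fintype_prod_eq_sum :
    θ.prod (ω.prod π) = ∑ m, ω {m} • (θ.prod π).map (fun a => (a.1, m, a.2)) := by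
  refine Measure.ext_of_lintegral _ fun f hf => ?_
  rw [lintegral_prod_fintype_prod θ ω π hf, lintegral_finsetSum_measure]
  refine Finset.sum_congr rfl fun m _ => ?_
  rw [lintegral_smul_measure, lintegral_map hf (measurable_mk_mid m), smul_eq_mul]

/-- Integrability is demanded only at atoms of positive mass, so a prescription may be arbitrary at
modes that cannot occur. -/
lemma integrable_prod_fintype_prod [IsFiniteMeasure ω] {f : X × M × W → E}
    (hf : StronglyMeasurable f)
    (hi : ∀ m, ω {m} ≠ 0 → Integrable (fun a : X × W => f (a.1, m, a.2)) (θ.prod π)) :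
    Integrable f (θ.prod (ω.prod π)) := by
  rw [prod_fintype_prod_eq_sum, integrable_finsetSum_measure]
  intro m _
  by_cases h : ω {m} = 0
  · simp [h]
  · refine Integrable.smul_measure ?_ (measure_ne_top _ _)
    exact (integrable_map_measure hf.aestronglyMeasurable (measurable_mk_mid m).aemeasurable).2
      (hi m h)

lemma integral_prod_fintype_prod [NormedSpace ℝ E] [IsFiniteMeasure ω] {f : X × M × W → E}
    (hf : StronglyMeasurable f)
    (hi : ∀ m, ω {m} ≠ 0 → Integrable (fun a : X × W => f (a.1, m, a.2)) (θ.prod π)) :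
    ∫ a, f a ∂(θ.prod (ω.prod π)) = ∑ m, ω.real {m} • ∫ a, f (a.1, m, a.2) ∂(θ.prod π) := by
  have h := integrable_prod_fintype_prod θ ω π hf hi
  rw [prod_fintype_prod_eq_sum] at h ⊢
  rw [integral_finsetSum_measure (integrable_finsetSum_measure.1 h)]
  refine Finset.sum_congr rfl fun m _ => ?_
  rw [integral_smul_measure, integral_map (measurable_mk_mid m).aemeasurable
    hf.aestronglyMeasurable]
  rfl

lemma memLp_prod_fintype_prod [IsFiniteMeasure ω] {f : X × M × W → E}
    (hf : StronglyMeasurable f)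
    (hi : ∀ m, ω {m} ≠ 0 → MemLp (fun a : X × W => f (a.1, m, a.2)) 2 (θ.prod π)) :
    MemLp f 2 (θ.prod (ω.prod π)) := by
  rw [memLp_two_iff_integrable_sq_norm hf.aestronglyMeasurable]
  exact integrable_prod_fintype_prod θ ω π (f := fun a => ‖f a‖ ^ 2)
    (hf.norm.pow 2) fun m hm =>
      (memLp_two_iff_integrable_sq_norm (hi m hm).1).1 (hi m hm)

lemma lintegral_ofReal_fintype [IsFiniteMeasure ω] {f : M → ℝ} (hf : ∀ m, 0 ≤ f m) :
    ∫⁻ m, ENNReal.ofReal (f m) ∂ω = ENNReal.ofReal (∑ m, ω.real {m} * f m) := by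
  rw [lintegral_fintype, ENNReal.ofReal_sum_of_nonneg fun m _ =>
    mul_nonneg measureReal_nonneg (hf m)]
  refine Finset.sum_congr rfl fun m _ => ?_
  rw [ENNReal.ofReal_mul measureReal_nonneg, mul_comm, ofReal_measureReal]

end FiniteFactor

/-- The form of `IsPSDForm.integral_add` needed for integrals in [0, ∞]; `k` carries the terms
already integrated out. -/
lemma IsPSDForm.lintegral_add {E α : Type*} [NormedAddCommGroup E] [NormedSpace ℝ E]
    [CompleteSpace E] [MeasurableSpace E] [BorelSpace E] [SecondCountableTopology E]
    [MeasurableSpace α] {μ : Measure α} [IsProbabilityMeasure μ] {q : E → ℝ} (hq : IsPSDForm q)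
    {Y : α → E} (hY : MemLp Y 2 μ) (hY0 : ∫ a, Y a ∂μ = 0) (c : E) {k : ℝ} (hk : 0 ≤ k) :
    ∫⁻ a, ENNReal.ofReal (q (c + Y a) + k) ∂μ = ENNReal.ofReal (q c + ∫ a, q (Y a) ∂μ + k) := by
  have hi : Integrable (fun a => q (c + Y a)) μ := hq.integrable ((memLp_const c).add hY)
  rw [← ofReal_integral_eq_lintegral_ofReal (f := fun a => q (c + Y a) + k)
    (hi.add (integrable_const k))
    (ae_of_all _ fun a => add_nonneg (hq.nonneg _) hk)]
  congr 1
  rw [MeasureTheory.integral_add hi (integrable_const k), hq.integral_add hY hY0]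
  simp

/-! ### Linear dynamics, quadratic cost and quadratic value functions -/

namespace System

variable {S : System}

/-- The conditional mean of `X⁰_{t+1}`. -/
def drift0 (S : System) (m0 : Fin S.κ0) (z : Vec S.dX0 × Vec S.dX1 × Vec S.dU0 × Vec S.dU1) :
    Vec S.dX0 := S.A00 m0 *ᵥ z.1 + S.B00 m0 *ᵥ z.2.2.1

/-- The conditional mean of `X¹_{t+1}`. -/
def drift1 (S : System) (m0 : Fin S.κ0) (m1 : Fin S.κ1)
    (z : Vec S.dX0 × Vec S.dX1 × Vec S.dU0 × Vec S.dU1) : Vec S.dX1 :=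
  S.A10 m0 m1 *ᵥ z.1 + S.A11 m0 m1 *ᵥ z.2.1 + S.B10 m0 m1 *ᵥ z.2.2.1 + S.B11 m0 m1 *ᵥ z.2.2.2

lemma isLinearMap_drift0 (m0 : Fin S.κ0) : IsLinearMap ℝ (S.drift0 m0) where
  map_add x y := by simp only [drift0, Prod.fst_add, Prod.snd_add, Matrix.mulVec_add]; abel
  map_smul c x := by simp only [drift0, Prod.smul_fst, Prod.smul_snd, Matrix.mulVec_smul, smul_add]

lemma isLinearMap_drift1 (m0 : Fin S.κ0) (m1 : Fin S.κ1) : IsLinearMap ℝ (S.drift1 m0 m1) where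
  map_add x y := by simp only [drift1, Prod.fst_add, Prod.snd_add, Matrix.mulVec_add]; abel
  map_smul c x := by simp only [drift1, Prod.smul_fst, Prod.smul_snd, Matrix.mulVec_smul, smul_add]

/-- The instantaneous cost is a nonnegative quadratic form of states and actions. -/
lemma isPSDForm_cost {t : ℕ} (ht : t ≤ S.T) (m0 : Fin S.κ0) (m1 : Fin S.κ1) :
    IsPSDForm fun z : Vec S.dX0 × Vec S.dX1 × Vec S.dU0 × Vec S.dU1 =>
      S.cost t z.1 z.2.1 m0 m1 z.2.2.1 z.2.2.2 := by
  refine IsPSDForm.add ?_ ?_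
  · refine (isPSDForm_matrix (S.posSemidef_Q t ht m0 m1)).comp
      (f := fun z : Vec S.dX0 × Vec S.dX1 × Vec S.dU0 × Vec S.dU1 => Sum.elim z.1 z.2.1)
      ⟨fun x y => ?_, fun c x => ?_⟩ <;> ext (i | i) <;> simp
  · refine (isPSDForm_matrix (S.posDef_R t ht m0 m1).posSemidef).comp
      (f := fun z : Vec S.dX0 × Vec S.dX1 × Vec S.dU0 × Vec S.dU1 => Sum.elim z.2.2.1 z.2.2.2)
      ⟨fun x y => ?_, fun c x => ?_⟩ <;> ext (i | i) <;> simp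

/-- The instantaneous cost controls the size of the local action. -/
lemma exists_le_cost {t : ℕ} (ht : t ≤ S.T) (m0 : Fin S.κ0) (m1 : Fin S.κ1) :
    ∃ ε : ℝ, 0 < ε ∧ ∀ x0 x1 u0 u1, ε * ‖u1‖ ^ 2 ≤ S.cost t x0 x1 m0 m1 u0 u1 := by
  obtain ⟨ε, hε, h⟩ := exists_le_posDef (S.posDef_R t ht m0 m1)
  refine ⟨ε, hε, fun x0 x1 u0 u1 => ?_⟩
  have hn : ‖u1‖ ≤ ‖(Sum.elim u0 u1 : Fin S.dU0 ⊕ Fin S.dU1 → ℝ)‖ :=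
    (pi_norm_le_iff_of_nonneg (norm_nonneg _)).2 fun i =>
      norm_le_pi_norm (Sum.elim u0 u1 : Fin S.dU0 ⊕ Fin S.dU1 → ℝ) (Sum.inr i)
  calc ε * ‖u1‖ ^ 2 ≤ ε * ‖(Sum.elim u0 u1 : Fin S.dU0 ⊕ Fin S.dU1 → ℝ)‖ ^ 2 := by gcongr
    _ ≤ _ := h _
    _ ≤ _ := le_add_of_nonneg_left
      ((isPSDForm_matrix (S.posSemidef_Q t ht m0 m1)).nonneg _)

instance (zt : Option (Fin S.κ1)) : IsProbabilityMeasure (S.modeBelief zt) := by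
  cases zt with
  | none => exact S.isProb_πM1
  | some l => exact Measure.dirac.isProbabilityMeasure

/-- The value functions that are sums of a quadratic form of the global state and the mean of
the belief, a quadratic function of the deviation from the mean, and a constant. -/
def IsQuadratic (V : S.ValueFn) : Prop :=
  ∃ (q : Fin S.κ0 → Option (Fin S.κ1) → Vec S.dX0 × Vec S.dX1 → ℝ)
    (r : Fin S.κ0 → Option (Fin S.κ1) → Vec S.dX1 → ℝ)
    (e : Fin S.κ0 → Option (Fin S.κ1) → ℝ),
    (∀ m z, IsPSDForm (q m z)) ∧ (∀ m z, IsPSDForm (r m z)) ∧ (∀ m z, 0 ≤ e m z) ∧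
    ∀ x0 m (θ : Belief S.dX1) z, V x0 m θ z =
      q m z (x0, ∫ x, x ∂θ.1) + ∫ x, r m z (x - ∫ y, y ∂θ.1) ∂θ.1 + e m z

lemma isBelief_dirac {n : ℕ} (x : Vec n) : IsBelief (Measure.dirac x) := by
  refine ⟨inferInstance, ?_⟩
  refine (memLp_two_iff_integrable_sq_norm (by fun_prop)).2 (integrable_dirac ?_)
  simp

end System

lemma measurable_of_forall_mid {X M W β : Type*} [MeasurableSpace X] [MeasurableSpace M]
    [MeasurableSpace W] [MeasurableSpace β] [Countable M] [MeasurableSingletonClass M]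
    {f : X × M × W → β} (h : ∀ m, Measurable fun a : X × W => f (a.1, m, a.2)) :
    Measurable f := by
  have h1 : Measurable fun b : M × (X × W) => f (b.2.1, b.1, b.2.2) :=
    measurable_from_prod_countable_right h
  exact h1.comp (g := fun b : M × (X × W) => f (b.2.1, b.1, b.2.2))
    (f := fun a : X × M × W => (a.2.1, (a.1, a.2.2))) (by fun_prop)

namespace System

variable {S : System}

instance : IsProbabilityMeasure S.πM0 := S.isProb_πM0

instance : IsProbabilityMeasure S.πM1 := S.isProb_πM1

instance : IsProbabilityMeasure S.p := S.isProb_p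

/-! ### Mean and second moments of the updated belief -/

section Update

variable {t : ℕ} {x0 : Vec S.dX0} {m0 : Fin S.κ0} {θ : Measure (Vec S.dX1)}
  {zt : Option (Fin S.κ1)} {u0 : Vec S.dU0} {ρ : S.Presc}

/-- States and actions when the local state is `x` and the local mode is `m`. -/
def point (S : System) (x0 : Vec S.dX0) (u0 : Vec S.dU0) (ρ : S.Presc) (m : Fin S.κ1)
    (x : Vec S.dX1) : Vec S.dX0 × Vec S.dX1 × Vec S.dU0 × Vec S.dU1 :=
  (x0, x, u0, ρ (x, m))

/-- The mean of states and actions given the local mode. -/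
def meanPoint (S : System) (x0 : Vec S.dX0) (θ : Measure (Vec S.dX1)) (u0 : Vec S.dU0)
    (ρ : S.Presc) (m : Fin S.κ1) : Vec S.dX0 × Vec S.dX1 × Vec S.dU0 × Vec S.dU1 :=
  (x0, ∫ x, x ∂θ, u0, ∫ x, ρ (x, m) ∂θ)

/-- The deviation of states and actions from their mean given the local mode. -/
def devPoint (S : System) (θ : Measure (Vec S.dX1)) (ρ : S.Presc) (m : Fin S.κ1)
    (x : Vec S.dX1) : Vec S.dX0 × Vec S.dX1 × Vec S.dU0 × Vec S.dU1 :=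
  (0, x - ∫ y, y ∂θ, 0, ρ (x, m) - ∫ y, ρ (y, m) ∂θ)

lemma point_eq (m : Fin S.κ1) (x : Vec S.dX1) :
    S.point x0 u0 ρ m x = S.meanPoint x0 θ u0 ρ m + S.devPoint θ ρ m x := by
  simp [point, meanPoint, devPoint]

lemma next1_eq (m : Fin S.κ1) (x w : Vec S.dX1) :
    S.next1 x0 x m0 m u0 (ρ (x, m)) w = S.drift1 m0 m (S.point x0 u0 ρ m x) + w := rfl

lemma measurable_point (hρ : Measurable ρ) (m : Fin S.κ1) : Measurable (S.point x0 u0 ρ m) := by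
  exact measurable_const.prodMk (measurable_id.prodMk (measurable_const.prodMk
    (hρ.comp (measurable_id.prodMk measurable_const))))

lemma measurable_next1 (hρ : Measurable ρ) :
    Measurable fun a : Vec S.dX1 × Fin S.κ1 × Vec S.dX1 =>
      S.next1 x0 a.1 m0 a.2.1 u0 (ρ (a.1, a.2.1)) a.2.2 := by
  refine measurable_of_forall_mid fun m => ?_
  have h1 : Continuous (S.drift1 m0 m) := by unfold drift1; fun_prop
  have h2 := measurable_point (x0 := x0) (u0 := u0) hρ m
  simp only [next1_eq]
  exact (h1.measurable.comp (h2.comp measurable_fst)).add measurable_snd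

lemma memLp_devPoint (hθ : IsBelief θ) {m : Fin S.κ1} (hL : MemLp (fun x => ρ (x, m)) 2 θ) :
    MemLp (S.devPoint θ ρ m) 2 θ := by
  have := hθ.1
  refine memLp_prod_iff.2 ⟨memLp_const _, memLp_prod_iff.2 ⟨?_, memLp_prod_iff.2 ⟨memLp_const _, ?_⟩⟩⟩
  · exact hθ.2.sub (memLp_const _)
  · exact hL.sub (memLp_const _)

lemma integral_devPoint (hθ : IsBelief θ) {m : Fin S.κ1} (hL : MemLp (fun x => ρ (x, m)) 2 θ) :
    ∫ x, S.devPoint θ ρ m x ∂θ = 0 := by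
  have := hθ.1
  have h1 : Integrable (fun x : Vec S.dX1 => x) θ := hθ.2.integrable (by norm_num)
  have h2 : Integrable (fun x => ρ (x, m)) θ := hL.integrable (by norm_num)
  have h3 : Integrable (fun x : Vec S.dX1 => x - ∫ y, y ∂θ) θ := h1.sub (integrable_const _)
  have h4 : Integrable (fun x => ρ (x, m) - ∫ y, ρ (y, m) ∂θ) θ := h2.sub (integrable_const _)
  unfold devPoint
  rw [integral_pair (integrable_const _) (h3.prodMk ((integrable_const _).prodMk h4)),
    integral_pair h3 ((integrable_const _).prodMk h4), integral_pair (integrable_const _) h4]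
  simp [integral_sub h1 (integrable_const _), integral_sub h2 (integrable_const _)]

lemma memLp_drift1_dev (hθ : IsBelief θ) {m : Fin S.κ1} (hL : MemLp (fun x => ρ (x, m)) 2 θ) :
    MemLp (fun x => S.drift1 m0 m (S.devPoint θ ρ m x)) 2 θ :=
  (LinearMap.toContinuousLinearMap (isLinearMap_drift1 m0 m).mk').comp_memLp'
    (memLp_devPoint hθ hL)

lemma integral_drift1_dev (hθ : IsBelief θ) {m : Fin S.κ1}
    (hL : MemLp (fun x => ρ (x, m)) 2 θ) :
    ∫ x, S.drift1 m0 m (S.devPoint θ ρ m x) ∂θ = 0 := by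
  have := hθ.1
  have h := (LinearMap.toContinuousLinearMap (isLinearMap_drift1 m0 m).mk').integral_comp_comm
    ((memLp_devPoint hθ hL).integrable (by norm_num))
  rw [integral_devPoint hθ hL, _root_.map_zero] at h
  exact h

lemma next1_eq_mean_add (m : Fin S.κ1) (x w : Vec S.dX1) :
    S.next1 x0 x m0 m u0 (ρ (x, m)) w =
      S.drift1 m0 m (S.meanPoint x0 θ u0 ρ m) + (S.drift1 m0 m (S.devPoint θ ρ m x) + w) := by
  rw [next1_eq, point_eq (θ := θ), (isLinearMap_drift1 m0 m).map_add, add_assoc]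

lemma memLp_drift1_dev_add (ht : t ≤ S.T) (hθ : IsBelief θ) {m : Fin S.κ1}
    (hL : MemLp (fun x => ρ (x, m)) 2 θ) :
    MemLp (fun a : Vec S.dX1 × Vec S.dX1 => S.drift1 m0 m (S.devPoint θ ρ m a.1) + a.2) 2
      (θ.prod (S.πW1 t)) := by
  have := hθ.1
  have := (S.isBelief_πW1 t ht).1
  exact ((memLp_drift1_dev hθ hL).comp_fst _).add ((S.isBelief_πW1 t ht).2.comp_snd _)

lemma integral_drift1_dev_add (ht : t ≤ S.T) (hθ : IsBelief θ) {m : Fin S.κ1}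
    (hL : MemLp (fun x => ρ (x, m)) 2 θ) :
    ∫ a : Vec S.dX1 × Vec S.dX1, (S.drift1 m0 m (S.devPoint θ ρ m a.1) + a.2)
      ∂(θ.prod (S.πW1 t)) = 0 := by
  have := hθ.1
  have := (S.isBelief_πW1 t ht).1
  have h1 : MemLp (fun a : Vec S.dX1 × Vec S.dX1 => S.drift1 m0 m (S.devPoint θ ρ m a.1)) 2
    (θ.prod (S.πW1 t)) := (memLp_drift1_dev hθ hL).comp_fst _
  have h2 : MemLp (fun a : Vec S.dX1 × Vec S.dX1 => a.2) 2
    (θ.prod (S.πW1 t)) := (S.isBelief_πW1 t ht).2.comp_snd _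
  rw [integral_add (h1.integrable (by norm_num)) (h2.integrable (by norm_num)),
    integral_fun_fst (fun x => S.drift1 m0 m (S.devPoint θ ρ m x)), integral_fun_snd (fun x => x),
    integral_drift1_dev hθ hL, S.mean_πW1 t ht]
  simp

lemma memLp_next1 (ht : t ≤ S.T) (hθ : IsBelief θ) (hρ : Measurable ρ)
    (hL : ∀ m, S.modeBelief zt {m} ≠ 0 → MemLp (fun x => ρ (x, m)) 2 θ) :
    MemLp (fun a : Vec S.dX1 × Fin S.κ1 × Vec S.dX1 =>
      S.next1 x0 a.1 m0 a.2.1 u0 (ρ (a.1, a.2.1)) a.2.2) 2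
      (θ.prod ((S.modeBelief zt).prod (S.πW1 t))) := by
  have := hθ.1
  have := (S.isBelief_πW1 t ht).1
  refine memLp_prod_fintype_prod _ _ _ (measurable_next1 hρ).stronglyMeasurable fun m hm => ?_
  exact ((memLp_const (S.drift1 m0 m (S.meanPoint x0 θ u0 ρ m))).add
    (memLp_drift1_dev_add ht hθ (hL m hm))).ae_eq
      (ae_of_all _ fun a => (next1_eq_mean_add m a.1 a.2).symm)

/-- The updated belief has a finite second moment. -/
lemma isBelief_beliefUpdate_none (ht : t ≤ S.T) (hθ : IsBelief θ) (hρ : Measurable ρ)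
    (hL : ∀ m, S.modeBelief zt {m} ≠ 0 → MemLp (fun x => ρ (x, m)) 2 θ) :
    IsBelief (S.beliefUpdate t θ u0 ρ x0 m0 zt none) := by
  have := hθ.1
  have := (S.isBelief_πW1 t ht).1
  refine ⟨Measure.isProbabilityMeasure_map (measurable_next1 hρ).aemeasurable, ?_⟩
  exact (memLp_map_measure_iff (by fun_prop) (measurable_next1 hρ).aemeasurable).2
    (memLp_next1 ht hθ hρ hL)

/-- Given the mode, deviation and noise are centred, so only the drift at the mean point survives
the integration. -/
lemma mean_beliefUpdate_none (ht : t ≤ S.T) (hθ : IsBelief θ) (hρ : Measurable ρ)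
    (hL : ∀ m, S.modeBelief zt {m} ≠ 0 → MemLp (fun x => ρ (x, m)) 2 θ) :
    ∫ y, y ∂(S.beliefUpdate t θ u0 ρ x0 m0 zt none) =
      ∑ m, (S.modeBelief zt).real {m} • S.drift1 m0 m (S.meanPoint x0 θ u0 ρ m) := by
  have := hθ.1
  have := (S.isBelief_πW1 t ht).1
  have hint : ∀ m, S.modeBelief zt {m} ≠ 0 →
      Integrable (fun a : Vec S.dX1 × Vec S.dX1 =>
        S.drift1 m0 m (S.devPoint θ ρ m a.1) + a.2) (θ.prod (S.πW1 t)) := fun m hm =>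
    (memLp_drift1_dev_add ht hθ (hL m hm)).integrable (by norm_num)
  rw [beliefUpdate, integral_map (measurable_next1 hρ).aemeasurable (by fun_prop),
    integral_prod_fintype_prod _ _ _ (measurable_next1 hρ).stronglyMeasurable]
  · refine Finset.sum_congr rfl fun m _ => ?_
    by_cases hm : S.modeBelief zt {m} = 0
    · simp [measureReal_def, hm]
    simp only [next1_eq_mean_add (θ := θ)]
    rw [integral_add (integrable_const _) (hint m hm), integral_drift1_dev_add ht hθ (hL m hm)]
    simp
  · intro m hm
    simp only [next1_eq_mean_add (θ := θ)]
    exact (integrable_const _).add (hint m hm)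

/-- Given the mode, the next state is a constant plus an independent centred deviation and centred
noise; all cross terms vanish. With `y` the mean of the updated belief, the first term measures how
the mode-wise means spread around their average. -/
lemma integral_form_beliefUpdate_none (ht : t ≤ S.T) (hθ : IsBelief θ) (hρ : Measurable ρ)
    (hL : ∀ m, S.modeBelief zt {m} ≠ 0 → MemLp (fun x => ρ (x, m)) 2 θ)
    {r : Vec S.dX1 → ℝ} (hr : IsPSDForm r) (y : Vec S.dX1) :
    ∫ x, r (x - y) ∂(S.beliefUpdate t θ u0 ρ x0 m0 zt none) =
      ∑ m, (S.modeBelief zt).real {m} * (r (S.drift1 m0 m (S.meanPoint x0 θ u0 ρ m) - y) +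
        ∫ x, r (S.drift1 m0 m (S.devPoint θ ρ m x)) ∂θ) + ∫ w, r w ∂(S.πW1 t) := by
  have := hθ.1
  have := (S.isBelief_πW1 t ht).1
  have hmeas : Measurable fun a : Vec S.dX1 × Fin S.κ1 × Vec S.dX1 =>
      r (S.next1 x0 a.1 m0 a.2.1 u0 (ρ (a.1, a.2.1)) a.2.2 - y) :=
    hr.continuous.measurable.comp ((measurable_next1 hρ).sub_const y)
  have hcongr : ∀ (m : Fin S.κ1) (a : Vec S.dX1 × Vec S.dX1),
      S.next1 x0 a.1 m0 m u0 (ρ (a.1, m)) a.2 - y =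
      (S.drift1 m0 m (S.meanPoint x0 θ u0 ρ m) - y) +
        (S.drift1 m0 m (S.devPoint θ ρ m a.1) + a.2) := by
    intro m a
    rw [next1_eq_mean_add (θ := θ)]
    abel
  rw [beliefUpdate, integral_map (measurable_next1 hρ).aemeasurable
    (f := fun x => r (x - y)) (hr.continuous.comp
      (by fun_prop : Continuous fun x : Vec S.dX1 => x - y)).aestronglyMeasurable,
    integral_prod_fintype_prod _ _ _ hmeas.stronglyMeasurable]
  · have hsum : ∑ m, (S.modeBelief zt).real {m} = 1 := by
      simp
    -- The noise term does not depend on the mode; writing 1 as the sum of the weights brings it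
    -- under the sum, for a comparison mode by mode.
    rw [← one_mul (∫ w, r w ∂(S.πW1 t)), ← hsum, Finset.sum_mul, ← Finset.sum_add_distrib]
    refine Finset.sum_congr rfl fun m _ => ?_
    by_cases hm : S.modeBelief zt {m} = 0
    · simp [measureReal_def, hm]
    simp only [hcongr, smul_eq_mul]
    rw [← mul_add]
    congr 1
    rw [hr.integral_add (memLp_drift1_dev_add ht hθ (hL m hm))
      (integral_drift1_dev_add ht hθ (hL m hm)), add_assoc]
    congr 1
    rw [integral_prod _ (hr.integrable (memLp_drift1_dev_add ht hθ (hL m hm)))]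
    simp only [hr.integral_add (S.isBelief_πW1 t ht).2 (S.mean_πW1 t ht)]
    rw [integral_add (hr.integrable (memLp_drift1_dev hθ (hL m hm))) (integrable_const _)]
    simp
  · intro m hm
    simp only [hcongr]
    exact hr.integrable ((memLp_const (S.drift1 m0 m (S.meanPoint x0 θ u0 ρ m) - y)).add
      (memLp_drift1_dev_add ht hθ (hL m hm)))

end Update

end System

/-! ### Expected cost of a stage with a quadratic value-to-go -/

namespace System

variable {S : System}

/-- The joint law of the next modes and the next link state. -/
abbrev linkLaw (S : System) : Measure (Fin S.κ0 × Fin S.κ1 × Bool) := S.πM0.prod (S.πM1.prod S.p)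

section Noise

variable {t : ℕ} {Q : Fin S.κ0 × Fin S.κ1 × Bool → Vec S.dX0 × Vec S.dX1 × Vec S.dX1 → ℝ}
  {k : Fin S.κ0 × Fin S.κ1 × Bool → ℝ}

/-- The average of a family of functions over the next modes and the next link state. -/
def linkAvg (S : System) {E : Type*} (Q : Fin S.κ0 × Fin S.κ1 × Bool → E → ℝ) (v : E) : ℝ :=
  ∑ c, S.linkLaw.real {c} * Q c v

lemma isPSDForm_linkAvg {E : Type*} [NormedAddCommGroup E] [NormedSpace ℝ E]
    {Q : Fin S.κ0 × Fin S.κ1 × Bool → E → ℝ} (hQ : ∀ c, IsPSDForm (Q c)) :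
    IsPSDForm (S.linkAvg Q) :=
  IsPSDForm.sum _ fun c => (hQ c).const_mul measureReal_nonneg

/-- The contribution of the noises to the expectation of a quadratic form of the next states. -/
def noiseCost (S : System) (t : ℕ) (q : Vec S.dX0 × Vec S.dX1 × Vec S.dX1 → ℝ) : ℝ :=
  ∫ w, q (0, w, 0) ∂(S.πW1 t) + ∫ w, q (w, 0, 0) ∂(S.πW0 t)

lemma noiseCost_nonneg {q : Vec S.dX0 × Vec S.dX1 × Vec S.dX1 → ℝ} (hq : IsPSDForm q) :
    0 ≤ S.noiseCost t q :=
  add_nonneg (integral_nonneg fun _ => hq.nonneg _) (integral_nonneg fun _ => hq.nonneg _)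

/-- Integration goes from the inside out: a finite average over next modes and link, then W¹, then
W⁰. Each noise is centred and adds only a constant. The slot `y` receives no noise: it will hold the
mean of the belief after a lost packet. -/
lemma lintegral_noise (ht : t ≤ S.T) (hQ : ∀ c, IsPSDForm (Q c)) (hk : ∀ c, 0 ≤ k c)
    (a0 : Vec S.dX0) (a1 y : Vec S.dX1) {a : ℝ} (ha : 0 ≤ a) :
    ∫⁻ b, ENNReal.ofReal (a + (Q b.2.2 (a0 + b.1, a1 + b.2.1, y) + k b.2.2))
      ∂((S.πW0 t).prod ((S.πW1 t).prod S.linkLaw)) =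
    ENNReal.ofReal (a + S.linkAvg Q (a0, a1, y) +
      (S.noiseCost t (S.linkAvg Q) + ∑ c, S.linkLaw.real {c} * k c)) := by
  have := (S.isBelief_πW0 t ht).1
  have := (S.isBelief_πW1 t ht).1
  have hΘ := isPSDForm_linkAvg hQ
  have hmeas : Measurable fun b : Vec S.dX0 × Vec S.dX1 × (Fin S.κ0 × Fin S.κ1 × Bool) =>
      ENNReal.ofReal (a + (Q b.2.2 (a0 + b.1, a1 + b.2.1, y) + k b.2.2)) := by
    have h1 : Measurable fun b : (Vec S.dX0 × Vec S.dX1) × (Fin S.κ0 × Fin S.κ1 × Bool) =>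
        ENNReal.ofReal (a + (Q b.2 (a0 + b.1.1, a1 + b.1.2, y) + k b.2)) := by
      refine measurable_from_prod_countable_left fun c => ?_
      have h2 : Measurable (Q c) := (hQ c).continuous.measurable
      have h3 : Measurable fun b : Vec S.dX0 × Vec S.dX1 => (a0 + b.1, a1 + b.2, y) := by fun_prop
      exact ENNReal.measurable_ofReal.comp (((h2.comp h3).add_const (k c)).const_add a)
    exact h1.comp (f := fun b : Vec S.dX0 × Vec S.dX1 × (Fin S.κ0 × Fin S.κ1 × Bool) =>
      ((b.1, b.2.1), b.2.2)) (by fun_prop)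
  rw [lintegral_prod _ hmeas.aemeasurable]
  have hsum : ∑ c, S.linkLaw.real {c} = 1 := by simp
  have hk' : 0 ≤ ∑ c, S.linkLaw.real {c} * k c :=
    Finset.sum_nonneg fun c _ => mul_nonneg measureReal_nonneg (hk c)
  have e1 : ∀ (w0 : Vec S.dX0) (w1 : Vec S.dX1),
      ∫⁻ c, ENNReal.ofReal (a + (Q c (a0 + w0, a1 + w1, y) + k c)) ∂S.linkLaw =
      ENNReal.ofReal (S.linkAvg Q ((a0 + w0, a1, y) + (0, w1, 0)) +
        (a + ∑ c, S.linkLaw.real {c} * k c)) := by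
    intro w0 w1
    rw [lintegral_ofReal_fintype _ fun c => add_nonneg ha (add_nonneg ((hQ c).nonneg _) (hk c))]
    congr 1
    simp only [mul_add, Finset.sum_add_distrib, ← Finset.sum_mul, hsum, one_mul]
    simp only [linkAvg, Prod.mk_add_mk, add_zero]
    ring
  have e2 : ∀ w0 : Vec S.dX0, ∫⁻ b, ENNReal.ofReal (a + (Q b.2 (a0 + w0, a1 + b.1, y) + k b.2))
        ∂((S.πW1 t).prod S.linkLaw) =
      ENNReal.ofReal (S.linkAvg Q ((a0, a1, y) + (w0, 0, 0)) +
        (∫ w, S.linkAvg Q (0, w, 0) ∂(S.πW1 t) + (a + ∑ c, S.linkLaw.real {c} * k c))) := by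
    intro w0
    rw [lintegral_prod (fun b : Vec S.dX1 × (Fin S.κ0 × Fin S.κ1 × Bool) =>
        ENNReal.ofReal (a + (Q b.2 (a0 + w0, a1 + b.1, y) + k b.2)))
      (hmeas.comp (measurable_prodMk_left (x := w0))).aemeasurable]
    simp only [e1]
    rw [hΘ.lintegral_add (Y := fun w1 : Vec S.dX1 => ((0 : Vec S.dX0), w1, (0 : Vec S.dX1)))
      (memLp_prod_iff.2 ⟨memLp_const _, memLp_prod_iff.2
        ⟨(S.isBelief_πW1 t ht).2, memLp_const _⟩⟩) ?_ _ (add_nonneg ha hk')]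
    · simp only [Prod.mk_add_mk, add_zero, add_assoc]
    · have h1 : Integrable (fun x : Vec S.dX1 => x) (S.πW1 t) :=
        (S.isBelief_πW1 t ht).2.integrable (by norm_num)
      rw [integral_pair (integrable_const _) (h1.prodMk (integrable_const _)),
        integral_pair h1 (integrable_const _), S.mean_πW1 t ht]
      simp
  simp only [e2]
  rw [hΘ.lintegral_add (Y := fun w0 : Vec S.dX0 => (w0, (0 : Vec S.dX1), (0 : Vec S.dX1)))
      (memLp_prod_iff.2 ⟨(S.isBelief_πW0 t ht).2, memLp_const _⟩) ?_ _
      (add_nonneg (integral_nonneg fun _ => hΘ.nonneg _) (add_nonneg ha hk'))]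
  · congr 1
    rw [noiseCost]
    ring
  · have h1 : Integrable (fun x : Vec S.dX0 => x) (S.πW0 t) :=
      (S.isBelief_πW0 t ht).2.integrable (by norm_num)
    rw [integral_pair h1 (integrable_const _), S.mean_πW0 t ht]
    simp

end Noise

section Stage

variable {t : ℕ} {x0 : Vec S.dX0} {m0 : Fin S.κ0} {θ : Measure (Vec S.dX1)}
  {zt : Option (Fin S.κ1)} {u0 : Vec S.dU0} {ρ : S.Presc}

/-- The cost of the present stage together with a quadratic form `q` of the next states, without
the contribution of the noises. -/
def stageForm (S : System) (t : ℕ) (m0 : Fin S.κ0) (m : Fin S.κ1)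
    (q : Vec S.dX0 × Vec S.dX1 × Vec S.dX1 → ℝ)
    (v : (Vec S.dX0 × Vec S.dX1 × Vec S.dU0 × Vec S.dU1) × Vec S.dX1) : ℝ :=
  S.cost t v.1.1 v.1.2.1 m0 m v.1.2.2.1 v.1.2.2.2 + q (S.drift0 m0 v.1, S.drift1 m0 m v.1, v.2)

lemma isPSDForm_stageForm (ht : t ≤ S.T) (m : Fin S.κ1)
    {q : Vec S.dX0 × Vec S.dX1 × Vec S.dX1 → ℝ} (hq : IsPSDForm q) :
    IsPSDForm (S.stageForm t m0 m q) := by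
  refine IsPSDForm.add ((isPSDForm_cost ht m0 m).comp
    (f := fun v : (Vec S.dX0 × Vec S.dX1 × Vec S.dU0 × Vec S.dU1) × Vec S.dX1 => v.1)
      ⟨fun _ _ => rfl, fun _ _ => rfl⟩)
    (hq.comp (f := fun v : (Vec S.dX0 × Vec S.dX1 × Vec S.dU0 × Vec S.dU1) × Vec S.dX1 =>
      (S.drift0 m0 v.1, S.drift1 m0 m v.1, v.2)) ⟨fun x y => ?_, fun c x => ?_⟩)
  · simp only [Prod.fst_add, Prod.snd_add, (isLinearMap_drift0 m0).map_add,
      (isLinearMap_drift1 m0 m).map_add, Prod.mk_add_mk]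
  · simp only [Prod.smul_fst, Prod.smul_snd, (isLinearMap_drift0 m0).map_smul,
      (isLinearMap_drift1 m0 m).map_smul, Prod.smul_mk]

/-- For a fixed mode the argument of the form is its mean point plus a centred deviation, so the
contributions of the two add up. The slot `y` is deterministic and has deviation 0. -/
lemma lintegral_stage (ht : t ≤ S.T) (hθ : IsBelief θ) (hρ : Measurable ρ)
    (hL : ∀ m, S.modeBelief zt {m} ≠ 0 → MemLp (fun x => ρ (x, m)) 2 θ)
    {Q : Fin S.κ0 × Fin S.κ1 × Bool → Vec S.dX0 × Vec S.dX1 × Vec S.dX1 → ℝ}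
    {k : Fin S.κ0 × Fin S.κ1 × Bool → ℝ}
    (hQ : ∀ c, IsPSDForm (Q c)) (hk : ∀ c, 0 ≤ k c) (y : Vec S.dX1) :
    ∫⁻ a : Vec S.dX1 × Fin S.κ1 × Vec S.dX0 × Vec S.dX1 × Fin S.κ0 × Fin S.κ1 × Bool,
      ENNReal.ofReal (S.cost t x0 a.1 m0 a.2.1 u0 (ρ (a.1, a.2.1)) +
        (Q a.2.2.2.2 (S.next0 x0 m0 u0 a.2.2.1,
          S.next1 x0 a.1 m0 a.2.1 u0 (ρ (a.1, a.2.1)) a.2.2.2.1, y) + k a.2.2.2.2))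
      ∂(θ.prod ((S.modeBelief zt).prod ((S.πW0 t).prod ((S.πW1 t).prod S.linkLaw)))) =
    ENNReal.ofReal (∑ m, (S.modeBelief zt).real {m} *
      (S.stageForm t m0 m (S.linkAvg Q) (S.meanPoint x0 θ u0 ρ m, y) +
        ∫ x, S.stageForm t m0 m (S.linkAvg Q) (S.devPoint θ ρ m x, 0) ∂θ +
        (S.noiseCost t (S.linkAvg Q) + ∑ c, S.linkLaw.real {c} * k c))) := by
  have := hθ.1
  have := (S.isBelief_πW0 t ht).1
  have := (S.isBelief_πW1 t ht).1
  have hΘ := isPSDForm_linkAvg hQ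
  have hform := fun m => isPSDForm_stageForm (m0 := m0) ht m hΘ
  have hK : 0 ≤ S.noiseCost t (S.linkAvg Q) + ∑ c, S.linkLaw.real {c} * k c :=
    add_nonneg (noiseCost_nonneg hΘ)
      (Finset.sum_nonneg fun c _ => mul_nonneg measureReal_nonneg (hk c))
  have hmeas_m : ∀ m, Measurable
      fun a : Vec S.dX1 × (Vec S.dX0 × Vec S.dX1 × (Fin S.κ0 × Fin S.κ1 × Bool)) =>
      ENNReal.ofReal (S.cost t x0 a.1 m0 m u0 (ρ (a.1, m)) +
        (Q a.2.2.2 (S.next0 x0 m0 u0 a.2.1,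
          S.next1 x0 a.1 m0 m u0 (ρ (a.1, m)) a.2.2.1, y) + k a.2.2.2)) := by
    intro m
    have h1 : Measurable fun b : (Vec S.dX1 × Vec S.dX0 × Vec S.dX1) ×
          (Fin S.κ0 × Fin S.κ1 × Bool) =>
        ENNReal.ofReal (S.cost t x0 b.1.1 m0 m u0 (ρ (b.1.1, m)) +
        (Q b.2 (S.next0 x0 m0 u0 b.1.2.1,
          S.next1 x0 b.1.1 m0 m u0 (ρ (b.1.1, m)) b.1.2.2, y) + k b.2)) := by
      refine measurable_from_prod_countable_left fun c => ?_
      have h2 : Measurable fun b : Vec S.dX1 × Vec S.dX0 × Vec S.dX1 => S.point x0 u0 ρ m b.1 :=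
        (measurable_point hρ m).comp measurable_fst
      have h3 : Continuous (S.drift1 m0 m) := by unfold drift1; fun_prop
      have h4 : Measurable fun b : Vec S.dX1 × Vec S.dX0 × Vec S.dX1 =>
          (S.drift0 m0 (S.point x0 u0 ρ m b.1) + b.2.1,
            S.drift1 m0 m (S.point x0 u0 ρ m b.1) + b.2.2, y) := by
        refine Measurable.prodMk ?_ (Measurable.prodMk ?_ measurable_const)
        · exact (by fun_prop : Measurable fun b : Vec S.dX1 × Vec S.dX0 × Vec S.dX1 =>
            (S.A00 m0 *ᵥ x0 + S.B00 m0 *ᵥ u0) + b.2.1)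
        · exact (h3.measurable.comp h2).add (by fun_prop)
      have h5 := (isPSDForm_cost ht m0 m).continuous.measurable.comp h2
      exact ENNReal.measurable_ofReal.comp
        (h5.add (((hQ c).continuous.measurable.comp h4).add_const (k c)))
    exact h1.comp (f := fun a : Vec S.dX1 × (Vec S.dX0 × Vec S.dX1 ×
      (Fin S.κ0 × Fin S.κ1 × Bool)) => ((a.1, a.2.1, a.2.2.1), a.2.2.2)) (by fun_prop)
  rw [lintegral_prod_fintype_prod _ _ _ (measurable_of_forall_mid hmeas_m),
    ENNReal.ofReal_sum_of_nonneg fun m _ => mul_nonneg measureReal_nonneg (add_nonneg (add_nonneg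
      ((hform m).nonneg _) (integral_nonneg fun _ => (hform m).nonneg _)) hK)]
  refine Finset.sum_congr rfl fun m _ => ?_
  rw [ENNReal.ofReal_mul measureReal_nonneg, ofReal_measureReal]
  by_cases hm : S.modeBelief zt {m} = 0
  · simp [hm]
  congr 1
  rw [lintegral_prod _ (hmeas_m m).aemeasurable]
  have e : ∀ x, ∫⁻ b, ENNReal.ofReal (S.cost t x0 x m0 m u0 (ρ (x, m)) +
        (Q b.2.2 (S.next0 x0 m0 u0 b.1,
          S.next1 x0 x m0 m u0 (ρ (x, m)) b.2.1, y) + k b.2.2))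
        ∂((S.πW0 t).prod ((S.πW1 t).prod S.linkLaw)) =
      ENNReal.ofReal (S.stageForm t m0 m (S.linkAvg Q) ((S.meanPoint x0 θ u0 ρ m, y) +
        (S.devPoint θ ρ m x, 0)) + (S.noiseCost t (S.linkAvg Q) +
          ∑ c, S.linkLaw.real {c} * k c)) := by
    intro x
    have := lintegral_noise ht hQ hk (S.drift0 m0 (S.point x0 u0 ρ m x))
      (S.drift1 m0 m (S.point x0 u0 ρ m x)) y
      ((isPSDForm_cost ht m0 m).nonneg (S.point x0 u0 ρ m x))
    rw [Prod.mk_add_mk, ← point_eq, add_zero]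
    exact this
  simp only [e]
  rw [(hform m).lintegral_add (Y := fun x => (S.devPoint θ ρ m x, (0 : Vec S.dX1)))
    (memLp_prod_iff.2 ⟨memLp_devPoint hθ (hL m hm), memLp_const _⟩) ?_ _ hK]
  rw [integral_pair ((memLp_devPoint hθ (hL m hm)).integrable (by norm_num)) (integrable_const _),
    integral_devPoint hθ (hL m hm)]
  simp

end Stage

end System

/-! ### Splitting and minimizing the stage value -/

namespace System

variable {S : System} {t : ℕ} {m0 : Fin S.κ0} {zt : Option (Fin S.κ1)}

lemma cost_nonneg (ht : t ≤ S.T) (x0 : Vec S.dX0) (x1 : Vec S.dX1) (m0 : Fin S.κ0)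
    (m1 : Fin S.κ1) (u0 : Vec S.dU0) (u1 : Vec S.dU1) : 0 ≤ S.cost t x0 x1 m0 m1 u0 u1 :=
  (isPSDForm_cost ht m0 m1).nonneg (x0, x1, u0, u1)

lemma measurable_cost_presc (ht : t ≤ S.T) {ρ : S.Presc} (hρ : Measurable ρ) (x0 : Vec S.dX0)
    (u0 : Vec S.dU0) (m : Fin S.κ1) :
    Measurable fun x => ENNReal.ofReal (S.cost t x0 x m0 m u0 (ρ (x, m))) :=
  ENNReal.measurable_ofReal.comp
    ((isPSDForm_cost ht m0 m).continuous.measurable.comp (measurable_point hρ m))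

lemma lintegral_cost {W : Type*} [MeasurableSpace W] (π : Measure W) [IsProbabilityMeasure π]
    (ht : t ≤ S.T) (θ : Measure (Vec S.dX1)) [SFinite θ] {ρ : S.Presc} (hρ : Measurable ρ)
    (x0 : Vec S.dX0) (u0 : Vec S.dU0) :
    ∫⁻ a, ENNReal.ofReal (S.cost t x0 a.1 m0 a.2.1 u0 (ρ (a.1, a.2.1)))
      ∂(θ.prod ((S.modeBelief zt).prod π)) =
    ∑ m, S.modeBelief zt {m} *
      ∫⁻ x, ENNReal.ofReal (S.cost t x0 x m0 m u0 (ρ (x, m))) ∂θ := by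
  have h := fun m => measurable_cost_presc (m0 := m0) ht hρ x0 u0 m
  rw [lintegral_prod_fintype_prod _ _ _
    (measurable_of_forall_mid fun m => (h m).comp measurable_fst)]
  refine Finset.sum_congr rfl fun m _ => ?_
  congr 1
  rw [lintegral_prod (fun a : Vec S.dX1 × W =>
    ENNReal.ofReal (S.cost t x0 a.1 m0 m u0 (ρ (a.1, m)))) ((h m).comp measurable_fst).aemeasurable]
  simp

/-- Monotonicity of the lower integral suffices, so `V` may be non-measurable here. -/
lemma lintegral_cost_le_stageValue (V : S.ValueFn) (ht : t ≤ S.T) (θ : Measure (Vec S.dX1))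
    [SFinite θ] {ρ : S.Presc} (hρ : Measurable ρ) (x0 : Vec S.dX0) (u0 : Vec S.dU0) :
    ∑ m, S.modeBelief zt {m} * ∫⁻ x, ENNReal.ofReal (S.cost t x0 x m0 m u0 (ρ (x, m))) ∂θ ≤
      S.stageValue t V x0 m0 θ zt u0 ρ := by
  have := (S.isBelief_πW0 t ht).1
  have := (S.isBelief_πW1 t ht).1
  rw [← lintegral_cost ((S.πW0 t).prod ((S.πW1 t).prod S.linkLaw)) ht θ hρ]
  exact lintegral_mono fun a => le_self_add

/-- Positive definiteness of R bounds the squared local action by the cost. A mode of mass zero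
contributes 0 · ∞ = 0 to the sum and yields no information, whence the restriction on `m`. -/
lemma memLp_of_lintegral_cost_ne_top (ht : t ≤ S.T) {θ : Measure (Vec S.dX1)} {ρ : S.Presc}
    (hρ : Measurable ρ) {x0 : Vec S.dX0} {u0 : Vec S.dU0}
    (h : ∑ m, S.modeBelief zt {m} *
      ∫⁻ x, ENNReal.ofReal (S.cost t x0 x m0 m u0 (ρ (x, m))) ∂θ ≠ ∞)
    (m : Fin S.κ1) (hm : S.modeBelief zt {m} ≠ 0) : MemLp (fun x => ρ (x, m)) 2 θ := by
  have h1 := ENNReal.sum_ne_top.1 h m (Finset.mem_univ _)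
  have h2 : ∫⁻ x, ENNReal.ofReal (S.cost t x0 x m0 m u0 (ρ (x, m))) ∂θ ≠ ∞ := by
    intro h3
    rw [h3, ENNReal.mul_top hm] at h1
    exact h1 rfl
  obtain ⟨ε, hε, hle⟩ := exists_le_cost ht m0 m
  have hmeas : Measurable fun x => ρ (x, m) := hρ.comp (by fun_prop)
  rw [memLp_two_iff_integrable_sq_norm hmeas.aestronglyMeasurable]
  have hi : Integrable (fun x => S.cost t x0 x m0 m u0 (ρ (x, m))) θ := by
    refine ⟨((isPSDForm_cost ht m0 m).continuous.measurable.comp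
      (measurable_point hρ m)).aestronglyMeasurable, ?_⟩
    rw [hasFiniteIntegral_iff_ofReal (ae_of_all _ fun x => cost_nonneg ht _ _ _ _ _ _)]
    exact h2.lt_top
  refine (hi.const_mul ε⁻¹).mono' (hmeas.norm.pow_const 2).aestronglyMeasurable
    (ae_of_all _ fun x => ?_)
  rw [Real.norm_of_nonneg (by positivity), ← div_eq_inv_mul, le_div_iff₀ hε, mul_comm]
  exact hle _ _ _ _

/-- The mean of the next local state when the packet does not arrive. -/
def driftMean (S : System) (m0 : Fin S.κ0) (zt : Option (Fin S.κ1))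
    (v : (Vec S.dX0 × Vec S.dX1) × (Vec S.dU0 × (Fin S.κ1 → Vec S.dU1))) : Vec S.dX1 :=
  ∑ m, (S.modeBelief zt).real {m} • S.drift1 m0 m (v.1.1, v.1.2, v.2.1, v.2.2 m)

lemma isLinearMap_driftMean : IsLinearMap ℝ (S.driftMean m0 zt) where
  map_add x y := by
    simp only [driftMean, ← Finset.sum_add_distrib, ← smul_add, ← (isLinearMap_drift1 _ _).map_add]
    rfl
  map_smul c x := by
    simp only [driftMean, Finset.smul_sum]
    refine Finset.sum_congr rfl fun m _ => ?_
    rw [smul_comm c, ← (isLinearMap_drift1 m0 m).map_smul c]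
    rfl

/-- With a quadratic value-to-go, the stage value splits into a quadratic form of the means and
quadratic forms of the deviations from the means. -/
lemma exists_stageValue_eq {V : S.ValueFn} (hV : IsQuadratic V) (ht : t ≤ S.T) (m0 : Fin S.κ0)
    (zt : Option (Fin S.κ1)) :
    ∃ (F : (Vec S.dX0 × Vec S.dX1) × (Vec S.dU0 × (Fin S.κ1 → Vec S.dU1)) → ℝ)
      (G : Fin S.κ1 → Vec S.dX1 × Vec S.dU1 → ℝ) (E : ℝ),
      IsPSDForm F ∧ (∀ m, IsPSDForm (G m)) ∧ 0 ≤ E ∧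
      ∀ x0 θ u0 ρ, IsBelief θ → Measurable ρ →
        (∀ m, S.modeBelief zt {m} ≠ 0 → MemLp (fun x => ρ (x, m)) 2 θ) →
        S.stageValue t V x0 m0 θ zt u0 ρ = ENNReal.ofReal
          (F ((x0, ∫ x, x ∂θ), (u0, fun m => ∫ x, ρ (x, m) ∂θ)) +
            ∑ m, (S.modeBelief zt).real {m} *
              ∫ x, G m (x - ∫ y, y ∂θ, ρ (x, m) - ∫ y, ρ (y, m) ∂θ) ∂θ + E) := by
  obtain ⟨q, r, e, hq, hr, he, hVe⟩ := hV
  -- Here `c` is (M⁰, M¹, Γ) at the next time. On arrival the next belief is a Dirac mass: its mean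
  -- is the next state (second slot) and its deviation term is zero. On loss its mean is the
  -- predicted one (third slot) and `R` collects the deviation term.
  let Q : Fin S.κ0 × Fin S.κ1 × Bool → Vec S.dX0 × Vec S.dX1 × Vec S.dX1 → ℝ := fun c v =>
    if c.2.2 then q c.1 (some c.2.1) (v.1, v.2.1) else q c.1 none (v.1, v.2.2)
  let R : Fin S.κ0 × Fin S.κ1 × Bool → Vec S.dX1 → ℝ := fun c y =>
    if c.2.2 then 0 else r c.1 none y
  let e' : Fin S.κ0 × Fin S.κ1 × Bool → ℝ := fun c => e c.1 (channel c.2.2 c.2.1)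
  have hQ : ∀ c, IsPSDForm (Q c) := by
    rintro ⟨a, b, γ⟩
    cases γ
    · exact (hq a none).comp (f := fun v : Vec S.dX0 × Vec S.dX1 × Vec S.dX1 => (v.1, v.2.2))
        ⟨fun _ _ => rfl, fun _ _ => rfl⟩
    · exact (hq a (some b)).comp
        (f := fun v : Vec S.dX0 × Vec S.dX1 × Vec S.dX1 => (v.1, v.2.1))
        ⟨fun _ _ => rfl, fun _ _ => rfl⟩
  have hR : ∀ c, IsPSDForm (R c) := by
    rintro ⟨a, b, γ⟩
    cases γ
    · exact hr a none
    · exact IsPSDForm.zero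
  have hΘ := isPSDForm_linkAvg hQ
  have hΘr := isPSDForm_linkAvg hR
  have hform := fun m => isPSDForm_stageForm (m0 := m0) ht m hΘ
  -- `F` gathers everything that depends on the means, including the spread of the mode-wise drifts
  -- around their average; `G m` gathers the deviations given mode `m`; the constant gathers noises
  -- and the constants of the value-to-go.
  refine ⟨fun v => ∑ m, (S.modeBelief zt).real {m} *
      (S.stageForm t m0 m (S.linkAvg Q) ((v.1.1, v.1.2, v.2.1, v.2.2 m), S.driftMean m0 zt v) +
        S.linkAvg R (S.drift1 m0 m (v.1.1, v.1.2, v.2.1, v.2.2 m) - S.driftMean m0 zt v)),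
    fun m d => S.stageForm t m0 m (S.linkAvg Q) ((0, d.1, 0, d.2), 0) +
      S.linkAvg R (S.drift1 m0 m (0, d.1, 0, d.2)),
    ∫ w, S.linkAvg R w ∂(S.πW1 t) +
      (S.noiseCost t (S.linkAvg Q) + ∑ c, S.linkLaw.real {c} * e' c), ?_, ?_, ?_, ?_⟩
  · refine IsPSDForm.sum _ fun m => (IsPSDForm.add ?_ ?_).const_mul measureReal_nonneg
    · refine (hform m).comp
        (f := fun v : (Vec S.dX0 × Vec S.dX1) × (Vec S.dU0 × (Fin S.κ1 → Vec S.dU1)) =>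
          ((v.1.1, v.1.2, v.2.1, v.2.2 m), S.driftMean m0 zt v)) ⟨fun x y => ?_, fun c x => ?_⟩
      · rw [isLinearMap_driftMean.map_add]; rfl
      · rw [isLinearMap_driftMean.map_smul]; rfl
    · refine hΘr.comp
        (f := fun v : (Vec S.dX0 × Vec S.dX1) × (Vec S.dU0 × (Fin S.κ1 → Vec S.dU1)) =>
          S.drift1 m0 m (v.1.1, v.1.2, v.2.1, v.2.2 m) - S.driftMean m0 zt v)
          ⟨fun x y => ?_, fun c x => ?_⟩
      · rw [isLinearMap_driftMean.map_add, ← add_sub_add_comm, ← (isLinearMap_drift1 m0 m).map_add]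
        rfl
      · rw [isLinearMap_driftMean.map_smul, smul_sub, ← (isLinearMap_drift1 m0 m).map_smul]
        rfl
  · intro m
    have hlin : IsLinearMap ℝ fun d : Vec S.dX1 × Vec S.dU1 =>
        ((0 : Vec S.dX0), d.1, (0 : Vec S.dU0), d.2) := ⟨fun x y => by simp, fun c x => by simp⟩
    refine IsPSDForm.add ((hform m).comp (f := fun d : Vec S.dX1 × Vec S.dU1 =>
      (((0 : Vec S.dX0), d.1, (0 : Vec S.dU0), d.2), (0 : Vec S.dX1)))
        ⟨fun x y => by simp, fun c x => by simp⟩) ?_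
    exact (hΘr.comp (isLinearMap_drift1 m0 m)).comp hlin
  · exact add_nonneg (integral_nonneg fun _ => hΘr.nonneg _) (add_nonneg (noiseCost_nonneg hΘ)
      (Finset.sum_nonneg fun c _ => mul_nonneg measureReal_nonneg (he _ _)))
  intro x0 θ u0 ρ hθ hρ hL
  have := hθ.1
  have hψ : IsBelief (S.beliefUpdate t θ u0 ρ x0 m0 zt none) :=
    isBelief_beliefUpdate_none ht hθ hρ hL
  have hmean : ∫ y, y ∂(S.beliefUpdate t θ u0 ρ x0 m0 zt none) =
      S.driftMean m0 zt ((x0, ∫ x, x ∂θ), (u0, fun m => ∫ x, ρ (x, m) ∂θ)) :=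
    mean_beliefUpdate_none ht hθ hρ hL
  set ybar := S.driftMean m0 zt ((x0, ∫ x, x ∂θ), (u0, fun m => ∫ x, ρ (x, m) ∂θ)) with hybar
  -- After a loss the updated belief is the same for all samples of the integration variable, so its
  -- deviation term enters as a number.
  let k : Fin S.κ0 × Fin S.κ1 × Bool → ℝ := fun c =>
    ∫ y, R c (y - ybar) ∂(S.beliefUpdate t θ u0 ρ x0 m0 zt none) + e' c
  have hk : ∀ c, 0 ≤ k c := fun c =>
    add_nonneg (integral_nonneg fun _ => (hR c).nonneg _) (he _ _)
  have hsum : ∑ m, (S.modeBelief zt).real {m} = 1 := by simp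
  have hksum : ∑ c, S.linkLaw.real {c} * k c =
      ∑ m, (S.modeBelief zt).real {m} *
        (S.linkAvg R (S.drift1 m0 m (S.meanPoint x0 θ u0 ρ m) - ybar) +
        ∫ x, S.linkAvg R (S.drift1 m0 m (S.devPoint θ ρ m x)) ∂θ) +
        ∫ w, S.linkAvg R w ∂(S.πW1 t) + ∑ c, S.linkLaw.real {c} * e' c := by
    rw [← integral_form_beliefUpdate_none ht hθ hρ hL hΘr ybar]
    simp only [k, mul_add, Finset.sum_add_distrib, linkAvg]
    congr 1
    rw [integral_finsetSum]
    · simp only [integral_const_mul]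
    · intro c _
      have := hψ.1
      exact ((hR c).integrable (hψ.2.sub (memLp_const ybar))).const_mul _
  have key := lintegral_stage (x0 := x0) (u0 := u0) (m0 := m0) ht hθ hρ hL hQ hk ybar
  have hstage : S.stageValue t V x0 m0 θ zt u0 ρ = _ := Eq.trans (lintegral_congr fun a => ?_) key
  · rw [hstage, hksum]
    congr 1
    have hGint : ∀ m, (S.modeBelief zt).real {m} *
        ∫ x, (S.stageForm t m0 m (S.linkAvg Q) (S.devPoint θ ρ m x, 0) +
          S.linkAvg R (S.drift1 m0 m (S.devPoint θ ρ m x))) ∂θ =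
        (S.modeBelief zt).real {m} *
        (∫ x, S.stageForm t m0 m (S.linkAvg Q) (S.devPoint θ ρ m x, 0) ∂θ +
          ∫ x, S.linkAvg R (S.drift1 m0 m (S.devPoint θ ρ m x)) ∂θ) := by
      intro m
      by_cases hm : S.modeBelief zt {m} = 0
      · simp [measureReal_def, hm]
      have hdev : MemLp (fun x => (S.devPoint θ ρ m x, (0 : Vec S.dX1))) 2 θ :=
        memLp_prod_iff.2 ⟨memLp_devPoint hθ (hL m hm), memLp_const _⟩
      rw [integral_add ((hform m).integrable hdev)
        (hΘr.integrable (memLp_drift1_dev hθ (hL m hm)))]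
    change _ = ∑ m, (S.modeBelief zt).real {m} *
        (S.stageForm t m0 m (S.linkAvg Q) (S.meanPoint x0 θ u0 ρ m, ybar) +
          S.linkAvg R (S.drift1 m0 m (S.meanPoint x0 θ u0 ρ m) - ybar)) +
      ∑ m, (S.modeBelief zt).real {m} *
        ∫ x, (S.stageForm t m0 m (S.linkAvg Q) (S.devPoint θ ρ m x, 0) +
          S.linkAvg R (S.drift1 m0 m (S.devPoint θ ρ m x))) ∂θ + _
    simp only [hGint]
    simp only [mul_add, Finset.sum_add_distrib, ← Finset.sum_mul, hsum, one_mul]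
    ring
  · obtain ⟨x1, m1, w0, w1, m0', m1', γ⟩ := a
    change ENNReal.ofReal (S.cost t x0 x1 m0 m1 u0 (ρ (x1, m1))) + _ =
      ENNReal.ofReal (S.cost t x0 x1 m0 m1 u0 (ρ (x1, m1)) + (_ + k (m0', m1', γ)))
    rw [ENNReal.ofReal_add (cost_nonneg ht _ _ _ _ _ _)
      (add_nonneg ((hQ (m0', m1', γ)).nonneg _) (hk _))]
    congr 1
    -- The integrands agree pointwise: `V.ext` is its quadratic expression at the predicted belief
    -- after a loss, at a Dirac mass after an arrival.
    cases γ
    · change V.ext (S.next0 x0 m0 u0 w0) m0' (S.beliefUpdate t θ u0 ρ x0 m0 zt none) none = _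
      rw [ValueFn.ext, dif_pos hψ, hVe, hmean, add_assoc]
      rfl
    · change V.ext (S.next0 x0 m0 u0 w0) m0' (Measure.dirac
        (S.next1 x0 x1 m0 m1 u0 (ρ (x1, m1)) w1)) (some m1') = _
      rw [ValueFn.ext, dif_pos (isBelief_dirac _), hVe, integral_dirac, integral_dirac, sub_self,
        (hr _ _).map_zero]
      simp only [k, R, if_true, integral_zero]
      rw [add_assoc]
      rfl

end System

/-- The `σ`-algebra on `Option α` makes functions measurable as soon as they are so on `α`. -/
lemma measurable_of_some {α β : Type*} [MeasurableSpace α] [MeasurableSpace β] {f : Option α → β}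
    (h : Measurable fun a => f (some a)) : Measurable f := fun _ hs => h hs

lemma measurable_some {α : Type*} [MeasurableSpace α] : Measurable (some : α → Option α) :=
  fun _ hs => hs

instance {α : Type*} [MeasurableSpace α] [DiscreteMeasurableSpace α] :
    DiscreteMeasurableSpace (Option α) := ⟨fun s => MeasurableSet.of_discrete (s := some ⁻¹' s)⟩

namespace System

variable {S : System} {t : ℕ}

/-- With a quadratic value-to-go, the minimal stage value over all measurable prescriptions is
attained and quadratic. -/
lemma exists_min_stageValue {V : S.ValueFn} (hV : IsQuadratic V) (ht : t ≤ S.T) (m0 : Fin S.κ0)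
    (zt : Option (Fin S.κ1)) :
    ∃ (q : Vec S.dX0 × Vec S.dX1 → ℝ) (r : Vec S.dX1 → ℝ) (e : ℝ),
      IsPSDForm q ∧ IsPSDForm r ∧ 0 ≤ e ∧ ∀ x0 θ, IsBelief θ →
        (∀ u0 ρ, Measurable ρ →
          ENNReal.ofReal (q (x0, ∫ x, x ∂θ) + ∫ x, r (x - ∫ y, y ∂θ) ∂θ + e) ≤
            S.stageValue t V x0 m0 θ zt u0 ρ) ∧
        ∃ u0, ∃ qb ∈ S.QBar, ∃ qt ∈ S.QTilde θ,
          S.stageValue t V x0 m0 θ zt u0 (S.combine qb qt) =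
            ENNReal.ofReal (q (x0, ∫ x, x ∂θ) + ∫ x, r (x - ∫ y, y ∂θ) ∂θ + e) := by
  obtain ⟨F, G, E, hF, hG, hE, hFG⟩ := exists_stageValue_eq hV ht m0 zt
  obtain ⟨LF, hLF⟩ := hF.exists_complete_square
  choose LG hLG using fun m => (hG m).exists_complete_square
  have hGL : ∀ m, IsPSDForm fun x : Vec S.dX1 => G m (x, LG m x) := fun m =>
    (hG m).comp (f := fun x : Vec S.dX1 => (x, LG m x))
      ⟨fun x y => by simp, fun c x => by simp⟩
  have hdev : ∀ θ : Measure (Vec S.dX1), IsBelief θ →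
      MemLp (fun x : Vec S.dX1 => x - ∫ y, y ∂θ) 2 θ := fun θ hθ => by
    have := hθ.1
    exact hθ.2.sub (memLp_const _)
  have hsum : ∀ θ : Measure (Vec S.dX1), IsBelief θ →
      ∫ x, ∑ m, (S.modeBelief zt).real {m} * G m (x - ∫ y, y ∂θ, LG m (x - ∫ y, y ∂θ)) ∂θ =
      ∑ m, (S.modeBelief zt).real {m} * ∫ x, G m (x - ∫ y, y ∂θ, LG m (x - ∫ y, y ∂θ)) ∂θ := by
    intro θ hθ
    rw [integral_finsetSum]
    · simp only [integral_const_mul]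
    · exact fun m _ => ((hGL m).integrable (hdev θ hθ)).const_mul _
  refine ⟨fun v => F (v, LF v), fun x => ∑ m, (S.modeBelief zt).real {m} * G m (x, LG m x), E,
    hF.comp (f := fun v : Vec S.dX0 × Vec S.dX1 => (v, LF v))
      ⟨fun x y => by simp, fun c x => by simp⟩,
    IsPSDForm.sum _ fun m => (hGL m).const_mul measureReal_nonneg, hE,
    fun x0 θ hθ => ⟨fun u0 ρ hρ => ?_, ?_⟩⟩
  · have := hθ.1
    by_cases htop : S.stageValue t V x0 m0 θ zt u0 ρ = ∞
    · rw [htop]; exact le_top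
    -- A finite stage value forces square integrability at all relevant modes, so the splitting
    -- applies to an arbitrary measurable prescription.
    have hL := memLp_of_lintegral_cost_ne_top (zt := zt) ht hρ
      (ne_top_of_le_ne_top htop (lintegral_cost_le_stageValue V ht θ hρ x0 u0))
    rw [hFG x0 θ u0 ρ hθ hρ hL]
    refine ENNReal.ofReal_le_ofReal (add_le_add (add_le_add ?_ ?_) le_rfl)
    · rw [hLF _ (u0, _)]
      exact le_add_of_nonneg_right (hF.nonneg _)
    · rw [hsum θ hθ]
      refine Finset.sum_le_sum fun m _ => ?_
      by_cases hm : S.modeBelief zt {m} = 0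
      · simp [measureReal_def, hm]
      refine mul_le_mul_of_nonneg_left ?_ measureReal_nonneg
      refine integral_mono ((hGL m).integrable (hdev θ hθ)) ((hG m).integrable
        (memLp_prod_iff.2 ⟨hdev θ hθ, (hL m hm).sub (memLp_const _)⟩)) fun x => ?_
      change _ ≤ G m (_, _)
      rw [hLG m _ (ρ (x, m) - _)]
      exact le_add_of_nonneg_right ((hG m).nonneg _)
  · have := hθ.1
    -- The two squares are annihilated independently: `u` prescribes u⁰ and the mode-wise means q̄,
    -- and the linear feedback `LG m` of the centred state prescribes q̃, which has mean zero by
    -- linearity.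
    set u := LF (x0, ∫ x, x ∂θ) with hu
    have hLGm : ∀ m, Continuous (LG m) := fun m => (LG m).continuous_of_finiteDimensional
    have hqL : ∀ m, MemLp (fun x => LG m (x - ∫ y, y ∂θ)) 2 θ := fun m =>
      (LinearMap.toContinuousLinearMap (LG m)).comp_memLp' (hdev θ hθ)
    have hq0 : ∀ m, ∫ x, LG m (x - ∫ y, y ∂θ) ∂θ = 0 := by
      intro m
      have h := (LinearMap.toContinuousLinearMap (LG m)).integral_comp_comm
        ((hdev θ hθ).integrable (by norm_num))
      rw [integral_sub (hθ.2.integrable (by norm_num)) (integrable_const _)] at h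
      simp only [integral_const, probReal_univ, one_smul, sub_self, _root_.map_zero] at h
      exact h
    let qt : S.Presc := fun a => LG a.2 (a.1 - ∫ y, y ∂θ)
    have hqt : Measurable qt := by
      refine measurable_from_prod_countable_left fun m => ?_
      exact (hLGm m).measurable.comp (by fun_prop)
    have hqtQ : qt ∈ S.QTilde θ :=
      ⟨hqt, fun m => ⟨(hqL m).integrable (by norm_num), hq0 m⟩⟩
    have hqb : u.2 ∈ S.QBar := measurable_of_countable _
    refine ⟨u.1, u.2, hqb, qt, hqtQ, ?_⟩
    have hmean : ∀ m, ∫ x, S.combine u.2 qt (x, m) ∂θ = u.2 m := by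
      intro m
      change ∫ x, (u.2 m + LG m (x - ∫ y, y ∂θ)) ∂θ = _
      rw [integral_add (integrable_const _) ((hqL m).integrable (by norm_num)), hq0 m]
      simp
    have hcomb : Measurable (S.combine u.2 qt) :=
      ((measurable_of_countable u.2).comp measurable_snd).add hqt
    rw [hFG x0 θ u.1 _ hθ hcomb fun m _ => (memLp_const (u.2 m)).add (hqL m), hsum θ hθ]
    simp only [hmean]
    congr 4
    funext m
    congr 2
    funext x
    congr 2
    change u.2 m + LG m (x - ∫ y, y ∂θ) - u.2 m = _
    abel

/-! ### Quadratic value functions by backward induction -/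

section Step

variable {V V' : S.ValueFn}

/-- One step of the dynamic program for given value-to-go `V'`. -/
def IsDPStep (t : ℕ) (V V' : S.ValueFn) : Prop :=
  ∀ x0 m0 (θ : Belief S.dX1) zt,
    IsLeast
      {y : EReal | ∃ u0, ∃ qb ∈ S.QBar, ∃ qt ∈ S.QTilde θ.1,
        y = (S.stageValue t V' x0 m0 θ.1 zt u0 (S.combine qb qt) : EReal)}
      ((V x0 m0 θ zt : ℝ) : EReal)

lemma measurable_combine {θ : Measure (Vec S.dX1)} {qb : Fin S.κ1 → Vec S.dU1}
    {qt : S.Presc} (hqb : qb ∈ S.QBar) (hqt : qt ∈ S.QTilde θ) : Measurable (S.combine qb qt) :=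
  (Measurable.comp hqb measurable_snd).add hqt.1

/-- Least elements are unique. Nonnegativity of `v` lets it pass from extended reals to [0, ∞] and
back. -/
lemma IsDPStep.eq_of_isLeast (h : IsDPStep t V V') {x0 : Vec S.dX0} {m0 : Fin S.κ0}
    {θ : Belief S.dX1} {zt : Option (Fin S.κ1)} {v : ℝ} (hv : 0 ≤ v)
    (hle : ∀ u0 ρ, Measurable ρ → ENNReal.ofReal v ≤ S.stageValue t V' x0 m0 θ.1 zt u0 ρ)
    (hex : ∃ u0, ∃ qb ∈ S.QBar, ∃ qt ∈ S.QTilde θ.1,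
      S.stageValue t V' x0 m0 θ.1 zt u0 (S.combine qb qt) = ENNReal.ofReal v) :
    V x0 m0 θ zt = v := by
  have hleast : IsLeast
      {y : EReal | ∃ u0, ∃ qb ∈ S.QBar, ∃ qt ∈ S.QTilde θ.1,
        y = (S.stageValue t V' x0 m0 θ.1 zt u0 (S.combine qb qt) : EReal)} (v : EReal) := by
    have hvE : (v : EReal) = ((ENNReal.ofReal v : ℝ≥0∞) : EReal) := by
      rw [EReal.coe_ennreal_ofReal, max_eq_left hv]
    constructor
    · obtain ⟨u0, qb, hqb, qt, hqt, he⟩ := hex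
      exact ⟨u0, qb, hqb, qt, hqt, by rw [he, hvE]⟩
    · rintro y ⟨u0, qb, hqb, qt, hqt, rfl⟩
      rw [hvE]
      exact EReal.coe_ennreal_le_coe_ennreal_iff.2 (hle _ _ (measurable_combine hqb hqt))
  exact EReal.coe_eq_coe_iff.1 ((h x0 m0 θ zt).unique hleast)

lemma quadratic_nonneg {q : Vec S.dX0 × Vec S.dX1 → ℝ} {r : Vec S.dX1 → ℝ} {e : ℝ}
    (hq : IsPSDForm q) (hr : IsPSDForm r) (he : 0 ≤ e) (x0 : Vec S.dX0)
    (θ : Measure (Vec S.dX1)) :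
    0 ≤ q (x0, ∫ x, x ∂θ) + ∫ x, r (x - ∫ y, y ∂θ) ∂θ + e :=
  add_nonneg (add_nonneg (hq.nonneg _) (integral_nonneg fun _ => hr.nonneg _)) he

lemma IsDPStep.isQuadratic (h : IsDPStep t V V') (hV' : IsQuadratic V') (ht : t ≤ S.T) :
    IsQuadratic V := by
  choose q r e hq hr he hmin using fun m0 zt => exists_min_stageValue hV' ht m0 zt
  exact ⟨q, r, e, hq, hr, he, fun x0 m0 θ zt =>
    h.eq_of_isLeast (quadratic_nonneg (hq m0 zt) (hr m0 zt) (he m0 zt) _ _)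
      (hmin m0 zt x0 θ.1 θ.2).1 (hmin m0 zt x0 θ.1 θ.2).2⟩

/-- This removes the restriction to decomposed prescriptions, so that competitors that are merely
measurable can be compared. -/
lemma IsDPStep.ofReal_le_stageValue (h : IsDPStep t V V') (hV' : IsQuadratic V') (ht : t ≤ S.T)
    (x0 : Vec S.dX0) (m0 : Fin S.κ0) (θ : Belief S.dX1) (zt : Option (Fin S.κ1)) (u0 : Vec S.dU0)
    {ρ : S.Presc} (hρ : Measurable ρ) :
    ENNReal.ofReal (V x0 m0 θ zt) ≤ S.stageValue t V' x0 m0 θ.1 zt u0 ρ := by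
  obtain ⟨q, r, e, hq, hr, he, hmin⟩ := exists_min_stageValue hV' ht m0 zt
  rw [h.eq_of_isLeast (quadratic_nonneg hq hr he _ _) (hmin x0 θ.1 θ.2).1 (hmin x0 θ.1 θ.2).2]
  exact (hmin x0 θ.1 θ.2).1 u0 ρ hρ

end Step

lemma SolvesDP.isQuadratic {V : ℕ → S.ValueFn} (hV : S.SolvesDP V) (ht : t ≤ S.T + 1) :
    IsQuadratic (V t) := by
  induction ht using Nat.decreasingInduction with
  | self =>
    exact ⟨fun _ _ _ => 0, fun _ _ _ => 0, fun _ _ => 0, fun _ _ => IsPSDForm.zero,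
      fun _ _ => IsPSDForm.zero, fun _ _ => le_rfl, fun x0 m0 θ zt => by
        simp [hV.terminal]⟩
  | of_succ k hk ih =>
    exact IsDPStep.isQuadratic (hV.step k (Nat.lt_succ_iff.1 hk)) ih (Nat.lt_succ_iff.1 hk)

/-- A quadratic value function depends measurably on the belief. -/
lemma IsQuadratic.measurable_ext {V : S.ValueFn} (hV : IsQuadratic V) {α : Type*}
    [MeasurableSpace α] (κ : Kernel α (Vec S.dX1)) [IsMarkovKernel κ] {x0 : α → Vec S.dX0}
    {m0 : α → Fin S.κ0} {zt : α → Option (Fin S.κ1)} (hx0 : Measurable x0) (hm0 : Measurable m0)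
    (hzt : Measurable zt) : Measurable fun a => V.ext (x0 a) (m0 a) (κ a) (zt a) := by
  classical
  obtain ⟨q, r, e, hq, hr, he, hVe⟩ := hV
  suffices h : ∀ m z, Measurable fun a => V.ext (x0 a) m (κ a) z by
    have h1 : Measurable fun b : α × (Fin S.κ0 × Option (Fin S.κ1)) =>
        V.ext (x0 b.1) b.2.1 (κ b.1) b.2.2 :=
      measurable_from_prod_countable_left fun c => h c.1 c.2
    exact h1.comp (measurable_id.prodMk (hm0.prodMk hzt))
  intro m z
  -- Membership in Δ becomes finiteness of a kernel integral, and the values of `V` become kernel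
  -- integrals as well; no σ-algebra on the set of beliefs is needed.
  have hbel : ∀ a, IsBelief (κ a) ↔ ∫⁻ x, ‖x‖ₑ ^ 2 ∂(κ a) < ∞ := by
    intro a
    constructor
    · intro h
      have := (memLp_two_iff_integrable_sq_norm h.2.1).1 h.2
      have h2 := this.2
      simpa [HasFiniteIntegral] using h2
    · intro h
      refine ⟨inferInstance, (memLp_two_iff_integrable_sq_norm (by fun_prop)).2
        ⟨by fun_prop, ?_⟩⟩
      simpa [HasFiniteIntegral] using h
  have hset : MeasurableSet {a | IsBelief (κ a)} := by
    simp only [hbel]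
    exact measurableSet_lt (Measurable.lintegral_kernel (by fun_prop)) measurable_const
  have hmean : Measurable fun a => ∫ x, x ∂(κ a) :=
    (StronglyMeasurable.integral_kernel_prod_right (κ := κ) (f := fun _ x => x)
      (by exact measurable_snd.stronglyMeasurable)).measurable
  have hdev : Measurable fun a => ∫ x, r m z (x - ∫ y, y ∂(κ a)) ∂(κ a) :=
    (StronglyMeasurable.integral_kernel_prod_right (κ := κ)
      (f := fun a x => r m z (x - ∫ y, y ∂(κ a))) (by
        exact ((hr m z).continuous.measurable.comp
          (measurable_snd.sub (hmean.comp measurable_fst))).stronglyMeasurable)).measurable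
  have heq : (fun a => V.ext (x0 a) m (κ a) z) = fun a => if IsBelief (κ a) then
      ENNReal.ofReal (q m z (x0 a, ∫ x, x ∂(κ a)) + ∫ x, r m z (x - ∫ y, y ∂(κ a)) ∂(κ a) + e m z)
      else ∞ := by
    funext a
    by_cases h : IsBelief (κ a)
    · simp only [ValueFn.ext, dif_pos h, if_pos h, hVe]
    · simp only [ValueFn.ext, dif_neg h, if_neg h]
  rw [heq]
  refine Measurable.ite hset ?_ measurable_const
  exact ENNReal.measurable_ofReal.comp
    ((((hq m z).continuous.measurable.comp (hx0.prodMk hmean)).add hdev).add_const _)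

/-- The last stage: only the instantaneous cost remains. -/
lemma stageValue_terminal {V : S.ValueFn} (hV : ∀ x0 m0 θ zt, V x0 m0 θ zt = 0) (ht : t ≤ S.T)
    {θ : Measure (Vec S.dX1)} (hθ : IsBelief θ) {ρ : S.Presc} (hρ : Measurable ρ)
    (x0 : Vec S.dX0) (m0 : Fin S.κ0) (zt : Option (Fin S.κ1)) (u0 : Vec S.dU0) :
    S.stageValue t V x0 m0 θ zt u0 ρ =
      ∑ m, S.modeBelief zt {m} *
        ∫⁻ x, ENNReal.ofReal (S.cost t x0 x m0 m u0 (ρ (x, m))) ∂θ := by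
  have := hθ.1
  have := (S.isBelief_πW0 t ht).1
  have := (S.isBelief_πW1 t ht).1
  refine le_antisymm ?_ (lintegral_cost_le_stageValue V ht θ hρ x0 u0)
  by_cases htop : ∑ m, S.modeBelief zt {m} *
        ∫⁻ x, ENNReal.ofReal (S.cost t x0 x m0 m u0 (ρ (x, m))) ∂θ = ∞
  · rw [htop]; exact le_top
  -- When the cost is finite the updated belief lies in Δ, so the value ∞ outside Δ is never met and
  -- the vanishing terminal value applies.
  have hψ := isBelief_beliefUpdate_none (x0 := x0) (u0 := u0) (m0 := m0) ht hθ hρ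
    (memLp_of_lintegral_cost_ne_top ht hρ htop)
  rw [← lintegral_cost ((S.πW0 t).prod ((S.πW1 t).prod S.linkLaw)) ht θ hρ]
  refine lintegral_mono fun a => ?_
  obtain ⟨x1, m1, w0, w1, m0', m1', γ⟩ := a
  have h0 : ∀ x θ' z, IsBelief θ' → V.ext x m0' θ' z = 0 := by
    intro x θ' z h
    simp [ValueFn.ext, dif_pos h, hV]
  cases γ
  · exact le_of_eq ((congrArg _ (h0 _ _ _ hψ)).trans (add_zero _))
  · exact le_of_eq ((congrArg _ (h0 _ _ _ (isBelief_dirac _))).trans (add_zero _))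

end System

/-! ### Measurability of the closed loop -/

namespace System

variable {S : System} {t : ℕ}

section Measurability

lemma measurable_channel {α : Type*} [MeasurableSpace α] :
    Measurable fun a : Bool × α => channel a.1 a.2 := by
  refine measurable_from_prod_countable_right fun γ => ?_
  cases γ
  · exact measurable_const
  · exact measurable_some

lemma measurable_last : Measurable (Hist.last : S.Hist t → S.Obs) := by
  cases t with
  | zero => exact measurable_id
  | succ t => exact measurable_snd.comp (measurable_snd (α := S.Hist t) (β := Vec S.dU0 × S.Obs))

lemma measurable_hist_x0 : Measurable (Hist.x0 : S.Hist t → _) :=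
  measurable_fst.comp measurable_last

lemma measurable_hist_m0 : Measurable (Hist.m0 : S.Hist t → _) :=
  (measurable_fst.comp measurable_snd).comp measurable_last

lemma measurable_hist_zTilde : Measurable (Hist.zTilde : S.Hist t → _) :=
  (measurable_snd.comp (measurable_snd.comp measurable_snd)).comp measurable_last

lemma measurable_next0_comp {α : Type*} [MeasurableSpace α] {x0 : α → Vec S.dX0}
    {m0 : α → Fin S.κ0} {u0 : α → Vec S.dU0} {w0 : α → Vec S.dX0} (hx0 : Measurable x0)
    (hm0 : Measurable m0) (hu0 : Measurable u0) (hw0 : Measurable w0) :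
    Measurable fun a => S.next0 (x0 a) (m0 a) (u0 a) (w0 a) := by
  have h : Measurable fun b : Fin S.κ0 × (Vec S.dX0 × Vec S.dU0 × Vec S.dX0) =>
      S.next0 b.2.1 b.1 b.2.2.1 b.2.2.2 :=
    measurable_from_prod_countable_right fun m => Continuous.measurable (by unfold next0; fun_prop)
  have hf := hm0.prodMk (hx0.prodMk (hu0.prodMk hw0))
  simpa only [Function.comp_def] using h.comp hf

lemma measurable_next1_comp {α : Type*} [MeasurableSpace α] {x0 : α → Vec S.dX0}
    {x1 : α → Vec S.dX1} {m0 : α → Fin S.κ0} {m1 : α → Fin S.κ1} {u0 : α → Vec S.dU0}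
    {u1 : α → Vec S.dU1} {w1 : α → Vec S.dX1} (hx0 : Measurable x0) (hx1 : Measurable x1)
    (hm0 : Measurable m0) (hm1 : Measurable m1) (hu0 : Measurable u0) (hu1 : Measurable u1)
    (hw1 : Measurable w1) :
    Measurable fun a => S.next1 (x0 a) (x1 a) (m0 a) (m1 a) (u0 a) (u1 a) (w1 a) := by
  have h : Measurable fun b : (Fin S.κ0 × Fin S.κ1) ×
      (Vec S.dX0 × Vec S.dX1 × Vec S.dU0 × Vec S.dU1 × Vec S.dX1) =>
      S.next1 b.2.1 b.2.2.1 b.1.1 b.1.2 b.2.2.2.1 b.2.2.2.2.1 b.2.2.2.2.2 := by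
    refine measurable_from_prod_countable_right fun m => ?_
    have h1 : Continuous (S.drift1 m.1 m.2) := by unfold drift1; fun_prop
    have h2 : Continuous fun b : Vec S.dX0 × Vec S.dX1 × Vec S.dU0 × Vec S.dU1 × Vec S.dX1 =>
        (b.1, b.2.1, b.2.2.1, b.2.2.2.1) := by fun_prop
    have h3 : Continuous fun b : Vec S.dX0 × Vec S.dX1 × Vec S.dU0 × Vec S.dU1 × Vec S.dX1 =>
        b.2.2.2.2 := by fun_prop
    exact ((h1.comp h2).add h3).measurable
  have hf := (hm0.prodMk hm1).prodMk (hx0.prodMk (hx1.prodMk (hu0.prodMk (hu1.prodMk hw1))))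
  simpa only [Function.comp_def] using h.comp hf

lemma measurable_cost_comp (ht : t ≤ S.T) {α : Type*} [MeasurableSpace α] {x0 : α → Vec S.dX0}
    {x1 : α → Vec S.dX1} {m0 : α → Fin S.κ0} {m1 : α → Fin S.κ1} {u0 : α → Vec S.dU0}
    {u1 : α → Vec S.dU1} (hx0 : Measurable x0) (hx1 : Measurable x1)
    (hm0 : Measurable m0) (hm1 : Measurable m1) (hu0 : Measurable u0) (hu1 : Measurable u1) :
    Measurable fun a =>
      ENNReal.ofReal (S.cost t (x0 a) (x1 a) (m0 a) (m1 a) (u0 a) (u1 a)) := by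
  have h : Measurable fun b : (Fin S.κ0 × Fin S.κ1) ×
      (Vec S.dX0 × Vec S.dX1 × Vec S.dU0 × Vec S.dU1) =>
      S.cost t b.2.1 b.2.2.1 b.1.1 b.1.2 b.2.2.2.1 b.2.2.2.2 :=
    measurable_from_prod_countable_right fun m =>
      (isPSDForm_cost ht m.1 m.2).continuous.measurable
  exact ENNReal.measurable_ofReal.comp
    (h.comp ((hm0.prodMk hm1).prodMk (hx0.prodMk (hx1.prodMk (hu0.prodMk hu1)))))

end Measurability

section Step

variable (φ : S.Strategy)

/-- The next local state, from the common information and the local state, mode and noise. -/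
def stepState (t : ℕ) (h : S.Hist t) (i : Vec S.dX1 × Fin S.κ1 × Vec S.dX1) : Vec S.dX1 :=
  S.next1 h.x0 i.1 h.m0 i.2.1 (φ.act t h) (φ.presc t h (i.1, i.2.1)) i.2.2

/-- The observation part of the next common information except the channel outputs. -/
def stepGlobal (t : ℕ) (h : S.Hist t) (w0 : Vec S.dX0) : Vec S.dX0 :=
  S.next0 h.x0 h.m0 (φ.act t h) w0

/-- The next common information. -/
def stepHist (t : ℕ) (h : S.Hist t) (i : Vec S.dX1 × Fin S.κ1 × Vec S.dX1)
    (c : Vec S.dX0 × Fin S.κ0 × Fin S.κ1 × Bool) : S.Hist (t + 1) :=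
  (h, φ.act t h, stepGlobal φ t h c.1, c.2.1,
    channel c.2.2.2 (stepState φ t h i), channel c.2.2.2 c.2.2.1)

variable {φ}

lemma measurable_stepState (hact : Measurable (φ.act t))
    (hpresc : Measurable fun a : S.Hist t × (Vec S.dX1 × Fin S.κ1) => φ.presc t a.1 a.2) :
    Measurable fun a : S.Hist t × (Vec S.dX1 × Fin S.κ1 × Vec S.dX1) =>
      stepState φ t a.1 a.2 := by
  refine measurable_next1_comp (measurable_hist_x0.comp measurable_fst) (by fun_prop)
    (measurable_hist_m0.comp measurable_fst) (by fun_prop) (hact.comp measurable_fst) ?_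
    (by fun_prop)
  exact hpresc.comp (f := fun a : S.Hist t × (Vec S.dX1 × Fin S.κ1 × Vec S.dX1) =>
    (a.1, (a.2.1, a.2.2.1))) (by fun_prop)

lemma measurable_stepGlobal (hact : Measurable (φ.act t)) :
    Measurable fun a : S.Hist t × Vec S.dX0 => stepGlobal φ t a.1 a.2 :=
  measurable_next0_comp (measurable_hist_x0.comp measurable_fst)
    (measurable_hist_m0.comp measurable_fst) (hact.comp measurable_fst) measurable_snd

lemma measurable_hist_mk {α : Type*} [MeasurableSpace α] {h : α → S.Hist t} {u : α → Vec S.dU0}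
    {x0 : α → Vec S.dX0} {m0 : α → Fin S.κ0} {z : α → Option (Vec S.dX1)}
    {zt : α → Option (Fin S.κ1)} (hh : Measurable h) (hu : Measurable u) (hx0 : Measurable x0)
    (hm0 : Measurable m0) (hz : Measurable z) (hzt : Measurable zt) :
    Measurable fun a => ((h a, u a, x0 a, m0 a, z a, zt a) : S.Hist (t + 1)) := by
  have : Measurable fun a =>
      ((h a, u a, x0 a, m0 a, z a, zt a) : S.Hist t × Vec S.dU0 × S.Obs) :=
    hh.prodMk (hu.prodMk (hx0.prodMk (hm0.prodMk (hz.prodMk hzt))))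
  exact this

lemma measurable_stepHist (hact : Measurable (φ.act t))
    (hpresc : Measurable fun a : S.Hist t × (Vec S.dX1 × Fin S.κ1) => φ.presc t a.1 a.2) :
    Measurable fun a : S.Hist t × (Vec S.dX1 × Fin S.κ1 × Vec S.dX1) ×
      (Vec S.dX0 × Fin S.κ0 × Fin S.κ1 × Bool) => stepHist φ t a.1 a.2.1 a.2.2 := by
  refine measurable_hist_mk measurable_fst (hact.comp measurable_fst) ?_ (by fun_prop) ?_ ?_
  · exact (measurable_stepGlobal hact).comp
      (f := fun a : S.Hist t × (Vec S.dX1 × Fin S.κ1 × Vec S.dX1) ×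
        (Vec S.dX0 × Fin S.κ0 × Fin S.κ1 × Bool) => (a.1, a.2.2.1)) (by fun_prop)
  · refine measurable_channel.comp (f := fun a : S.Hist t × (Vec S.dX1 × Fin S.κ1 × Vec S.dX1) ×
        (Vec S.dX0 × Fin S.κ0 × Fin S.κ1 × Bool) => (a.2.2.2.2.2, stepState φ t a.1 a.2.1)) ?_
    refine Measurable.prodMk (by fun_prop) ?_
    exact (measurable_stepState hact hpresc).comp
      (f := fun a : S.Hist t × (Vec S.dX1 × Fin S.κ1 × Vec S.dX1) ×
        (Vec S.dX0 × Fin S.κ0 × Fin S.κ1 × Bool) => (a.1, a.2.1)) (by fun_prop)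
  · exact measurable_channel.comp (f := fun a : S.Hist t × (Vec S.dX1 × Fin S.κ1 × Vec S.dX1) ×
        (Vec S.dX0 × Fin S.κ0 × Fin S.κ1 × Bool) => (a.2.2.2.2.2, a.2.2.2.2.1)) (by fun_prop)

end Step

section Loop

variable {Ω : Type*} (ξ : S.Sources Ω) (φ : S.Strategy)

lemma commonInfo_m0 (t : ℕ) (ω : Ω) : (commonInfo ξ φ t ω).m0 = ξ.M0 t ω := by
  cases t <;> rfl

lemma loop_succ (t : ℕ) (ω : Ω) :
    loop ξ φ (t + 1) ω =
      (stepHist φ t (commonInfo ξ φ t ω) (state1 ξ φ t ω, ξ.M1 t ω, ξ.W1 t ω)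
        (ξ.W0 t ω, ξ.M0 (t + 1) ω, ξ.M1 (t + 1) ω, ξ.link (t + 1) ω),
      stepState φ t (commonInfo ξ φ t ω) (state1 ξ φ t ω, ξ.M1 t ω, ξ.W1 t ω)) := by
  simp only [stepHist, stepState, stepGlobal, commonInfo_m0]
  rfl

lemma commonInfo_succ (t : ℕ) (ω : Ω) :
    commonInfo ξ φ (t + 1) ω =
      stepHist φ t (commonInfo ξ φ t ω) (state1 ξ φ t ω, ξ.M1 t ω, ξ.W1 t ω)
        (ξ.W0 t ω, ξ.M0 (t + 1) ω, ξ.M1 (t + 1) ω, ξ.link (t + 1) ω) := by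
  rw [commonInfo, loop_succ]

lemma state1_succ (t : ℕ) (ω : Ω) :
    state1 ξ φ (t + 1) ω =
      stepState φ t (commonInfo ξ φ t ω) (state1 ξ φ t ω, ξ.M1 t ω, ξ.W1 t ω) := by
  rw [state1, loop_succ]

variable {ξ φ}

/-- The σ-algebra on Ω is left free: applied to one generated by selected primitives, the lemma says
that the loop up to time `t` depends only on those primitives. -/
lemma measurable_loop [MeasurableSpace Ω]
    (hact : ∀ s < t, Measurable (φ.act s))
    (hpresc : ∀ s < t, Measurable fun a : S.Hist s × (Vec S.dX1 × Fin S.κ1) => φ.presc s a.1 a.2)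
    (hX0 : Measurable ξ.X0) (hX1 : Measurable ξ.X1) (hW0 : ∀ s < t, Measurable (ξ.W0 s))
    (hW1 : ∀ s < t, Measurable (ξ.W1 s)) (hM0 : ∀ s ≤ t, Measurable (ξ.M0 s))
    (hM1 : ∀ s ≤ t, Measurable (ξ.M1 s)) (hlink : ∀ s ≤ t, Measurable (ξ.link s)) :
    Measurable (commonInfo ξ φ t) ∧ Measurable (state1 ξ φ t) := by
  induction t with
  | zero =>
    refine ⟨?_, hX1⟩
    have h1 : Measurable fun ω => channel (ξ.link 0 ω) (ξ.X1 ω) :=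
      measurable_channel.comp ((hlink 0 le_rfl).prodMk hX1)
    have h2 : Measurable fun ω => channel (ξ.link 0 ω) (ξ.M1 0 ω) :=
      measurable_channel.comp ((hlink 0 le_rfl).prodMk (hM1 0 le_rfl))
    have h3 : Measurable fun ω => ((ξ.X0 ω, ξ.M0 0 ω, channel (ξ.link 0 ω) (ξ.X1 ω),
      channel (ξ.link 0 ω) (ξ.M1 0 ω)) : S.Obs) :=
      hX0.prodMk ((hM0 0 le_rfl).prodMk (h1.prodMk h2))
    exact h3
  | succ t ih =>
    obtain ⟨hH, hX⟩ := ih (fun s hs => hact s (by omega)) (fun s hs => hpresc s (by omega))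
      (fun s hs => hW0 s (by omega)) (fun s hs => hW1 s (by omega)) (fun s hs => hM0 s (by omega))
      (fun s hs => hM1 s (by omega)) (fun s hs => hlink s (by omega))
    have hi : Measurable fun ω => (state1 ξ φ t ω, ξ.M1 t ω, ξ.W1 t ω) :=
      hX.prodMk ((hM1 t (by omega)).prodMk (hW1 t (by omega)))
    have hc : Measurable fun ω =>
        (ξ.W0 t ω, ξ.M0 (t + 1) ω, ξ.M1 (t + 1) ω, ξ.link (t + 1) ω) :=
      (hW0 t (by omega)).prodMk ((hM0 _ le_rfl).prodMk ((hM1 _ le_rfl).prodMk (hlink _ le_rfl)))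
    have hact' := hact t (by omega)
    have hpresc' := hpresc t (by omega)
    constructor
    · rw [funext (commonInfo_succ ξ φ t)]
      have hf := hH.prodMk (hi.prodMk hc)
      simpa only [Function.comp_def] using (measurable_stepHist hact' hpresc').comp hf
    · rw [funext (state1_succ ξ φ t)]
      have hf := hH.prodMk hi
      simpa only [Function.comp_def] using (measurable_stepState hact' hpresc').comp hf

end Loop

/-! ### Independence of blocks of primitive variables -/

section Independence

variable {Ω : Type*} [MeasurableSpace Ω] {P : Measure Ω}

lemma lintegral_of_indepFun [IsProbabilityMeasure P] {A B : Type*} [MeasurableSpace A]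
    [MeasurableSpace B] {f : Ω → A} {g : Ω → B} {ν : Measure B} (hfg : IndepFun f g P)
    (hf : Measurable f) (hg : Measurable g) (hν : P.map g = ν) {K : A × B → ℝ≥0∞}
    (hK : Measurable K) :
    ∫⁻ ω, K (f ω, g ω) ∂P = ∫⁻ ω, ∫⁻ b, K (f ω, b) ∂ν ∂P := by
  have hmap := (indepFun_iff_map_prod_eq_prod_map_map hf.aemeasurable hg.aemeasurable).1 hfg
  have : IsProbabilityMeasure ν := hν ▸ Measure.isProbabilityMeasure_map hg.aemeasurable
  rw [← lintegral_map hK (hf.prodMk hg), hmap, hν, lintegral_prod _ hK.aemeasurable,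
    lintegral_map hK.lintegral_prod_right' hf]

/-- The `σ`-algebra generated by some of the primitive random variables. -/
@[reducible]
def srcAlg {Ω : Type*} (ξ : S.Sources Ω) (I : Set (Src S.T)) : MeasurableSpace Ω :=
  ⨆ i ∈ I, MeasurableSpace.comap (ξ.rv i) inferInstance

variable {ξ : S.Sources Ω}

lemma measurable_srcAlg {Ω : Type*} {ξ : S.Sources Ω} {I : Set (Src S.T)} {i : Src S.T} (hi : i ∈ I) :
    Measurable[srcAlg ξ I] (ξ.rv i) :=
  Measurable.of_comap_le (le_iSup₂_of_le i hi le_rfl)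

lemma indepFun_srcAlg (hξ : ξ.Admissible P) {I J : Set (Src S.T)} (hIJ : Disjoint I J)
    {A B : Type*} [MeasurableSpace A] [MeasurableSpace B] {f : Ω → A} {g : Ω → B}
    (hf : Measurable[srcAlg ξ I] f) (hg : Measurable[srcAlg ξ J] g) : IndepFun f g P := by
  have h := indep_iSup_of_disjoint (fun i => (hξ.measurable i).comap_le) hξ.indep hIJ
  exact indep_of_indep_of_le_left (indep_of_indep_of_le_right h hg.comap_le) hf.comap_le

end Independence

end System

/-! ### The local mode given the common information -/

namespace System

variable {S : System} {t : ℕ} {Ω : Type*}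

section Alg

variable {ξ : S.Sources Ω} {φ : S.Strategy} {I : Set (Src S.T)} {s : ℕ}

lemma measurable_srcAlg_W0 (hs : s ≤ S.T) (h : Src.w0 ⟨s, Nat.lt_succ_of_le hs⟩ ∈ I) :
    Measurable[srcAlg ξ I] (ξ.W0 s) := measurable_srcAlg h

lemma measurable_srcAlg_W1 (hs : s ≤ S.T) (h : Src.w1 ⟨s, Nat.lt_succ_of_le hs⟩ ∈ I) :
    Measurable[srcAlg ξ I] (ξ.W1 s) := measurable_srcAlg h

lemma measurable_srcAlg_M0 (hs : s ≤ S.T) (h : Src.m0 ⟨s, Nat.lt_succ_of_le hs⟩ ∈ I) :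
    Measurable[srcAlg ξ I] (ξ.M0 s) := measurable_srcAlg h

lemma measurable_srcAlg_M1 (hs : s ≤ S.T) (h : Src.m1 ⟨s, Nat.lt_succ_of_le hs⟩ ∈ I) :
    Measurable[srcAlg ξ I] (ξ.M1 s) := measurable_srcAlg h

lemma measurable_srcAlg_link (hs : s ≤ S.T) (h : Src.link ⟨s, Nat.lt_succ_of_le hs⟩ ∈ I) :
    Measurable[srcAlg ξ I] (ξ.link s) := measurable_srcAlg h

/-- The part of feasibility that concerns measurability of the strategy. -/
structure IsMeasurable (φ : S.Strategy) : Prop where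
  act : ∀ t ≤ S.T, Measurable (φ.act t)
  presc : ∀ t ≤ S.T,
    Measurable fun a : S.Hist t × (Vec S.dX1 × Fin S.κ1) => φ.presc t a.1 a.2

lemma measurable_loop_srcAlg (hφ : IsMeasurable φ) (ht : t ≤ S.T) (hx0 : Src.x0 ∈ I)
    (hx1 : Src.x1 ∈ I) (hw0 : ∀ s : Fin (S.T + 1), s.1 < t → Src.w0 s ∈ I)
    (hw1 : ∀ s : Fin (S.T + 1), s.1 < t → Src.w1 s ∈ I)
    (hm0 : ∀ s : Fin (S.T + 1), s.1 ≤ t → Src.m0 s ∈ I)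
    (hm1 : ∀ s : Fin (S.T + 1), s.1 ≤ t → Src.m1 s ∈ I)
    (hl : ∀ s : Fin (S.T + 1), s.1 ≤ t → Src.link s ∈ I) :
    Measurable[srcAlg ξ I] (commonInfo ξ φ t) ∧ Measurable[srcAlg ξ I] (state1 ξ φ t) :=
  @measurable_loop S t Ω ξ φ (srcAlg ξ I) (fun s hs => hφ.act s (by omega))
    (fun s hs => hφ.presc s (by omega)) (measurable_srcAlg hx0) (measurable_srcAlg hx1)
    (fun s hs => measurable_srcAlg_W0 (by omega) (hw0 _ hs))
    (fun s hs => measurable_srcAlg_W1 (by omega) (hw1 _ hs))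
    (fun s hs => measurable_srcAlg_M0 (by omega) (hm0 _ hs))
    (fun s hs => measurable_srcAlg_M1 (by omega) (hm1 _ hs))
    (fun s hs => measurable_srcAlg_link (by omega) (hl _ hs))

end Alg

/-- The common belief on the local mode as a kernel. -/
def modeKernel (S : System) : Kernel (Option (Fin S.κ1)) (Fin S.κ1) where
  toFun := S.modeBelief
  measurable' := Measurable.of_discrete

lemma modeKernel_apply (z : Option (Fin S.κ1)) : S.modeKernel z = S.modeBelief z := rfl

instance : IsMarkovKernel S.modeKernel := ⟨fun z => by rw [modeKernel_apply]; infer_instance⟩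

/-- The common belief on the local mode as a kernel from the common information. -/
def histModeKernel (S : System) (t : ℕ) : Kernel (S.Hist t) (Fin S.κ1) :=
  S.modeKernel.comap Hist.zTilde measurable_hist_zTilde

lemma histModeKernel_apply (h : S.Hist t) : S.histModeKernel t h = S.modeBelief h.zTilde := rfl

instance : IsMarkovKernel (S.histModeKernel t) := by unfold histModeKernel; infer_instance

lemma measurable_lintegral_mode {β : Type*} [MeasurableSpace β]
    {F : (S.Hist t × β) × Fin S.κ1 → ℝ≥0∞} (hF : Measurable F) :
    Measurable fun a : S.Hist t × β => ∫⁻ m, F (a, m) ∂(S.modeBelief a.1.zTilde) :=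
  hF.lintegral_kernel_prod_right' (κ := (S.histModeKernel t).comap Prod.fst measurable_fst)

variable [MeasurableSpace Ω] {P : Measure Ω}

variable {ξ : S.Sources Ω} {φ : S.Strategy}

lemma measurable_W0 (hξ : ξ.Admissible P) {s : ℕ} (hs : s ≤ S.T) : Measurable (ξ.W0 s) :=
  hξ.measurable (.w0 ⟨s, Nat.lt_succ_of_le hs⟩)

lemma measurable_W1 (hξ : ξ.Admissible P) {s : ℕ} (hs : s ≤ S.T) : Measurable (ξ.W1 s) :=
  hξ.measurable (.w1 ⟨s, Nat.lt_succ_of_le hs⟩)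

lemma measurable_M0 (hξ : ξ.Admissible P) {s : ℕ} (hs : s ≤ S.T) : Measurable (ξ.M0 s) :=
  hξ.measurable (.m0 ⟨s, Nat.lt_succ_of_le hs⟩)

lemma measurable_M1 (hξ : ξ.Admissible P) {s : ℕ} (hs : s ≤ S.T) : Measurable (ξ.M1 s) :=
  hξ.measurable (.m1 ⟨s, Nat.lt_succ_of_le hs⟩)

lemma measurable_link (hξ : ξ.Admissible P) {s : ℕ} (hs : s ≤ S.T) : Measurable (ξ.link s) :=
  hξ.measurable (.link ⟨s, Nat.lt_succ_of_le hs⟩)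

lemma measurable_commonInfo_state1 (hξ : ξ.Admissible P) (hφ : IsMeasurable φ) (ht : t ≤ S.T) :
    Measurable (commonInfo ξ φ t) ∧ Measurable (state1 ξ φ t) :=
  measurable_loop (fun s hs => hφ.act s (by omega)) (fun s hs => hφ.presc s (by omega))
    (hξ.measurable .x0) (hξ.measurable .x1) (fun s hs => measurable_W0 hξ (by omega))
    (fun s hs => measurable_W1 hξ (by omega)) (fun s hs => measurable_M0 hξ (by omega))
    (fun s hs => measurable_M1 hξ (by omega)) (fun s hs => measurable_link hξ (by omega))

variable [IsProbabilityMeasure P]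

/-- Observing the local mode through the channel leaves it with the distribution `modeBelief`. -/
lemma lintegral_mode_of_channel {𝒴 : Type*} [MeasurableSpace 𝒴] {Y : Ω → 𝒴} {M : Ω → Fin S.κ1}
    {Γ : Ω → Bool} (hY : Measurable Y) (hM : Measurable M) (hΓ : Measurable Γ)
    (hind : IndepFun Y (fun ω => (M ω, Γ ω)) P)
    (hlaw : P.map (fun ω => (M ω, Γ ω)) = S.πM1.prod S.p)
    {b : 𝒴 × Option (Vec S.dX1) × Option (Fin S.κ1) → S.Hist t} (hb : Measurable b)
    (hbz : ∀ a, (b a).zTilde = a.2.2) {pr : 𝒴 → Vec S.dX1} (hpr : Measurable pr)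
    {H : Ω → S.Hist t}
    (hH : ∀ ω, H ω = b (Y ω, channel (Γ ω) (pr (Y ω)), channel (Γ ω) (M ω)))
    {F : (S.Hist t × Vec S.dX1) × Fin S.κ1 → ℝ≥0∞} (hF : Measurable F) :
    ∫⁻ ω, F ((H ω, pr (Y ω)), M ω) ∂P =
      ∫⁻ ω, ∫⁻ m, F ((H ω, pr (Y ω)), m) ∂(S.modeBelief (H ω).zTilde) ∂P := by
  simp only [hH]
  have hbuild : Measurable fun a : 𝒴 × (Fin S.κ1 × Bool) =>
      b (a.1, channel a.2.2 (pr a.1), channel a.2.2 a.2.1) := by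
    refine hb.comp (measurable_fst.prodMk (Measurable.prodMk ?_ ?_))
    · exact measurable_channel.comp (f := fun a : 𝒴 × (Fin S.κ1 × Bool) => (a.2.2, pr a.1))
        (by fun_prop)
    · exact measurable_channel.comp (f := fun a : 𝒴 × (Fin S.κ1 × Bool) => (a.2.2, a.2.1))
        (by fun_prop)
  have hpair : Measurable fun a : 𝒴 × (Fin S.κ1 × Bool) =>
      (b (a.1, channel a.2.2 (pr a.1), channel a.2.2 a.2.1), pr a.1) :=
    hbuild.prodMk (hpr.comp measurable_fst)
  have hK1 : Measurable fun a : 𝒴 × (Fin S.κ1 × Bool) =>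
      F ((b (a.1, channel a.2.2 (pr a.1), channel a.2.2 a.2.1), pr a.1), a.2.1) :=
    hF.comp (hpair.prodMk (by fun_prop))
  have hK2 : Measurable fun a : 𝒴 × (Fin S.κ1 × Bool) =>
      ∫⁻ m, F ((b (a.1, channel a.2.2 (pr a.1), channel a.2.2 a.2.1), pr a.1), m)
        ∂(S.modeBelief (b (a.1, channel a.2.2 (pr a.1), channel a.2.2 a.2.1)).zTilde) :=
    (measurable_lintegral_mode hF).comp hpair
  have e1 := lintegral_of_indepFun hind hY (hM.prodMk hΓ) hlaw hK1
  have e2 := lintegral_of_indepFun hind hY (hM.prodMk hΓ) hlaw hK2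
  refine e1.trans (Eq.trans ?_ e2.symm)
  refine lintegral_congr fun ω => ?_
  -- The link state is integrated last. With the link down the history does not involve the mode,
  -- and both sides average over `πM1`; with the link up the history reveals the mode, and the
  -- belief is the Dirac mass at it.
  refine (lintegral_prod_symm' _ (hK1.comp (measurable_prodMk_left (x := Y ω)))).trans
    (Eq.trans ?_ (lintegral_prod_symm' _ (hK2.comp (measurable_prodMk_left (x := Y ω)))).symm)
  refine lintegral_congr fun γ => ?_
  cases γ
  · simp only [channel, Function.comp_apply, hbz]
    simp [modeBelief]
  · simp only [channel, Function.comp_apply, hbz]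
    simp [modeBelief]

/-- The local mode and the link state are independent. -/
lemma map_mode_link (hξ : ξ.Admissible P) (ht : t ≤ S.T) :
    P.map (fun ω => (ξ.M1 t ω, ξ.link t ω)) = S.πM1.prod S.p := by
  have hind : IndepFun (ξ.M1 t) (ξ.link t) P :=
    indepFun_srcAlg hξ (I := {Src.m1 ⟨t, Nat.lt_succ_of_le ht⟩})
      (J := {Src.link ⟨t, Nat.lt_succ_of_le ht⟩}) (by simp) (measurable_srcAlg_M1 ht rfl)
      (measurable_srcAlg_link ht rfl)
  rw [(indepFun_iff_map_prod_eq_prod_map_map (measurable_M1 hξ ht).aemeasurable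
    (measurable_link hξ ht).aemeasurable).1 hind]
  congr 1
  · exact hξ.law (.m1 ⟨t, Nat.lt_succ_of_le ht⟩)
  · exact hξ.law (.link ⟨t, Nat.lt_succ_of_le ht⟩)

/-- Given the common information, the local mode is independent of the local state and has the
distribution `modeBelief`. -/
lemma lintegral_mode (hξ : ξ.Admissible P) (hφ : IsMeasurable φ) (ht : t ≤ S.T)
    {F : (S.Hist t × Vec S.dX1) × Fin S.κ1 → ℝ≥0∞} (hF : Measurable F) :
    ∫⁻ ω, F ((commonInfo ξ φ t ω, state1 ξ φ t ω), ξ.M1 t ω) ∂P =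
      ∫⁻ ω, ∫⁻ m, F ((commonInfo ξ φ t ω, state1 ξ φ t ω), m)
        ∂(S.modeBelief (commonInfo ξ φ t ω).zTilde) ∂P := by
  -- Everything else that enters the common information and the local state at this time is
  -- measurable with respect to the primitives outside `J`.
  let J : Set (Src S.T) :=
    {Src.m1 ⟨t, Nat.lt_succ_of_le ht⟩, Src.link ⟨t, Nat.lt_succ_of_le ht⟩}
  have hJ : Measurable[srcAlg ξ J] fun ω => (ξ.M1 t ω, ξ.link t ω) :=
    Measurable.prodMk
      (measurable_srcAlg_M1 ht (Or.inl rfl)) (measurable_srcAlg_link ht (Or.inr rfl))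
  cases t with
  | zero =>
    have hYJ : Measurable[srcAlg ξ Jᶜ] fun ω => ((ξ.X0 ω, ξ.M0 0 ω), ξ.X1 ω) :=
      Measurable.prodMk
        (Measurable.prodMk
          (measurable_srcAlg (i := .x0) (by simp [J]))
          (measurable_srcAlg_M0 ht (by simp [J])))
        (measurable_srcAlg (i := .x1) (by simp [J]))
    have hb : Measurable fun a : ((Vec S.dX0 × Fin S.κ0) × Vec S.dX1) ×
        Option (Vec S.dX1) × Option (Fin S.κ1) =>
        ((a.1.1.1, a.1.1.2, a.2.1, a.2.2) : S.Obs) := by fun_prop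
    have hY : Measurable fun ω => ((ξ.X0 ω, ξ.M0 0 ω), ξ.X1 ω) :=
      Measurable.prodMk (Measurable.prodMk (hξ.measurable .x0) (measurable_M0 hξ ht))
        (hξ.measurable .x1)
    exact lintegral_mode_of_channel (t := 0) (pr := Prod.snd)
      (b := fun a => ((a.1.1.1, a.1.1.2, a.2.1, a.2.2) : S.Obs))
      hY (measurable_M1 hξ ht) (measurable_link hξ ht)
      (indepFun_srcAlg hξ disjoint_compl_left hYJ hJ) (map_mode_link hξ ht) hb
      (fun a => rfl) measurable_snd (fun ω => rfl) hF
  | succ t =>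
    have htT : t ≤ S.T := by omega
    have hstate : ∀ m : MeasurableSpace Ω, Measurable[m] (commonInfo ξ φ t) →
        Measurable[m] (state1 ξ φ t) → Measurable[m] (ξ.W0 t) → Measurable[m] (ξ.W1 t) →
        Measurable[m] (ξ.M1 t) → Measurable[m] (ξ.M0 (t + 1)) →
        Measurable[m] fun ω => ((commonInfo ξ φ t ω,
          stepGlobal φ t (commonInfo ξ φ t ω) (ξ.W0 t ω), ξ.M0 (t + 1) ω),
          stepState φ t (commonInfo ξ φ t ω) (state1 ξ φ t ω, ξ.M1 t ω, ξ.W1 t ω)) := by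
      intro m h1 h2 h3 h4 h5 h6
      refine (h1.prodMk (Measurable.prodMk ?_ h6)).prodMk ?_
      · have h := (measurable_stepGlobal (hφ.act t htT)).comp (h1.prodMk h3)
        simpa only [Function.comp_def] using h
      · have h := (measurable_stepState (hφ.act t htT) (hφ.presc t htT)).comp
          (h1.prodMk (h2.prodMk (h5.prodMk h4)))
        simpa only [Function.comp_def] using h
    have hloopJ := measurable_loop_srcAlg (ξ := ξ) (φ := φ) (I := Jᶜ) hφ htT (by simp [J])
      (by simp [J]) (fun s _ => by simp [J]) (fun s _ => by simp [J]) (fun s _ => by simp [J])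
      (fun s hs => by simp [J, Fin.ext_iff]; omega) (fun s hs => by simp [J, Fin.ext_iff]; omega)
    have hYJ := hstate (srcAlg ξ Jᶜ) hloopJ.1 hloopJ.2 (measurable_srcAlg_W0 htT (by simp [J]))
      (measurable_srcAlg_W1 htT (by simp [J]))
      (measurable_srcAlg_M1 htT (by simp [J])) (measurable_srcAlg_M0 ht (by simp [J]))
    have hloop := measurable_commonInfo_state1 hξ hφ htT
    have hY := hstate _ hloop.1 hloop.2 (measurable_W0 hξ htT) (measurable_W1 hξ htT)
      (measurable_M1 hξ htT) (measurable_M0 hξ ht)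
    have hb : Measurable fun a : ((S.Hist t × Vec S.dX0 × Fin S.κ0) × Vec S.dX1) ×
        Option (Vec S.dX1) × Option (Fin S.κ1) =>
        ((a.1.1.1, φ.act t a.1.1.1, a.1.1.2.1, a.1.1.2.2, a.2.1, a.2.2) : S.Hist (t + 1)) :=
      measurable_hist_mk (by fun_prop) ((hφ.act t htT).comp (by fun_prop)) (by fun_prop)
        (by fun_prop) (by fun_prop) (by fun_prop)
    have key := lintegral_mode_of_channel (pr := Prod.snd) hY (measurable_M1 hξ ht)
      (measurable_link hξ ht) (indepFun_srcAlg hξ disjoint_compl_left hYJ hJ)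
      (map_mode_link hξ ht) hb (fun a => rfl) measurable_snd
      (H := commonInfo ξ φ (t + 1)) (fun ω => by rw [commonInfo_succ]; rfl) hF
    simpa only [← state1_succ] using key

end System

/-! ### The conditional law of one step -/

namespace System

variable {S : System} {t : ℕ} {Ω : Type*} [MeasurableSpace Ω] {P : Measure Ω}
  [IsProbabilityMeasure P] {ξ : S.Sources Ω} {φ : S.Strategy}

/-- The common belief as a kernel from the common information. -/
def beliefKernel (ξ : S.Sources Ω) (φ : S.Strategy) (P : Measure Ω) [IsProbabilityMeasure P]
    (t : ℕ) : Kernel (S.Hist t) (Vec S.dX1) :=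
  condDistrib (state1 ξ φ t) (commonInfo ξ φ t) P

instance : IsMarkovKernel (beliefKernel ξ φ P t) := by unfold beliefKernel; infer_instance

lemma lintegral_state (hξ : ξ.Admissible P) (hφ : IsMeasurable φ) (ht : t ≤ S.T)
    {F : S.Hist t × Vec S.dX1 → ℝ≥0∞} (hF : Measurable F) :
    ∫⁻ ω, F (commonInfo ξ φ t ω, state1 ξ φ t ω) ∂P =
      ∫⁻ ω, ∫⁻ x, F (commonInfo ξ φ t ω, x) ∂(beliefKernel ξ φ P t (commonInfo ξ φ t ω)) ∂P := by
  obtain ⟨hH, hX⟩ := measurable_commonInfo_state1 hξ hφ ht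
  rw [← lintegral_map hF (hH.prodMk hX), ← compProd_map_condDistrib hX.aemeasurable,
    Measure.lintegral_compProd hF, lintegral_map hF.lintegral_kernel_prod_right' hH]
  rfl

lemma lintegral_state_mode (hξ : ξ.Admissible P) (hφ : IsMeasurable φ) (ht : t ≤ S.T)
    {F : (S.Hist t × Vec S.dX1) × Fin S.κ1 → ℝ≥0∞} (hF : Measurable F) :
    ∫⁻ ω, F ((commonInfo ξ φ t ω, state1 ξ φ t ω), ξ.M1 t ω) ∂P =
      ∫⁻ ω, ∫⁻ x, ∫⁻ m, F ((commonInfo ξ φ t ω, x), m)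
        ∂(S.modeBelief (commonInfo ξ φ t ω).zTilde)
        ∂(beliefKernel ξ φ P t (commonInfo ξ φ t ω)) ∂P := by
  rw [lintegral_mode hξ hφ ht hF]
  exact lintegral_state hξ hφ ht (measurable_lintegral_mode hF)

/-- The law of the local state, mode and noise given the common information. -/
def localKernel (κ : Kernel (S.Hist t) (Vec S.dX1)) :
    Kernel (S.Hist t) (Vec S.dX1 × Fin S.κ1 × Vec S.dX1) :=
  κ ×ₖ (S.histModeKernel t ×ₖ Kernel.const _ (S.πW1 t))

lemma localKernel_apply (ht : t ≤ S.T) (κ : Kernel (S.Hist t) (Vec S.dX1)) [IsMarkovKernel κ]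
    (h : S.Hist t) :
    localKernel κ h = (κ h).prod ((S.modeBelief h.zTilde).prod (S.πW1 t)) := by
  have := (S.isBelief_πW1 t ht).1
  rw [localKernel, Kernel.prod_apply, Kernel.prod_apply, Kernel.const_apply,
    histModeKernel_apply]

lemma isMarkovKernel_localKernel (ht : t ≤ S.T) (κ : Kernel (S.Hist t) (Vec S.dX1))
    [IsMarkovKernel κ] : IsMarkovKernel (localKernel κ) := by
  have := (S.isBelief_πW1 t ht).1
  unfold localKernel
  infer_instance

/-- The law of the global noise together with the next modes and link state. -/
lemma map_next (hξ : ξ.Admissible P) (ht : t + 1 ≤ S.T) :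
    P.map (fun ω => (ξ.W0 t ω, ξ.M0 (t + 1) ω, ξ.M1 (t + 1) ω, ξ.link (t + 1) ω)) =
      (S.πW0 t).prod S.linkLaw := by
  have htT : t ≤ S.T := by omega
  have hml : Measurable fun ω => (ξ.M1 (t + 1) ω, ξ.link (t + 1) ω) :=
    (measurable_M1 hξ ht).prodMk (measurable_link hξ ht)
  let J : Set (Src S.T) := {Src.m1 ⟨t + 1, Nat.lt_succ_of_le ht⟩,
    Src.link ⟨t + 1, Nat.lt_succ_of_le ht⟩}
  let J' : Set (Src S.T) := {Src.m0 ⟨t + 1, Nat.lt_succ_of_le ht⟩,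
    Src.m1 ⟨t + 1, Nat.lt_succ_of_le ht⟩, Src.link ⟨t + 1, Nat.lt_succ_of_le ht⟩}
  have i1 : IndepFun (ξ.M0 (t + 1)) (fun ω => (ξ.M1 (t + 1) ω, ξ.link (t + 1) ω)) P :=
    indepFun_srcAlg hξ (I := Jᶜ) (J := J) disjoint_compl_left
      (measurable_srcAlg_M0 ht (by simp [J]))
      (Measurable.prodMk (measurable_srcAlg_M1 ht (by simp [J]))
        (measurable_srcAlg_link ht (by simp [J])))
  have i2 : IndepFun (ξ.W0 t)
      (fun ω => (ξ.M0 (t + 1) ω, ξ.M1 (t + 1) ω, ξ.link (t + 1) ω)) P :=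
    indepFun_srcAlg hξ (I := J'ᶜ) (J := J') disjoint_compl_left
      (measurable_srcAlg_W0 htT (by simp [J']))
      (Measurable.prodMk (measurable_srcAlg_M0 ht (by simp [J']))
        (Measurable.prodMk (measurable_srcAlg_M1 ht (by simp [J']))
          (measurable_srcAlg_link ht (by simp [J']))))
  rw [(indepFun_iff_map_prod_eq_prod_map_map (measurable_W0 hξ htT).aemeasurable
      ((measurable_M0 hξ ht).prodMk hml).aemeasurable).1 i2,
    (indepFun_iff_map_prod_eq_prod_map_map (measurable_M0 hξ ht).aemeasurable
      hml.aemeasurable).1 i1, map_mode_link hξ ht]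
  congr 1
  · exact hξ.law (.w0 ⟨t, Nat.lt_succ_of_le htT⟩)
  · congr 1
    exact hξ.law (.m0 ⟨t + 1, Nat.lt_succ_of_le ht⟩)

/-- The joint law of everything that determines the next common information and local state. -/
lemma lintegral_step (hξ : ξ.Admissible P) (hφ : IsMeasurable φ) (ht : t + 1 ≤ S.T)
    {K : S.Hist t × (Vec S.dX1 × Fin S.κ1 × Vec S.dX1) ×
      (Vec S.dX0 × Fin S.κ0 × Fin S.κ1 × Bool) → ℝ≥0∞} (hK : Measurable K) :
    ∫⁻ ω, K (commonInfo ξ φ t ω, (state1 ξ φ t ω, ξ.M1 t ω, ξ.W1 t ω),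
      (ξ.W0 t ω, ξ.M0 (t + 1) ω, ξ.M1 (t + 1) ω, ξ.link (t + 1) ω)) ∂P =
    ∫⁻ ω, ∫⁻ i, ∫⁻ c, K (commonInfo ξ φ t ω, i, c) ∂((S.πW0 t).prod S.linkLaw)
      ∂(localKernel (beliefKernel ξ φ P t) (commonInfo ξ φ t ω)) ∂P := by
  have htT : t ≤ S.T := by omega
  have := (S.isBelief_πW0 t htT).1
  have := (S.isBelief_πW1 t htT).1
  obtain ⟨hH, hX⟩ := measurable_commonInfo_state1 hξ hφ htT
  have hM := measurable_M1 hξ htT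
  have hW1 := measurable_W1 hξ htT
  let J : Set (Src S.T) := {Src.w0 ⟨t, Nat.lt_succ_of_le htT⟩,
    Src.m0 ⟨t + 1, Nat.lt_succ_of_le ht⟩,
    Src.m1 ⟨t + 1, Nat.lt_succ_of_le ht⟩, Src.link ⟨t + 1, Nat.lt_succ_of_le ht⟩}
  have hc : Measurable fun ω => (ξ.W0 t ω, ξ.M0 (t + 1) ω, ξ.M1 (t + 1) ω, ξ.link (t + 1) ω) :=
    (measurable_W0 hξ htT).prodMk ((measurable_M0 hξ ht).prodMk
      ((measurable_M1 hξ ht).prodMk (measurable_link hξ ht)))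
  have hcJ : Measurable[srcAlg ξ J] fun ω =>
      (ξ.W0 t ω, ξ.M0 (t + 1) ω, ξ.M1 (t + 1) ω, ξ.link (t + 1) ω) :=
    Measurable.prodMk (measurable_srcAlg_W0 htT (by simp [J]))
      (Measurable.prodMk (measurable_srcAlg_M0 ht (by simp [J]))
        (Measurable.prodMk (measurable_srcAlg_M1 ht (by simp [J]))
          (measurable_srcAlg_link ht (by simp [J]))))
  have hloopJ := measurable_loop_srcAlg (ξ := ξ) (φ := φ) (I := Jᶜ) hφ htT (by simp [J])
    (by simp [J]) (fun s hs => by simp [J, Fin.ext_iff]; omega) (fun s _ => by simp [J])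
    (fun s hs => by simp [J, Fin.ext_iff]; omega)
    (fun s hs => by simp [J, Fin.ext_iff]; omega) (fun s hs => by simp [J, Fin.ext_iff]; omega)
  have hDJ : Measurable[srcAlg ξ Jᶜ] fun ω =>
      (((commonInfo ξ φ t ω, state1 ξ φ t ω), ξ.M1 t ω), ξ.W1 t ω) :=
    ((hloopJ.1.prodMk hloopJ.2).prodMk (measurable_srcAlg_M1 htT (by simp [J]))).prodMk
      (measurable_srcAlg_W1 htT (by simp [J]))
  let J' : Set (Src S.T) := {Src.w1 ⟨t, Nat.lt_succ_of_le htT⟩}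
  have hloopJ' := measurable_loop_srcAlg (ξ := ξ) (φ := φ) (I := J'ᶜ) hφ htT (by simp [J'])
    (by simp [J']) (fun s hs => by simp [J']) (fun s hs => by simp [J', Fin.ext_iff]; omega)
    (fun s hs => by simp [J']) (fun s hs => by simp [J']) (fun s hs => by simp [J'])
  have hDJ' : Measurable[srcAlg ξ J'ᶜ] fun ω =>
      ((commonInfo ξ φ t ω, state1 ξ φ t ω), ξ.M1 t ω) :=
    (hloopJ'.1.prodMk hloopJ'.2).prodMk (measurable_srcAlg_M1 htT (by simp [J']))
  have hD : Measurable fun ω => ((commonInfo ξ φ t ω, state1 ξ φ t ω), ξ.M1 t ω) :=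
    (hH.prodMk hX).prodMk hM
  have hK1 : Measurable fun a : (((S.Hist t × Vec S.dX1) × Fin S.κ1) × Vec S.dX1) ×
      (Vec S.dX0 × Fin S.κ0 × Fin S.κ1 × Bool) =>
      K (a.1.1.1.1, (a.1.1.1.2, a.1.1.2, a.1.2), a.2) := hK.comp (by fun_prop)
  have hK2 : Measurable fun a : ((S.Hist t × Vec S.dX1) × Fin S.κ1) × Vec S.dX1 =>
      ∫⁻ c, K (a.1.1.1, (a.1.1.2, a.1.2, a.2), c) ∂((S.πW0 t).prod S.linkLaw) :=
    hK1.lintegral_prod_right'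
  have hK3 : Measurable fun a : (S.Hist t × Vec S.dX1) × Fin S.κ1 =>
      ∫⁻ w, ∫⁻ c, K (a.1.1, (a.1.2, a.2, w), c) ∂((S.πW0 t).prod S.linkLaw) ∂(S.πW1 t) :=
    hK2.lintegral_prod_right'
  have e1 := lintegral_of_indepFun (indepFun_srcAlg hξ disjoint_compl_left hDJ hcJ)
    (hD.prodMk hW1) hc (map_next hξ ht) hK1
  have e2 := lintegral_of_indepFun (indepFun_srcAlg hξ (J := J') disjoint_compl_left hDJ'
    (measurable_srcAlg_W1 htT rfl)) hD hW1 (hξ.law (.w1 ⟨t, Nat.lt_succ_of_le htT⟩)) hK2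
  -- The independent variables are peeled off in turn: the global noise with the next modes and
  -- link, then the local noise, then the mode and state given the common information.
  refine e1.trans (e2.trans ((lintegral_state_mode hξ hφ htT hK3).trans ?_))
  refine lintegral_congr fun ω => ?_
  have hm : Measurable fun i : Vec S.dX1 × Fin S.κ1 × Vec S.dX1 =>
      ∫⁻ c, K (commonInfo ξ φ t ω, i, c) ∂((S.πW0 t).prod S.linkLaw) := by
    have : Measurable fun a : (Vec S.dX1 × Fin S.κ1 × Vec S.dX1) ×
      (Vec S.dX0 × Fin S.κ0 × Fin S.κ1 × Bool) => K (commonInfo ξ φ t ω, a.1, a.2) :=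
      hK.comp (by fun_prop)
    exact this.lintegral_prod_right'
  rw [localKernel_apply htT, lintegral_prod _ hm.aemeasurable]
  refine lintegral_congr fun x => ?_
  exact (lintegral_prod _ (hm.comp (measurable_prodMk_left (x := x))).aemeasurable).symm

end System

/-! ### The belief recursion -/

namespace System

variable {S : System} {t : ℕ} {Ω : Type*} [MeasurableSpace Ω] {P : Measure Ω}
  [IsProbabilityMeasure P] {ξ : S.Sources Ω} {φ : S.Strategy}

/-- The law of the next local state given the present common information. -/
def predictKernel (φ : S.Strategy) (κ : Kernel (S.Hist t) (Vec S.dX1)) :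
    Kernel (S.Hist t) (Vec S.dX1) :=
  (Kernel.id ×ₖ localKernel κ).map fun a => stepState φ t a.1 a.2

lemma predictKernel_apply (hφ : IsMeasurable φ) (ht : t ≤ S.T)
    (κ : Kernel (S.Hist t) (Vec S.dX1)) [IsMarkovKernel κ] (h : S.Hist t) :
    predictKernel φ κ h = (localKernel κ h).map (stepState φ t h) := by
  have := isMarkovKernel_localKernel ht κ
  have hm := measurable_stepState (hφ.act t ht) (hφ.presc t ht)
  rw [predictKernel, Kernel.map_apply _ hm, Kernel.prod_apply, Kernel.id_apply,
    Measure.dirac_prod, Measure.map_map hm (by fun_prop)]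
  rfl

lemma isMarkovKernel_predictKernel (hφ : IsMeasurable φ) (ht : t ≤ S.T)
    (κ : Kernel (S.Hist t) (Vec S.dX1)) [IsMarkovKernel κ] :
    IsMarkovKernel (predictKernel φ κ) := by
  have := isMarkovKernel_localKernel ht κ
  exact Kernel.IsMarkovKernel.map _ (measurable_stepState (hφ.act t ht) (hφ.presc t ht))

/-- The last channel output. -/
def lastZ (h : S.Hist (t + 1)) : Option (Vec S.dX1) := h.2.2.2.2.1

lemma measurable_lastZ : Measurable (lastZ : S.Hist (t + 1) → _) :=
  (measurable_fst.comp (measurable_snd.comp measurable_snd)).comp measurable_last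

lemma measurable_prev : Measurable fun h : S.Hist (t + 1) => (h.1 : S.Hist t) :=
  measurable_fst (α := S.Hist t) (β := Vec S.dU0 × S.Obs)

lemma measurable_getD {α : Type*} [MeasurableSpace α] (a : α) :
    Measurable fun z : Option α => z.getD a :=
  measurable_of_some measurable_id

lemma measurableSet_lastZ_none : MeasurableSet {h : S.Hist (t + 1) | lastZ h = none} := by
  refine measurableSet_preimage measurable_lastZ (t := {z | z = none}) ?_
  change MeasurableSet (some ⁻¹' {z : Option (Vec S.dX1) | z = none})
  have : (some ⁻¹' {z : Option (Vec S.dX1) | z = none}) = ∅ := by ext; simp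
  rw [this]
  exact MeasurableSet.empty

open Classical in
/-- The updated belief as a kernel from the next common information. -/
def filterKernel (φ : S.Strategy) (κ : Kernel (S.Hist t) (Vec S.dX1)) :
    Kernel (S.Hist (t + 1)) (Vec S.dX1) :=
  Kernel.piecewise measurableSet_lastZ_none
    ((predictKernel φ κ).comap (fun h : S.Hist (t + 1) => (h.1 : S.Hist t)) measurable_prev)
    -- The default 0 is never used: on this branch the last output is not `none`.
    (Kernel.deterministic (fun h => (lastZ h).getD 0) ((measurable_getD 0).comp measurable_lastZ))

lemma isMarkovKernel_filterKernel (hφ : IsMeasurable φ) (ht : t ≤ S.T)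
    (κ : Kernel (S.Hist t) (Vec S.dX1)) [IsMarkovKernel κ] :
    IsMarkovKernel (filterKernel φ κ) := by
  have := isMarkovKernel_predictKernel hφ ht κ
  unfold filterKernel
  infer_instance

/-- This links the kernel, a function of the whole next history, to the update ψ of the dynamic
program. -/
lemma filterKernel_stepHist (hφ : IsMeasurable φ) (ht : t ≤ S.T)
    (κ : Kernel (S.Hist t) (Vec S.dX1)) [IsMarkovKernel κ] (h : S.Hist t)
    (i : Vec S.dX1 × Fin S.κ1 × Vec S.dX1) (c : Vec S.dX0 × Fin S.κ0 × Fin S.κ1 × Bool) :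
    filterKernel φ κ (stepHist φ t h i c) =
      S.beliefUpdate t (κ h) (φ.act t h) (φ.presc t h) h.x0 h.m0 h.zTilde
        (channel c.2.2.2 (stepState φ t h i)) := by
  obtain ⟨w0, m0', m1', γ⟩ := c
  cases γ
  · have hz : stepHist φ t h i (w0, m0', m1', false) ∈
      {h : S.Hist (t + 1) | lastZ h = none} := rfl
    rw [filterKernel, Kernel.piecewise_apply, if_pos hz, Kernel.comap_apply]
    change predictKernel φ κ h = _
    rw [predictKernel_apply hφ ht, localKernel_apply ht]
    rfl
  · have hz : stepHist φ t h i (w0, m0', m1', true) ∉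
      {h : S.Hist (t + 1) | lastZ h = none} := by
      change ¬ (some _ = none)
      simp
    rw [filterKernel, Kernel.piecewise_apply, if_neg hz, Kernel.deterministic_apply]
    rfl

lemma lintegral_swap_section {A B C : Type*} [MeasurableSpace A] [MeasurableSpace B]
    [MeasurableSpace C] {μ : Measure B} {ν : Measure C} [SFinite μ] [SFinite ν]
    {K : A × B × C → ℝ≥0∞} (hK : Measurable K) (a : A) :
    ∫⁻ b, ∫⁻ c, K (a, b, c) ∂ν ∂μ = ∫⁻ c, ∫⁻ b, K (a, b, c) ∂μ ∂ν :=
  lintegral_lintegral_swap (f := fun b c => K (a, b, c))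
    (hK.comp (measurable_prodMk_left (x := a))).aemeasurable

/-- The common belief evolves according to the belief update. -/
lemma map_eq_compProd_filterKernel (hξ : ξ.Admissible P) (hφ : IsMeasurable φ)
    (ht : t + 1 ≤ S.T) :
    P.map (fun ω => (commonInfo ξ φ (t + 1) ω, state1 ξ φ (t + 1) ω)) =
      P.map (commonInfo ξ φ (t + 1)) ⊗ₘ filterKernel φ (beliefKernel ξ φ P t) := by
  have htT : t ≤ S.T := by omega
  have := (S.isBelief_πW0 t htT).1
  have hmk := isMarkovKernel_filterKernel hφ htT (beliefKernel ξ φ P t)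
  have hlk := isMarkovKernel_localKernel htT (beliefKernel ξ φ P t)
  obtain ⟨hH, hX⟩ := measurable_commonInfo_state1 hξ hφ ht
  have hstepH := measurable_stepHist (hφ.act t htT) (hφ.presc t htT)
  have hstepX := measurable_stepState (hφ.act t htT) (hφ.presc t htT)
  refine Measure.ext_of_lintegral _ fun f hf => ?_
  have hg : Measurable fun h : S.Hist (t + 1) =>
      ∫⁻ y, f (h, y) ∂(filterKernel φ (beliefKernel ξ φ P t) h) := hf.lintegral_kernel_prod_right'
  rw [lintegral_map hf (hH.prodMk hX), Measure.lintegral_compProd hf, lintegral_map hg hH]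
  simp only [commonInfo_succ, state1_succ]
  have hpair : Measurable fun a : S.Hist t × (Vec S.dX1 × Fin S.κ1 × Vec S.dX1) ×
      (Vec S.dX0 × Fin S.κ0 × Fin S.κ1 × Bool) =>
      (stepHist φ t a.1 a.2.1 a.2.2, stepState φ t a.1 a.2.1) := by
    have h2 : Measurable fun a : S.Hist t × (Vec S.dX1 × Fin S.κ1 × Vec S.dX1) ×
      (Vec S.dX0 × Fin S.κ0 × Fin S.κ1 × Bool) => (a.1, a.2.1) := by fun_prop
    have h3 := hstepX.comp h2
    simp only [Function.comp_def] at h3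
    exact hstepH.prodMk h3
  have hK1 := hf.comp hpair
  have hK2 := hg.comp hstepH
  simp only [Function.comp_def] at hK1 hK2
  rw [lintegral_step hξ hφ ht hK1, lintegral_step hξ hφ ht hK2]
  refine lintegral_congr fun ω => ?_
  set h := commonInfo ξ φ t ω
  -- With the link state fixed first, the two cases separate. After a loss the next history does not
  -- depend on the local variables, whose law is pushed forward to the predicted belief; after an
  -- arrival both sides evaluate `f` at the received state.
  refine (lintegral_swap_section hK1 h).trans (Eq.trans ?_ (lintegral_swap_section hK2 h).symm)
  refine lintegral_congr fun c => ?_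
  simp only [filterKernel_stepHist hφ htT]
  obtain ⟨w0, m0', m1', γ⟩ := c
  cases γ
  · have hmap : S.beliefUpdate t (beliefKernel ξ φ P t h) (φ.act t h) (φ.presc t h) h.x0 h.m0
        h.zTilde none =
        (localKernel (beliefKernel ξ φ P t) h).map (stepState φ t h) := by
      rw [localKernel_apply htT]; rfl
    have hsec : Measurable (stepState φ t h) := by
      simpa only [Function.comp_def] using hstepX.comp (measurable_prodMk_left (x := h))
    have key : ∀ h' : S.Hist (t + 1),
        ∫⁻ i, f (h', stepState φ t h i) ∂(localKernel (beliefKernel ξ φ P t) h) =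
        ∫⁻ _, ∫⁻ y, f (h', y) ∂(S.beliefUpdate t (beliefKernel ξ φ P t h) (φ.act t h)
          (φ.presc t h) h.x0 h.m0 h.zTilde none) ∂(localKernel (beliefKernel ξ φ P t) h) := by
      intro h'
      have hfh : Measurable fun y => f (h', y) := hf.comp measurable_prodMk_left
      rw [lintegral_const, measure_univ, mul_one, hmap, lintegral_map hfh hsec]
    exact key (h, φ.act t h, stepGlobal φ t h w0, m0', none, none)
  · refine lintegral_congr fun i => ?_
    exact (lintegral_dirac' (stepState φ t h i) (hf.comp
      (measurable_prodMk_left (x := stepHist φ t h i (w0, m0', m1', true))))).symm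

lemma beliefKernel_succ_ae_eq (hξ : ξ.Admissible P) (hφ : IsMeasurable φ) (ht : t + 1 ≤ S.T) :
    ∀ᵐ ω ∂P, beliefKernel ξ φ P (t + 1) (commonInfo ξ φ (t + 1) ω) =
      filterKernel φ (beliefKernel ξ φ P t) (commonInfo ξ φ (t + 1) ω) := by
  have hmk := isMarkovKernel_filterKernel hφ (by omega) (beliefKernel ξ φ P t)
  obtain ⟨hH, hX⟩ := measurable_commonInfo_state1 hξ hφ ht
  exact ae_of_ae_map hH.aemeasurable (condDistrib_ae_eq_of_measure_eq_compProd _ hX.aemeasurable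
    (map_eq_compProd_filterKernel hξ hφ ht))

end System

lemma lintegral_prod_reorder {X M A B C : Type*} [MeasurableSpace X] [MeasurableSpace M]
    [MeasurableSpace A] [MeasurableSpace B] [MeasurableSpace C] (θ : Measure X) (ω : Measure M)
    (α : Measure A) (β : Measure B) (τ : Measure C) [SFinite θ] [SFinite ω] [SFinite α] [SFinite β]
    [SFinite τ] {K : (X × M × B) × (A × C) → ℝ≥0∞} (hK : Measurable K) :
    ∫⁻ a, K ((a.1, a.2.1, a.2.2.2.1), (a.2.2.1, a.2.2.2.2))
      ∂(θ.prod (ω.prod (α.prod (β.prod τ)))) =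
    ∫⁻ i, ∫⁻ c, K (i, c) ∂(α.prod τ) ∂(θ.prod (ω.prod β)) := by
  have h1 : Measurable fun a : X × M × A × B × C =>
      K ((a.1, a.2.1, a.2.2.2.1), (a.2.2.1, a.2.2.2.2)) := hK.comp (by fun_prop)
  have h2 : Measurable fun i : X × M × B => ∫⁻ c, K (i, c) ∂(α.prod τ) :=
    hK.lintegral_prod_right'
  rw [lintegral_prod _ h1.aemeasurable, lintegral_prod _ h2.aemeasurable]
  refine lintegral_congr fun x => ?_
  have h3 : Measurable fun a : M × A × B × C =>
      K ((x, a.1, a.2.2.1), (a.2.1, a.2.2.2)) := hK.comp (by fun_prop)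
  have h4 : Measurable fun i : M × B => ∫⁻ c, K ((x, i), c) ∂(α.prod τ) :=
    h2.comp measurable_prodMk_left
  refine (lintegral_prod _ h3.aemeasurable).trans
    (Eq.trans ?_ (lintegral_prod _ h4.aemeasurable).symm)
  refine lintegral_congr fun m => ?_
  have h5 : Measurable fun a : A × B × C => K ((x, m, a.2.1), (a.1, a.2.2)) :=
    hK.comp (by fun_prop)
  have h6 : Measurable fun a : (A × B) × C => K ((x, m, a.1.2), (a.1.1, a.2)) :=
    hK.comp (by fun_prop)
  have h7 : Measurable fun a : A × B => ∫⁻ c, K ((x, m, a.2), (a.1, c)) ∂τ :=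
    h6.lintegral_prod_right'
  calc ∫⁻ a, K ((x, m, a.2.1), (a.1, a.2.2)) ∂(α.prod (β.prod τ))
      = ∫⁻ a, ∫⁻ b, ∫⁻ c, K ((x, m, b), (a, c)) ∂τ ∂β ∂α := by
        rw [lintegral_prod _ h5.aemeasurable]
        refine lintegral_congr fun a => ?_
        exact lintegral_prod _ (h5.comp (measurable_prodMk_left (x := a))).aemeasurable
    _ = ∫⁻ b, ∫⁻ a, ∫⁻ c, K ((x, m, b), (a, c)) ∂τ ∂α ∂β :=
        lintegral_lintegral_swap h7.aemeasurable
    _ = ∫⁻ b, ∫⁻ c, K ((x, m, b), c) ∂(α.prod τ) ∂β := by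
        refine lintegral_congr fun b => ?_
        exact (lintegral_prod _
          (hK.comp (measurable_prodMk_left (x := (x, m, b)))).aemeasurable).symm

/-! ### Verification along trajectories -/

namespace System

variable {S : System} {t : ℕ} {Ω : Type*} [MeasurableSpace Ω] {P : Measure Ω}
  [IsProbabilityMeasure P] {ξ : S.Sources Ω} {φ : S.Strategy}

/-- The value function along the trajectory. -/
def pathValue (ξ : S.Sources Ω) (φ : S.Strategy) (P : Measure Ω) [IsProbabilityMeasure P]
    (V : ℕ → S.ValueFn) (t : ℕ) (ω : Ω) : ℝ≥0∞ :=
  (V t).ext (commonInfo ξ φ t ω).x0 (commonInfo ξ φ t ω).m0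
    (beliefKernel ξ φ P t (commonInfo ξ φ t ω)) (commonInfo ξ φ t ω).zTilde

/-- The stage value of the selected prescription along the trajectory. -/
def pathStage (ξ : S.Sources Ω) (φ : S.Strategy) (P : Measure Ω) [IsProbabilityMeasure P]
    (V : ℕ → S.ValueFn) (t : ℕ) (ω : Ω) : ℝ≥0∞ :=
  S.stageValue t (V (t + 1)) (commonInfo ξ φ t ω).x0 (commonInfo ξ φ t ω).m0
    (beliefKernel ξ φ P t (commonInfo ξ φ t ω)) (commonInfo ξ φ t ω).zTilde
    (φ.act t (commonInfo ξ φ t ω)) (φ.presc t (commonInfo ξ φ t ω))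

/-- The instantaneous cost along the trajectory. -/
def pathCost (ξ : S.Sources Ω) (φ : S.Strategy) (t : ℕ) (ω : Ω) : ℝ≥0∞ :=
  ENNReal.ofReal (S.cost t (state0 ξ φ t ω) (state1 ξ φ t ω) (ξ.M0 t ω) (ξ.M1 t ω)
    (action0 ξ φ t ω) (action1 ξ φ t ω))

/-- The instantaneous cost as a function of the common information, local state and mode. -/
def histCost (φ : S.Strategy) (t : ℕ) (h : S.Hist t) (x : Vec S.dX1) (m : Fin S.κ1) : ℝ≥0∞ :=
  ENNReal.ofReal (S.cost t h.x0 x h.m0 m (φ.act t h) (φ.presc t h (x, m)))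

lemma measurable_histCost (hφ : IsMeasurable φ) (ht : t ≤ S.T) {α : Type*} [MeasurableSpace α]
    {h : α → S.Hist t} {x : α → Vec S.dX1} {m : α → Fin S.κ1} (hh : Measurable h)
    (hx : Measurable x) (hm : Measurable m) :
    Measurable fun a => histCost φ t (h a) (x a) (m a) := by
  have h1 := (hφ.presc t ht).comp (hh.prodMk (hx.prodMk hm))
  simp only [Function.comp_def] at h1
  exact measurable_cost_comp ht (measurable_hist_x0.comp hh) hx (measurable_hist_m0.comp hh) hm
    ((hφ.act t ht).comp hh) h1

lemma pathCost_eq (t : ℕ) (ω : Ω) :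
    pathCost ξ φ t ω = histCost φ t (commonInfo ξ φ t ω) (state1 ξ φ t ω) (ξ.M1 t ω) := by
  rw [pathCost, histCost, commonInfo_m0]
  rfl

lemma measurable_pathCost (hξ : ξ.Admissible P) (hφ : IsMeasurable φ) (ht : t ≤ S.T) :
    Measurable (pathCost ξ φ t) := by
  rw [funext (pathCost_eq t)]
  obtain ⟨hH, hX⟩ := measurable_commonInfo_state1 hξ hφ ht
  exact measurable_histCost hφ ht hH hX (measurable_M1 hξ ht)

lemma measurable_presc_apply (hφ : IsMeasurable φ) (ht : t ≤ S.T) (h : S.Hist t) :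
    Measurable (φ.presc t h) := by
  simpa only [Function.comp_def] using (hφ.presc t ht).comp (measurable_prodMk_left (x := h))

/-- The tower property: the expected stage value is the expected cost plus the expected value at
the next time. -/
lemma lintegral_pathStage (hξ : ξ.Admissible P) (hφ : IsMeasurable φ) (ht : t + 1 ≤ S.T)
    {V : ℕ → S.ValueFn} (hV : S.SolvesDP V) :
    ∫⁻ ω, pathStage ξ φ P V t ω ∂P =
      ∫⁻ ω, pathCost ξ φ t ω ∂P + ∫⁻ ω, pathValue ξ φ P V (t + 1) ω ∂P := by
  have htT : t ≤ S.T := by omega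
  have := (S.isBelief_πW0 t htT).1
  have := (S.isBelief_πW1 t htT).1
  set κ := beliefKernel ξ φ P t with hκ
  have hmk := isMarkovKernel_filterKernel hφ htT κ
  have hext : Measurable fun h : S.Hist (t + 1) =>
      (V (t + 1)).ext h.x0 h.m0 (filterKernel φ κ h) h.zTilde :=
    (hV.isQuadratic (by omega)).measurable_ext _ measurable_hist_x0 measurable_hist_m0
      measurable_hist_zTilde
  let K : S.Hist t × (Vec S.dX1 × Fin S.κ1 × Vec S.dX1) ×
      (Vec S.dX0 × Fin S.κ0 × Fin S.κ1 × Bool) → ℝ≥0∞ := fun a =>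
    histCost φ t a.1 a.2.1.1 a.2.1.2.1 +
      (V (t + 1)).ext (stepHist φ t a.1 a.2.1 a.2.2).x0 (stepHist φ t a.1 a.2.1 a.2.2).m0
        (filterKernel φ κ (stepHist φ t a.1 a.2.1 a.2.2)) (stepHist φ t a.1 a.2.1 a.2.2).zTilde
  have hK : Measurable K := by
    have h1 := hext.comp (measurable_stepHist (hφ.act t htT) (hφ.presc t htT))
    simp only [Function.comp_def] at h1
    exact (measurable_histCost hφ htT measurable_fst (by fun_prop) (by fun_prop)).add h1
  rw [← lintegral_add_left (measurable_pathCost hξ hφ htT)]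
  have e1 : ∫⁻ ω, (pathCost ξ φ t ω + pathValue ξ φ P V (t + 1) ω) ∂P =
      ∫⁻ ω, K (commonInfo ξ φ t ω, (state1 ξ φ t ω, ξ.M1 t ω, ξ.W1 t ω),
        (ξ.W0 t ω, ξ.M0 (t + 1) ω, ξ.M1 (t + 1) ω, ξ.link (t + 1) ω)) ∂P := by
    -- The true conditional law at the next time is replaced by the filter almost surely, which
    -- turns the integrand into a function of the variables of `lintegral_step`.
    refine lintegral_congr_ae ?_
    filter_upwards [beliefKernel_succ_ae_eq hξ hφ ht] with ω hω
    simp only [K]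
    rw [pathCost_eq, pathValue, hω, ← commonInfo_succ]
  rw [e1, lintegral_step hξ hφ ht hK]
  refine lintegral_congr fun ω => ?_
  set h := commonInfo ξ φ t ω with hh
  have hKh : Measurable fun a : (Vec S.dX1 × Fin S.κ1 × Vec S.dX1) ×
      (Vec S.dX0 × Fin S.κ0 × Fin S.κ1 × Bool) => K (h, a.1, a.2) := hK.comp (by fun_prop)
  rw [localKernel_apply htT]
  refine Eq.trans ?_ (lintegral_prod_reorder _ _ _ _ _ hKh)
  refine lintegral_congr fun a => ?_
  obtain ⟨x1, m1, w0, w1, m0', m1', γ⟩ := a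
  simp only [K, filterKernel_stepHist hφ htT]
  rfl

/-- The common belief has a finite second moment. -/
lemma ae_isBelief (hξ : ξ.Admissible P) (hφ : IsMeasurable φ) (ht : t ≤ S.T)
    (hL : MemLp (state1 ξ φ t) 2 P) :
    ∀ᵐ ω ∂P, IsBelief (beliefKernel ξ φ P t (commonInfo ξ φ t ω)) := by
  obtain ⟨hH, hX⟩ := measurable_commonInfo_state1 hξ hφ ht
  have hF : Measurable fun a : S.Hist t × Vec S.dX1 => ‖a.2‖ₑ ^ 2 := by fun_prop
  have h1 := lintegral_state hξ hφ ht hF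
  have h2 : ∫⁻ ω, ‖state1 ξ φ t ω‖ₑ ^ 2 ∂P ≠ ∞ := by
    have := ((memLp_two_iff_integrable_sq_norm hL.1).1 hL).2
    simpa [HasFiniteIntegral] using this.ne
  have hm : Measurable fun ω =>
      ∫⁻ x, ‖x‖ₑ ^ 2 ∂(beliefKernel ξ φ P t (commonInfo ξ φ t ω)) :=
    (hF.lintegral_kernel_prod_right' (κ := beliefKernel ξ φ P t)).comp hH
  filter_upwards [ae_lt_top hm (h1 ▸ h2)] with ω hω
  refine ⟨inferInstance, (memLp_two_iff_integrable_sq_norm (by fun_prop)).2 ⟨by fun_prop, ?_⟩⟩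
  simpa [HasFiniteIntegral] using hω

/-- The last stage is treated apart: `Sources.Admissible` says nothing about modes and link at time
T + 1, and none are needed since the terminal value is zero. -/
lemma lintegral_pathStage_last (hξ : ξ.Admissible P) (hφ : IsMeasurable φ)
    (hL : MemLp (state1 ξ φ S.T) 2 P) {V : ℕ → S.ValueFn} (hV : S.SolvesDP V) :
    ∫⁻ ω, pathStage ξ φ P V S.T ω ∂P = ∫⁻ ω, pathCost ξ φ S.T ω ∂P := by
  have hF : Measurable fun a : (S.Hist S.T × Vec S.dX1) × Fin S.κ1 =>
      histCost φ S.T a.1.1 a.1.2 a.2 :=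
    measurable_histCost hφ le_rfl (by fun_prop) (by fun_prop) (by fun_prop)
  simp only [pathCost_eq]
  rw [lintegral_state_mode hξ hφ le_rfl hF]
  refine lintegral_congr_ae ?_
  filter_upwards [ae_isBelief hξ hφ le_rfl hL] with ω hω
  rw [pathStage, stageValue_terminal hV.terminal le_rfl hω
    (measurable_presc_apply hφ le_rfl _)]
  simp only [lintegral_fintype, histCost]
  rw [lintegral_finsetSum]
  · refine Finset.sum_congr rfl fun m _ => ?_
    rw [lintegral_mul_const _ (measurable_cost_presc le_rfl
      (measurable_presc_apply hφ le_rfl _) _ _ m), mul_comm]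
  · intro m _
    exact (measurable_cost_presc le_rfl (measurable_presc_apply hφ le_rfl _) _ _ m).mul_const _

/-- Feasibility enters through the second moment of the local state: it keeps the beliefs almost
surely in Δ, outside of which the path value would be ∞. -/
lemma ae_pathValue_le_pathStage (hξ : ξ.Admissible P) (hφ : IsMeasurable φ) (ht : t ≤ S.T)
    (hL : MemLp (state1 ξ φ t) 2 P) {V : ℕ → S.ValueFn} (hV : S.SolvesDP V) :
    ∀ᵐ ω ∂P, pathValue ξ φ P V t ω ≤ pathStage ξ φ P V t ω := by
  filter_upwards [ae_isBelief hξ hφ ht hL] with ω hω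
  rw [pathValue, ValueFn.ext, dif_pos hω]
  exact IsDPStep.ofReal_le_stageValue (hV.step t ht) (hV.isQuadratic (by omega)) ht _ _ ⟨_, hω⟩ _ _
    (measurable_presc_apply hφ ht _)

lemma ae_pathStage_le_pathValue (hξ : ξ.Admissible P) (hφ : IsMeasurable φ) (ht : t ≤ S.T)
    (hL : MemLp (state1 ξ φ t) 2 P) {V : ℕ → S.ValueFn} (hmin : AchievesMin ξ φ P V) :
    ∀ᵐ ω ∂P, pathStage ξ φ P V t ω ≤ pathValue ξ φ P V t ω := by
  filter_upwards [ae_isBelief hξ hφ ht hL, hmin t ht] with ω hω h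
  obtain ⟨qb, -, qt, -, hpresc, heq⟩ := h hω
  rw [pathValue, ValueFn.ext, dif_pos hω, pathStage, hpresc]
  refine EReal.coe_ennreal_le_coe_ennreal_iff.1 ?_
  rw [EReal.coe_ennreal_ofReal]
  exact heq.le.trans (EReal.coe_le_coe_iff.2 (le_max_left _ _))

lemma Feasible.isMeasurable (hφ : Feasible ξ φ P) : IsMeasurable φ :=
  ⟨hφ.measurable_act, hφ.measurable_presc⟩

lemma totalCost_eq_sum (hξ : ξ.Admissible P) (hφ : IsMeasurable φ) :
    totalCost ξ φ P = ∑ t ∈ Finset.range (S.T + 1), ∫⁻ ω, pathCost ξ φ t ω ∂P :=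
  lintegral_finsetSum _ fun _ ht =>
    measurable_pathCost hξ hφ (Nat.lt_succ_iff.1 (Finset.mem_range.1 ht))

/-- No feasible strategy does better than the value function. -/
lemma lintegral_pathValue_le_totalCost (hξ : ξ.Admissible P) (hφ : Feasible ξ φ P)
    {V : ℕ → S.ValueFn} (hV : S.SolvesDP V) :
    ∫⁻ ω, pathValue ξ φ P V 0 ω ∂P ≤ totalCost ξ φ P := by
  have hm := hφ.isMeasurable
  have hle : ∀ t ≤ S.T, ∫⁻ ω, pathValue ξ φ P V t ω ∂P ≤ ∫⁻ ω, pathStage ξ φ P V t ω ∂P :=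
    fun t ht => lintegral_mono_ae (ae_pathValue_le_pathStage hξ hm ht (hφ.memLp_state1 t ht) hV)
  have key : ∀ t ≤ S.T, ∫⁻ ω, pathValue ξ φ P V 0 ω ∂P ≤
      ∑ s ∈ Finset.range t, ∫⁻ ω, pathCost ξ φ s ω ∂P + ∫⁻ ω, pathValue ξ φ P V t ω ∂P := by
    intro t
    induction t with
    | zero => simp
    | succ t ih =>
      intro ht
      refine (ih (by omega)).trans ?_
      rw [Finset.sum_range_succ, add_assoc, ← lintegral_pathStage hξ hm ht hV]
      exact add_le_add le_rfl (hle t (by omega))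
  rw [totalCost_eq_sum hξ hm, Finset.sum_range_succ,
    ← lintegral_pathStage_last hξ hm (hφ.memLp_state1 _ le_rfl) hV]
  refine (key S.T le_rfl).trans ?_
  exact add_le_add le_rfl (hle S.T le_rfl)

/-- A strategy that achieves the minima attains the value function. -/
lemma totalCost_le_lintegral_pathValue (hξ : ξ.Admissible P) (hφ : Feasible ξ φ P)
    {V : ℕ → S.ValueFn} (hV : S.SolvesDP V) (hmin : AchievesMin ξ φ P V) :
    totalCost ξ φ P ≤ ∫⁻ ω, pathValue ξ φ P V 0 ω ∂P := by
  have hm := hφ.isMeasurable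
  have hle : ∀ t ≤ S.T, ∫⁻ ω, pathStage ξ φ P V t ω ∂P ≤ ∫⁻ ω, pathValue ξ φ P V t ω ∂P :=
    fun t ht => lintegral_mono_ae (ae_pathStage_le_pathValue hξ hm ht (hφ.memLp_state1 t ht) hmin)
  have key : ∀ t ≤ S.T,
      ∑ s ∈ Finset.range t, ∫⁻ ω, pathCost ξ φ s ω ∂P + ∫⁻ ω, pathValue ξ φ P V t ω ∂P ≤
        ∫⁻ ω, pathValue ξ φ P V 0 ω ∂P := by
    intro t
    induction t with
    | zero => simp
    | succ t ih =>
      intro ht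
      refine le_trans ?_ (ih (by omega))
      rw [Finset.sum_range_succ, add_assoc, ← lintegral_pathStage hξ hm ht hV]
      exact add_le_add le_rfl (hle t (by omega))
  rw [totalCost_eq_sum hξ hm, Finset.sum_range_succ,
    ← lintegral_pathStage_last hξ hm (hφ.memLp_state1 _ le_rfl) hV]
  refine le_trans ?_ (key S.T le_rfl)
  exact add_le_add le_rfl (hle S.T le_rfl)

end System

end SwitchedNCS

end

theorem theorem2 {Ω : Type*} [MeasurableSpace Ω] (P : Measure Ω) [IsProbabilityMeasure P]
    (S : System) (ξ : S.Sources Ω) (hξ : ξ.Admissible P)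
    (V : ℕ → S.ValueFn) (hV : S.SolvesDP V)
    (φ : S.Strategy) (hφ : System.Feasible ξ φ P)
    (hmin : System.AchievesMin ξ φ P V) :
    System.IsOptimal ξ φ P :=
  -- The two bounds meet because H⁰_0 and X¹_0, hence the path value at time 0, are by definition
  -- the same for both strategies.
  ⟨hφ, fun _ hφ' => (System.totalCost_le_lintegral_pathValue hξ hφ hV hmin).trans
    (System.lintegral_pathValue_le_totalCost hξ hφ' hV)⟩
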